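/- Let $T_3$ denote the $3$-regular tree. It is a Cayley graph of some group. Let $\Gamma$ be any group and $S\subseteq\Gamma$ such that the Cayley graph of $\Gamma$ with respect to $S$ (in which $x\sim xs$ for $s\in S$) is $T_3$. For a set $A$ the group $\Gamma$ acts on $A^\Gamma$ by $(\gamma L)(x)=L(\gamma^{-1}x)$. Let $U=(U_v)_{v\in\Gamma}$ be i.i.d. uniform on $[0,1]$; a *factor* of $U$ is a random object $f(U)$ with $f$ a measurable $\Gamma$-equivariant map defined on $[0,1]^\Gamma$. Clusters of a vertex labeling of a graph are the connected components left after deleting all edges between vertices of different labels. A tree is *forking* if it has a vertex whose deletion leaves at least three infinite components. Then there are a factor $\Lambda=f(U)\in[0,1]^\Gamma$, factors $\Pi_0,\Pi_1,\dots$ that are partitions of $\Gamma$, and factors $g_1,g_2,\dots\in\{0,1\}^\Gamma$, such that: 1. for every $v\in\Gamma$, $\Lambda(v)$ is uniform on $[0,1]$; 2. for every realization of $U$ and every vertex $v$, the $\Lambda$-cluster of $v$ in $T_3$ is infinite. Moreover $\Lambda$ arises bit by bit. Let $\Lambda_i(v)$ be the $i$-th binary digit of $\Lambda(v)$ (using the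 expansion with infinitely many $1$'s for positive numbers, and all digits $0$ for the number $0$), and let $F_n$ be the spanning forest of $T_3$ formed by the clusters of the labeling $(\Lambda_1,\dots,\Lambda_n)$ (so $F_0=T_3$). For every $n\ge 0$: 3. $\Lambda_{n+1}$ and $1-\Lambda_{n+1}$ have the same law, and for each $v$ the bit $\Lambda_{n+1}(v)$ is fair and independent of the family $(\Lambda_i(x))_{1\le i\le n,\;x\in\Gamma}$ of earlier bits; 4. almost surely, the cells of $\Pi_n$ are finite and connected in $T_3$, each tree of $F_n$ is a union of $\Pi_n$-cells, $\Pi_n$ refines $\Pi_{n+1}$, and each coarse-grained tree, obtained from a tree of $F_n$ by contracting every $\Pi_n$-cell to a point, has minimal degree at least $4$; 5. $g_{n+1}$ is a Bernoulli$(1/2)$ percolation on these coarse-grained trees: almost surely it is constant on $\Pi_n$-cells, and conditionally on $\Pi_0,\dots,\Pi_n$, $g_1,\dots,g_n$, $\Lambda_1,\dots,\Lambda_n$ its values on the distinct $\Pi_n$-cells are i.i.d. fair bits; 6. almost surely $\Lambda_{n+1}$ is obtained from $g_{n+1}$ by the following deterministic equivariant merging inside the trees of $F_n$: in each round, all vertices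 of every non-forking cluster that is at distance one in its tree of $F_n$ from a forking cluster switch their label; the rounds are iterated with the clusters recomputed, and $\Lambda_{n+1}(v)$ is the value at which the label of $v$ stabilizes; 7. almost surely all trees of $F_{n+1}$ are forking. In particular the answer to the following question of Gaboriau is negative: if a factor of i.i.d. uniform labels on a Cayley graph has uniform marginals, are almost surely all clusters of equal labels finite? -/

import Mathlib

open MeasureTheory Filter

namespace FactorIID

/-- The left translate `γ L` of a labeling `L` of the elements of a group. -/
def translate {Γ α : Type*} [Group Γ] (γ : Γ) (L : Γ → α) : Γ → α := fun x => L (γ⁻¹ * x)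

/-- The law of a family of i.i.d. labels, each uniform on `[0,1]`, indexed by `Γ`. -/
noncomputable def iidUniform (Γ : Type*) : Measure (Γ → unitInterval) :=
  Measure.infinitePi (fun _ : Γ => (volume : Measure unitInterval))

/-- A measurable equivariant map from `[0,1]`-labelings to `α`-labelings.  Applied to an i.i.d.
uniform labeling, it produces a factor of i.i.d. labeling. -/
structure IsFactor {Γ α : Type*} [Group Γ] [MeasurableSpace α]
    (f : (Γ → unitInterval) → (Γ → α)) : Prop where
  measurable : Measurable f
  equivariant : ∀ (γ : Γ) (ω : Γ → unitInterval), f (translate γ ω) = translate γ (f ω)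

/-- A measurable equivariant map from `[0,1]`-labelings to partitions of `Γ`. -/
structure IsFactorPartition {Γ : Type*} [Group Γ]
    (p : (Γ → unitInterval) → Setoid Γ) : Prop where
  measurable : ∀ x y : Γ, MeasurableSet {ω | (p ω).r x y}
  equivariant : ∀ (γ : Γ) (ω : Γ → unitInterval) (x y : Γ),
    (p (translate γ ω)).r x y ↔ (p ω).r (γ⁻¹ * x) (γ⁻¹ * y)

/-- The 3-regular tree. -/
def IsCubicTree {V : Type*} (T : SimpleGraph V) : Prop :=
  T.IsTree ∧ ∀ v, (T.neighborSet v).encard = 3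

/-- The `i`-th binary digit (`i ≥ 1`) of a number in `[0,1]`, using for a positive number the binary
expansion with infinitely many ones; the digits of `0` are all zero (here the subtraction
truncates). -/
noncomputable def binDigit (i : ℕ) (x : unitInterval) : Bool :=
  decide ((⌈(2 : ℝ) ^ i * (x : ℝ)⌉₊ - 1) % 2 = 1)

/-- The graph obtained from `H` by deleting the edges between vertices of different labels; its
connected components are the clusters of the labeling. -/
def clust {V α : Type*} (H : SimpleGraph V) (L : V → α) : SimpleGraph V where
  Adj x y := H.Adj x y ∧ L x = L y
  symm := ⟨fun _ _ h => ⟨h.1.symm, h.2.symm⟩⟩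
  loopless := ⟨fun _ h => h.1.ne rfl⟩

/-- `v` is a furcation of the tree `H`: deleting `v` leaves at least three infinite components. -/
def IsFurcation {V : Type*} (H : SimpleGraph V) (v : V) : Prop :=
  3 ≤ {c : (H.induce {v}ᶜ).ConnectedComponent | c.supp.Infinite}.encard

/-- A tree is forking if it has a furcation. -/
def IsForking {V : Type*} (H : SimpleGraph V) : Prop := ∃ v, IsFurcation H v

/-- The component of the forest `H` that contains `v` is a forking tree. -/
def InForking {V : Type*} (H : SimpleGraph V) (v : V) : Prop :=
  IsForking (H.connectedComponentMk v).toSimpleGraph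

open Classical in
/-- One round of the merging: every non-forking cluster of `L` (inside a tree of the forest `F`)
which is at distance one (in that tree) from a forking cluster switches its label. -/
noncomputable def mergeStep {V : Type*} (F : SimpleGraph V) (L : V → Bool) : V → Bool := fun v =>
  if ¬ InForking (clust F L) v ∧
      ∃ x y, (clust F L).Reachable v x ∧ F.Adj x y ∧ InForking (clust F L) y
  then !(L v) else L v

/-- `L'` is the result of merging non-forking clusters of `L` into forking ones: at each vertex the
iterated rounds of merging stabilize at the label given by `L'`. -/
def IsMergeOf {V : Type*} (F : SimpleGraph V) (L L' : V → Bool) : Prop :=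
  ∀ v, ∀ᶠ k : ℕ in atTop, (mergeStep F)^[k] L v = L' v

/-- The graph on the cells of a partition in which two distinct cells are adjacent if they are
joined by an edge of `H`. -/
def coarseGraph {V : Type*} (H : SimpleGraph V) (s : Setoid V) : SimpleGraph (Quotient s) where
  Adj a b := a ≠ b ∧ ∃ x y, Quotient.mk s x = a ∧ Quotient.mk s y = b ∧ H.Adj x y
  symm := ⟨fun _ _ h => ⟨h.1.symm, by
    obtain ⟨_, x, y, hx, hy, hxy⟩ := h
    exact ⟨y, x, hy, hx, hxy.symm⟩⟩⟩
  loopless := ⟨fun _ h => h.1 rfl⟩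

/-- The cells of `s` are finite and connected in `T`, every tree of the spanning forest `F` is a
union of cells, and the coarse-grained trees on the cells have minimal degree at least `4`. -/
structure IsCoarseGraining {V : Type*} (T F : SimpleGraph V) (s : Setoid V) : Prop where
  finite : ∀ x, {y | s.r x y}.Finite
  connected : ∀ x, (T.induce {y | s.r x y}).Connected
  compatible : ∀ x y, s.r x y → F.Reachable x y
  four_le_degree : ∀ c, 4 ≤ ((coarseGraph F s).neighborSet c).encard

/-- Given the information in the sigma-algebra `past` (which is meant to determine the random
partition `p`), the labels `g` are i.i.d. fair bits over the cells of `p`, that is, `g` is a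
Bernoulli(1/2) percolation on the coarse-grained graph. -/
def IsFairCellLabeling {Ω V : Type*} [MeasurableSpace Ω] (P : Measure Ω)
    (past : MeasurableSpace Ω) (p : Ω → Setoid V) (g : Ω → V → Bool) : Prop :=
  (∀ᵐ ω ∂P, ∀ x y, (p ω).r x y → g ω x = g ω y) ∧
  ∀ (A : Finset V) (ε : V → Bool) (E : Set Ω), MeasurableSet[past] E →
    (∀ ω ∈ E, ∀ x ∈ A, ∀ y ∈ A, x ≠ y → ¬ (p ω).r x y) →
    P (E ∩ {ω | ∀ x ∈ A, g ω x = ε x}) = (1 / 2) ^ A.card * P E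

/-- The sigma-algebra generated by the partitions `p 0, …, p n`, the preliminary labelings
`g 0, …, g (n - 1)` and the first `n` bits of the labeling `f`. -/
abbrev past {Ω V : Type*} (f : Ω → V → unitInterval) (p : ℕ → Ω → Setoid V)
    (g : ℕ → Ω → V → Bool) (n : ℕ) : MeasurableSpace Ω :=
  MeasurableSpace.generateFrom
    ({E | ∃ k ≤ n, ∃ x y, E = {ω | (p k ω).r x y}} ∪
     {E | ∃ k < n, ∃ x, E = {ω | g k ω x = true}} ∪
     {E | ∃ k < n, ∃ x, E = {ω | binDigit (k + 1) (f ω x) = true}})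

/-- The first `n` binary digits of the labels. -/
noncomputable def firstBits {V : Type*} (n : ℕ) (L : V → unitInterval) : V → Fin n → Bool :=
  fun v i => binDigit (i + 1) (L v)

/-- The `(n + 1)`-st binary digit of the labels. -/
noncomputable def nextBit {V : Type*} (n : ℕ) (L : V → unitInterval) : V → Bool :=
  fun v => binDigit (n + 1) (L v)

end FactorIID

/-!
The construction uses the binary digits of the i.i.d. uniform labels, which form a family
`z : Γ × ℕ → Bool` of fair bits: those of even index, counted from zero, serve as the bits
`bitOf z n` of the successive steps, and those of odd index as labels `labOf z`, almost
surely distinct, that break all ties. Given the forest `forest T z n` of the first `n` bits, with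
all trees forking, step `n` is as follows.

*Coarsening.* Almost surely each tree of the forest has infinitely many furcations: otherwise all
its vertices could send unit mass to one of finitely many furcations, chosen by the labels, which
the mass transport principle `ae_finite_of_equivariant` excludes. Hence each tree contains finite
connected unions of old cells with furcations in two of the cells. Such a set is isolated by some
code, out of countably many, from the others that meet it; the sets isolated by the first code that
occurs in their tree are disjoint, and serve as seeds. The remaining old cells then join adjacent
seeds, round by round. By mass transport again, the resulting new cells are finite. Each contains
two furcations, and thus has at least four neighboring cells, in two infinite branches at each of
the furcations (`four_le_neighborSet`).

*Percolation.* Each coarse-grained tree has minimal degree at least four, so it contains a ternary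
tree. In a Bernoulli(1/2) percolation on the ternary tree, a given vertex starts an infinite
downward path of ones with positive probability. Let `p` be the probability that no vertex has
label one and three children that all start such paths. Then `p < 1`, and `p ≤ p ^ 3`, because the
three subtrees below the root are independent; so `p = 0` (`ae_hasTriple`). Hence each tree almost
surely contains a forking cluster; the furcation is a median of three exits of a cell
(`exists_isBranching_of_exits`).

*Merging.* No forking cluster ever loses a vertex, and after `k` rounds all vertices at distance
`k` from an initial forking cluster are in forking clusters. So the labels stabilize, and all
clusters of the limit are forking (`isMergeOf_mergeLim`, `inForking_mergeLim`).

Flipping all bits of step `n` preserves their law and leaves everything determined before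
unchanged, while it turns the percolation, and with it the result of the merging, into the opposite
labeling. So the new bit of a vertex is fair and independent of the past (`fair_inter_bit_mem`). It
follows that the digits of a label are independent fair bits, so that the label is uniform.
Finally, all bits are constant along the edges inside a cell: those of earlier steps because the
cell lies in one tree, those of its own and later steps because the later cells contain it. The
cells increase strictly from step to step, so that each cluster of the complete labeling contains
an increasing union of cells, and is infinite (`infinite_cluster`). On the null event where
something fails, a constant labeling is used instead.
-/

namespace FactorIID

section

/-! ### Forests, branches and furcations -/

variable {V : Type*}

/-- The graph on all of `V` that keeps exactly the edges of `H` with both endpoints in `C`. -/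
def within (H : SimpleGraph V) (C : Set V) : SimpleGraph V where
  Adj x y := H.Adj x y ∧ x ∈ C ∧ y ∈ C
  symm := ⟨fun _ _ h => ⟨h.1.symm, h.2.2, h.2.1⟩⟩
  loopless := ⟨fun _ h => h.1.ne rfl⟩

/-- The vertices that can be reached from `a` without visiting `u`. -/
def branch (H : SimpleGraph V) (u a : V) : Set V := {w | (within H {u}ᶜ).Reachable a w}

/-- `u` has three neighbors from which infinitely many vertices can be reached while avoiding `u`.
In a forest this says that `u` is a furcation of its tree; unlike the definition through components
of induced subgraphs, it is visibly monotone in the forest. -/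
def IsBranching (H : SimpleGraph V) (u : V) : Prop :=
  ∃ a : Fin 3 → V, Function.Injective a ∧ ∀ i, H.Adj u (a i) ∧ (branch H u (a i)).Infinite

theorem within_le (H : SimpleGraph V) (C : Set V) : within H C ≤ H := fun _ _ h => h.1

theorem within_mono {H H' : SimpleGraph V} {C C' : Set V} (h : H ≤ H') (hC : C ⊆ C') :
    within H C ≤ within H' C' := fun _ _ h' => ⟨h h'.1, hC h'.2.1, hC h'.2.2⟩

theorem clust_le {α : Type*} (H : SimpleGraph V) (L : V → α) : clust H L ≤ H := fun _ _ h => h.1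

/-- Induction along a walk, one edge at a time. -/
theorem reachable_induction {H : SimpleGraph V} {x : V} {P : V → Prop} (h0 : P x)
    (hs : ∀ y z, H.Reachable x y → P y → H.Adj y z → P z) {y : V} (h : H.Reachable x y) : P y := by
  rw [SimpleGraph.reachable_iff_reflTransGen] at h
  induction h with
  | refl => exact h0
  | tail h1 h2 ih => exact hs _ _ ((SimpleGraph.reachable_iff_reflTransGen _ _).2 h1) ih h2

theorem reachable_step {H : SimpleGraph V} {x y z : V} (h : H.Reachable x y) (h' : H.Adj y z) :
    H.Reachable x z := h.trans h'.reachable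

theorem mem_of_within_reachable {H : SimpleGraph V} {C : Set V} {x y : V} (hx : x ∈ C)
    (h : (within H C).Reachable x y) : y ∈ C :=
  reachable_induction (H := within H C) (P := (· ∈ C)) hx (fun _ _ _ _ h => h.2.2) h

/-- Reachability only needs the edges among vertices that are themselves reachable. -/
theorem reachable_of_adj_imp {H H' : SimpleGraph V} {x y : V} (h : H.Reachable x y)
    (hh : ∀ a b, H.Reachable x a → H.Adj a b → H'.Adj a b) : H'.Reachable x y :=
  reachable_induction (P := H'.Reachable x) (SimpleGraph.Reachable.refl x)
    (fun y z h1 h2 h3 => reachable_step h2 (hh y z h1 h3)) h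

theorem induce_reachable_iff {H : SimpleGraph V} {C : Set V} (x y : C) :
    (H.induce C).Reachable x y ↔ (within H C).Reachable x y := by
  constructor
  · intro h
    refine reachable_induction (P := fun z : C => (within H C).Reachable x z)
      (SimpleGraph.Reachable.refl _) ?_ h
    intro a b _ h2 h3
    exact reachable_step h2 ⟨h3, a.2, b.2⟩
  · intro h
    have : ∀ z, (within H C).Reachable (x : V) z → ∀ hz : z ∈ C,
        (H.induce C).Reachable x ⟨z, hz⟩ := by
      intro z hz
      refine reachable_induction (P := fun z => ∀ hz : z ∈ C,
        (H.induce C).Reachable x ⟨z, hz⟩) (fun _ => SimpleGraph.Reachable.refl _) ?_ hz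
      intro a b _ h2 h3 hb
      exact reachable_step (h2 h3.2.1) h3.1
    exact this y h y.2

theorem exists_adj_reachable_avoiding {H : SimpleGraph V} {u x : V} (h : H.Reachable u x)
    (hx : x ≠ u) : ∃ a, H.Adj u a ∧ (within H {u}ᶜ).Reachable a x := by
  have : x = u ∨ ∃ a, H.Adj u a ∧ (within H {u}ᶜ).Reachable a x := by
    refine reachable_induction (P := fun x => x = u ∨ ∃ a, H.Adj u a ∧
      (within H {u}ᶜ).Reachable a x) (Or.inl rfl) ?_ h
    intro y z _ h2 h3
    by_cases hz : z = u
    · exact Or.inl hz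
    by_cases hy : y = u
    · subst hy
      exact Or.inr ⟨z, h3, SimpleGraph.Reachable.refl _⟩
    · obtain ⟨a, ha, h4⟩ := h2.resolve_left hy
      exact Or.inr ⟨a, ha, reachable_step h4 ⟨h3, hy, hz⟩⟩
  exact this.resolve_left hx

/-- In a forest, distinct neighbors of `u` lie in distinct components of the complement of `u`. -/
theorem eq_of_reachable_avoiding {H : SimpleGraph V} (hH : H.IsAcyclic) {u a b : V}
    (ha : H.Adj u a) (hb : H.Adj u b) (h : (within H {u}ᶜ).Reachable a b) : a = b := by
  by_contra hab
  have := SimpleGraph.isAcyclic_iff_forall_adj_isBridge.1 hH ha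
  rw [SimpleGraph.isBridge_iff] at this
  refine this ?_
  have h1 : (H \ SimpleGraph.fromEdgeSet {s(u, a)}).Reachable a b := by
    refine h.mono ?_
    intro x y hxy
    refine ⟨hxy.1, fun h => ?_⟩
    have := h.1
    have h2 := hxy.2.1
    have h3 := hxy.2.2
    simp at this h2 h3
    tauto
  refine SimpleGraph.Reachable.trans (SimpleGraph.Adj.reachable (v := b) ⟨hb, fun h => ?_⟩) h1.symm
  have := h.1
  have h2 := hb.ne
  simp at this
  tauto

theorem branch_mono {H H' : SimpleGraph V} (h : H ≤ H') (u a : V) :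
    branch H u a ⊆ branch H' u a := fun _ hw => hw.mono (within_mono h subset_rfl)

theorem IsBranching.mono {H H' : SimpleGraph V} (h : H ≤ H') {u : V} (hu : IsBranching H u) :
    IsBranching H' u := by
  obtain ⟨a, ha, hh⟩ := hu
  exact ⟨a, ha, fun i => ⟨h (hh i).1, (hh i).2.mono (branch_mono h _ _)⟩⟩

theorem le_encard_iff_exists_fin {α : Type*} (s : Set α) (n : ℕ) :
    (n : ℕ∞) ≤ s.encard ↔ ∃ a : Fin n → α, Function.Injective a ∧ ∀ i, a i ∈ s := by
  constructor
  · intro h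
    obtain ⟨t, hts, ht⟩ := Set.exists_subset_encard_eq h
    have hf : t.Finite := Set.finite_of_encard_eq_coe ht
    obtain ⟨F, rfl⟩ := hf.exists_finset_coe
    rw [Set.encard_coe_eq_coe_finsetCard] at ht
    have ht' : F.card = n := by exact_mod_cast ht
    refine ⟨fun i => (F.equivFinOfCardEq ht').symm i, ?_, fun i => hts ?_⟩
    · exact Subtype.val_injective.comp (Equiv.injective _)
    · exact ((F.equivFinOfCardEq ht').symm i).2
  · rintro ⟨a, ha, hs⟩
    have : Set.range a ⊆ s := by rintro _ ⟨i, rfl⟩; exact hs i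
    refine le_trans ?_ (Set.encard_le_encard this)
    rw [← Set.image_univ, ha.encard_image]
    simp

theorem isFurcation_iff_isBranching {H : SimpleGraph V} (hH : H.IsAcyclic) (hc : H.Preconnected)
    (u : V) : IsFurcation H u ↔ IsBranching H u := by
  have key : ∀ x : ({u}ᶜ : Set V), Subtype.val ''
      ((H.induce {u}ᶜ).connectedComponentMk x).supp = branch H u x := by
    intro x
    ext w
    simp only [Set.mem_image, SimpleGraph.ConnectedComponent.mem_supp_iff,
      SimpleGraph.ConnectedComponent.eq, branch, Set.mem_ofPred_eq]
    constructor
    · rintro ⟨y, hy, rfl⟩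
      exact ((induce_reachable_iff _ _).1 hy).symm
    · intro h
      exact ⟨⟨w, mem_of_within_reachable x.2 h⟩, ((induce_reachable_iff _ _).2 h).symm, rfl⟩
  have keyinf : ∀ x : ({u}ᶜ : Set V), ((H.induce {u}ᶜ).connectedComponentMk x).supp.Infinite ↔
      (branch H u x).Infinite := by
    intro x
    rw [← key, Set.infinite_image_iff Subtype.val_injective.injOn]
  have h3 : IsFurcation H u ↔ _ :=
    le_encard_iff_exists_fin {c : (H.induce {u}ᶜ).ConnectedComponent | c.supp.Infinite} 3
  rw [h3]
  constructor
  · rintro ⟨c, hc1, hc2⟩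
    have : ∀ i, ∃ a, ∃ h : H.Adj u a, c i = (H.induce {u}ᶜ).connectedComponentMk ⟨a, h.ne'⟩ := by
      intro i
      obtain ⟨x, hx⟩ := (c i).exists_rep
      obtain ⟨a, ha, hr⟩ := exists_adj_reachable_avoiding (hc u x) x.2
      refine ⟨a, ha, ?_⟩
      rw [← hx]
      exact SimpleGraph.ConnectedComponent.sound ((induce_reachable_iff _ _).2 hr).symm
    choose a ha hca using this
    refine ⟨a, fun i j hij => hc1 ?_, fun i => ⟨ha i, ?_⟩⟩
    · rw [hca i, hca j]; congr 2
    · have := hc2 i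
      rw [hca i] at this
      exact (keyinf _).1 this
  · rintro ⟨a, ha, hh⟩
    refine ⟨fun i => (H.induce {u}ᶜ).connectedComponentMk ⟨a i, (hh i).1.ne'⟩, fun i j hij => ?_,
      fun i => ?_⟩
    · have := SimpleGraph.ConnectedComponent.exact hij
      rw [induce_reachable_iff] at this
      exact ha (eq_of_reachable_avoiding hH (hh i).1 (hh j).1 this)
    · exact (keyinf _).2 (hh i).2

theorem mem_branch_reachable {H : SimpleGraph V} {u a w : V} (ha : H.Adj u a)
    (h : w ∈ branch H u a) : H.Reachable u w :=
  ha.reachable.trans (SimpleGraph.Reachable.mono (within_le _ _) h)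

theorem isBranching_component {H : SimpleGraph V} (c : H.ConnectedComponent) (u : c.supp) :
    IsBranching (H.induce c.supp) u ↔ IsBranching H u := by
  have hmem : ∀ {x y : V}, x ∈ c.supp → H.Reachable x y → y ∈ c.supp := by
    intro x y hx h
    rw [SimpleGraph.ConnectedComponent.mem_supp_iff] at hx ⊢
    rw [← hx]
    exact (SimpleGraph.ConnectedComponent.sound h).symm
  have key : ∀ a : c.supp, Subtype.val '' branch (H.induce c.supp) u a = branch H u a := by
    intro a
    ext w
    constructor
    · rintro ⟨w, hw, rfl⟩
      refine reachable_induction (P := fun w : c.supp => (w : V) ∈ branch H u a)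
        (SimpleGraph.Reachable.refl _) ?_ hw
      intro x y _ h1 h2
      refine reachable_step h1 ⟨h2.1, ?_, ?_⟩
      · simpa [Subtype.ext_iff] using h2.2.1
      · simpa [Subtype.ext_iff] using h2.2.2
    · intro hw
      have : ∀ z, (within H {(u : V)}ᶜ).Reachable (a : V) z → ∃ hz : z ∈ c.supp,
          (within (H.induce c.supp) {u}ᶜ).Reachable a ⟨z, hz⟩ := by
        intro z hz
        refine reachable_induction (P := fun z => ∃ hz : z ∈ c.supp,
          (within (H.induce c.supp) {u}ᶜ).Reachable a ⟨z, hz⟩)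
          ⟨a.2, SimpleGraph.Reachable.refl _⟩ ?_ hz
        rintro x y _ ⟨hx, h2⟩ h3
        have hy := hmem hx h3.1.reachable
        refine ⟨hy, reachable_step h2 ⟨h3.1, ?_, ?_⟩⟩
        · simpa [Subtype.ext_iff] using h3.2.1
        · simpa [Subtype.ext_iff] using h3.2.2
      obtain ⟨hz, h⟩ := this w hw
      exact ⟨⟨w, hz⟩, h, rfl⟩
  have keyinf : ∀ a : c.supp, (branch (H.induce c.supp) u a).Infinite ↔
      (branch H u a).Infinite := by
    intro a
    rw [← key, Set.infinite_image_iff Subtype.val_injective.injOn]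
  constructor
  · rintro ⟨a, ha, hh⟩
    exact ⟨fun i => a i, Subtype.val_injective.comp ha, fun i => ⟨(hh i).1, (keyinf _).1 (hh i).2⟩⟩
  · rintro ⟨a, ha, hh⟩
    refine ⟨fun i => ⟨a i, hmem u.2 (hh i).1.reachable⟩, fun i j hij => ha (by simpa using hij),
      fun i => ⟨(hh i).1, (keyinf ⟨a i, _⟩).2 (hh i).2⟩⟩

/-- In a forest, the tree of `v` is forking iff it contains a branching vertex. -/
theorem inForking_iff {H : SimpleGraph V} (hH : H.IsAcyclic) (v : V) :
    InForking H v ↔ ∃ u, H.Reachable v u ∧ IsBranching H u := by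
  have hc : (H.connectedComponentMk v).toSimpleGraph.Preconnected :=
    (SimpleGraph.ConnectedComponent.connected_toSimpleGraph _).preconnected
  have ha : (H.connectedComponentMk v).toSimpleGraph.IsAcyclic := hH.induce _
  unfold InForking IsForking
  constructor
  · rintro ⟨u, hu⟩
    rw [isFurcation_iff_isBranching ha hc] at hu
    refine ⟨u, ?_, (isBranching_component _ u).1 hu⟩
    exact (SimpleGraph.ConnectedComponent.exact u.2).symm
  · rintro ⟨u, hu, hb⟩
    refine ⟨⟨u, SimpleGraph.ConnectedComponent.sound hu.symm⟩, ?_⟩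
    rw [isFurcation_iff_isBranching ha hc]
    exact (isBranching_component _ _).2 hb

/-! ### Furcations from exits of connected sets -/

theorem reachable_avoiding_of_length_lt {G : SimpleGraph V} {u a x : V} (p : G.Walk a x)
    (h : p.length < G.dist u x) : (within G {u}ᶜ).Reachable a x := by
  induction p with
  | nil => exact SimpleGraph.Reachable.refl _
  | @cons a b x hab q ih =>
    have h1 : q.length < G.dist u x := by
      rw [SimpleGraph.Walk.length_cons] at h; omega
    refine SimpleGraph.Reachable.trans (SimpleGraph.Adj.reachable (v := b) ⟨hab, ?_, ?_⟩) (ih h1)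
    · rintro rfl
      exact absurd (SimpleGraph.dist_le (SimpleGraph.Walk.cons hab q)) (not_le.2 h)
    · rintro rfl
      exact absurd (SimpleGraph.dist_le q) (not_le.2 h1)

/-- If three infinite pieces of the complement are attached to a connected set `C`, then `C`
contains a branching vertex: the median of the three attaching points, found by minimizing the sum
of the distances to them inside `C`. -/
theorem exists_isBranching_of_exits {H : SimpleGraph V} {C : Set V}
    (hC : ∀ x ∈ C, ∀ y ∈ C, (within H C).Reachable x y) (x y : Fin 3 → V)
    (hx : ∀ i, x i ∈ C) (hy : ∀ i, y i ∉ C) (hinj : Function.Injective y)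
    (hadj : ∀ i, H.Adj (x i) (y i))
    (hinf : ∀ i, {w | (within H Cᶜ).Reachable (y i) w}.Infinite) :
    ∃ u ∈ C, IsBranching H u := by
  let φ : V → ℕ := fun u => ∑ i, (within H C).dist u (x i)
  obtain ⟨u, huC, hmin⟩ : ∃ u ∈ C, ∀ v ∈ C, φ u ≤ φ v :=
    ⟨_, Function.argminOn_mem φ C ⟨x 0, hx 0⟩,
      fun v hv => Function.argminOn_le φ C hv⟩
  -- the first step `a` from `u` towards each of the three exits
  have step : ∀ i, ∃ a, H.Adj u a ∧ (within H {u}ᶜ).Reachable a (y i) ∧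
      ((u = x i ∧ a = y i) ∨ (u ≠ x i ∧ a ∈ C ∧ (within H C).Adj u a ∧
        (within H C).dist a (x i) + 1 ≤ (within H C).dist u (x i))) := by
    intro i
    by_cases hu : u = x i
    · exact ⟨y i, hu ▸ hadj i, SimpleGraph.Reachable.refl _, Or.inl ⟨hu, rfl⟩⟩
    · obtain ⟨p, hp⟩ := (hC u huC (x i) (hx i)).exists_walk_length_eq_dist
      cases p with
      | nil => exact absurd rfl hu
      | @cons _ a _ hua q =>
        rw [SimpleGraph.Walk.length_cons] at hp
        refine ⟨a, hua.1, ?_, Or.inr ⟨hu, hua.2.2, hua, ?_⟩⟩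
        · have h1 : (within (within H C) {u}ᶜ).Reachable a (x i) :=
            reachable_avoiding_of_length_lt q (by omega)
          refine reachable_step (h1.mono (within_mono (within_le _ _) subset_rfl))
            ⟨hadj i, fun h => hu h.symm, fun h => hy i ?_⟩
          rw [Set.mem_singleton_iff] at h
          rw [h]; exact huC
        · have := SimpleGraph.dist_le q
          omega
  choose a ha hr hcase using step
  refine ⟨u, huC, a, ?_, fun i => ⟨ha i, ?_⟩⟩
  · intro i j hij
    by_contra hne
    rcases hcase i with ⟨h1, h2⟩ | ⟨h1, h2, h3, h4⟩ <;>
    rcases hcase j with ⟨h1', h2'⟩ | ⟨h1', h2', h3', h4'⟩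
    · exact hne (hinj (by rw [← h2, ← h2', hij]))
    · exact hy i (by rw [← h2, hij]; exact h2')
    · exact hy j (by rw [← h2', ← hij]; exact h2)
    -- two equal first steps inside `C` would decrease the sum of the three distances
    · have key : ∀ k, (within H C).dist (a i) (x k) + ((if k = i then 2 else 0) +
          (if k = j then 2 else 0)) ≤ (within H C).dist u (x k) + 1 := by
        intro k
        by_cases hk : k = i
        · subst hk
          simp only [if_true, if_neg hne]
          omega
        by_cases hk' : k = j
        · subst hk'
          rw [← hij] at h4'
          simp only [if_true, if_neg hk]
          omega
        · simp only [if_neg hk, if_neg hk']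
          have := (hC u huC (x k) (hx k)).exists_walk_length_eq_dist
          obtain ⟨p, hp⟩ := this
          have := SimpleGraph.dist_le (SimpleGraph.Walk.cons h3.symm p)
          rw [SimpleGraph.Walk.length_cons] at this
          omega
      have hsum := Finset.sum_le_sum (fun k (_ : k ∈ Finset.univ) => key k)
      rw [Finset.sum_add_distrib, Finset.sum_add_distrib, Finset.sum_add_distrib] at hsum
      simp only [Finset.sum_ite_eq', Finset.mem_univ, if_true, Finset.sum_const, Finset.card_univ,
        Fintype.card_fin] at hsum
      have := hmin (a i) h2
      simp only [φ] at this
      simp at hsum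
      omega
  · refine (hinf i).mono ?_
    intro w hw
    refine (hr i).trans ?_
    refine SimpleGraph.Reachable.mono (within_mono le_rfl ?_) hw
    intro z hz h
    rw [Set.mem_singleton_iff] at h
    exact hz (h ▸ huC)

theorem exists_crossing {G : SimpleGraph V} {C : Set V} {a w : V} (h : G.Reachable a w)
    (ha : a ∈ C) (hw : w ∉ C) : ∃ x y, G.Reachable a x ∧ G.Adj x y ∧ x ∈ C ∧ y ∉ C := by
  by_contra hcon
  push Not at hcon
  exact hw (reachable_induction (P := (· ∈ C)) ha (fun y z h1 h2 h3 => hcon y z h1 h3 h2) h)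

/-- An infinite branch at a vertex of a finite set contains an exit of this set. -/
theorem exists_exit_in_branch {F : SimpleGraph V} {C : Set V} (hC : C.Finite) {u a : V}
    (hu : u ∈ C) (ha : F.Adj u a) (hinf : (branch F u a).Infinite) :
    ∃ x y, x ∈ C ∧ y ∉ C ∧ F.Adj x y ∧ y ∈ branch F u a := by
  by_cases haC : a ∈ C
  · obtain ⟨w, hw, hwC⟩ := (hinf.sdiff hC).nonempty
    obtain ⟨x, y, h1, h2, h3, h4⟩ := exists_crossing hw haC hwC
    exact ⟨x, y, h3, h4, h2.1, reachable_step h1 h2⟩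
  · exact ⟨u, a, hu, haC, ha, SimpleGraph.Reachable.refl _⟩

/-- At a branching vertex there are two infinite branches that miss a given vertex. -/
theorem IsBranching.exists_two_branches {F : SimpleGraph V} (hF : F.IsAcyclic) {u : V}
    (hu : IsBranching F u) (v : V) : ∃ a : Bool → V, Function.Injective a ∧
      ∀ i, F.Adj u (a i) ∧ (branch F u (a i)).Infinite ∧ v ∉ branch F u (a i) := by
  obtain ⟨a, ha, h⟩ := hu
  have hne : ∀ i j, i ≠ j → v ∈ branch F u (a i) → v ∉ branch F u (a j) := fun i j hij h1 h2 =>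
    hij (ha (eq_of_reachable_avoiding hF (h i).1 (h j).1 (h1.trans h2.symm)))
  obtain ⟨i, j, hij, hi, hj⟩ : ∃ i j, i ≠ j ∧ v ∉ branch F u (a i) ∧ v ∉ branch F u (a j) := by
    by_cases h0 : v ∈ branch F u (a 0)
    · exact ⟨1, 2, by decide, hne 0 1 (by decide) h0, hne 0 2 (by decide) h0⟩
    · by_cases h1 : v ∈ branch F u (a 1)
      · exact ⟨0, 2, by decide, h0, hne 1 2 (by decide) h1⟩
      · exact ⟨0, 1, by decide, h0, h1⟩
  refine ⟨fun b => if b then a i else a j, ?_, ?_⟩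
  · intro b c hbc
    cases b <;> cases c <;> simp at hbc ⊢
    · exact hij (ha hbc.symm)
    · exact hij (ha hbc)
  · intro b
    cases b
    · exact ⟨(h j).1, (h j).2, hj⟩
    · exact ⟨(h i).1, (h i).2, hi⟩

/-- Branches of distinct vertices that point away from each other are disjoint. -/
theorem disjoint_branches {F : SimpleGraph V} {u v a b : V} (huv : u ≠ v) (ha : F.Adj u a)
    (hv : v ∉ branch F u a) (hu : u ∉ branch F v b) : Disjoint (branch F u a) (branch F v b) := by
  rw [Set.disjoint_left]
  intro w hw hw'
  have h1 : (within F {v}ᶜ).Reachable a w := by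
    refine reachable_of_adj_imp hw fun x y hx hxy => ⟨hxy.1, ?_, ?_⟩
    · rintro rfl; exact hv hx
    · rintro rfl; exact hv (reachable_step hx hxy)
  refine hu (SimpleGraph.Reachable.trans hw' (h1.symm.trans (SimpleGraph.Adj.reachable
    ⟨ha.symm, ?_, huv⟩)))
  rintro rfl
  exact hv (SimpleGraph.Reachable.refl _)

/-- The cells of `s` are finite and connected in `F`. -/
structure FiniteConnectedCells (F : SimpleGraph V) (s : Setoid V) : Prop where
  finite : ∀ x, {y | s x y}.Finite
  connected : ∀ x y, s x y → (within F {z | s x z}).Reachable x y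

theorem FiniteConnectedCells.reachable {F : SimpleGraph V} {s : Setoid V}
    (h : FiniteConnectedCells F s) {x y z : V} (hy : s x y) (hz : s x z) :
    (within F {z | s x z}).Reachable y z := (h.connected x y hy).symm.trans (h.connected x z hz)

/-- A cell containing two branching vertices has at least four neighboring cells: each of the two
vertices has two infinite branches away from the other one, and the cell has an exit in each of
these four branches. -/
theorem four_le_neighborSet {F : SimpleGraph V} (hF : F.IsAcyclic) {s : Setoid V}
    (hs : FiniteConnectedCells F s) {x u v : V} (hxu : s x u) (hxv : s x v) (huv : u ≠ v)
    (hu : IsBranching F u) (hv : IsBranching F v) :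
    4 ≤ ((coarseGraph F s).neighborSet (Quotient.mk s x)).encard := by
  obtain ⟨a, hai, ha⟩ := hu.exists_two_branches hF v
  obtain ⟨b, hbi, hb⟩ := hv.exists_two_branches hF u
  have hexa := fun i => exists_exit_in_branch (hs.finite x) hxu (ha i).1 (ha i).2.1
  have hexb := fun i => exists_exit_in_branch (hs.finite x) hxv (hb i).1 (hb i).2.1
  choose xa ya hxa hya hadja hyba using hexa
  choose xb yb hxb hyb hadjb hybb using hexb
  have avoid : ∀ {y y' t : V}, ¬ s x y → s x t → s y y' → (within F {t}ᶜ).Reachable y y' := by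
    intro y y' t hy ht hyy'
    refine (hs.connected y y' hyy').mono (within_mono le_rfl ?_)
    intro z hz h
    rw [Set.mem_singleton_iff] at h
    subst h
    exact hy (s.trans' ht (s.symm' hz))
  have hab : ∀ i j, ¬ s (ya i) (yb j) := by
    intro i j hij
    have h1 : ya i ∈ branch F v (b j) := (hybb j).trans (avoid (hya i) hxv hij).symm
    exact Set.disjoint_left.1 (disjoint_branches huv (ha i).1 (ha i).2.2 (hb j).2.2) (hyba i) h1
  let q : Bool ⊕ Bool → Quotient s :=
    Sum.elim (fun i => Quotient.mk s (ya i)) (fun i => Quotient.mk s (yb i))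
  have hq : Function.Injective q := by
    rintro (i | i) (j | j) hij
    · have h1 : s (ya i) (ya j) := Quotient.exact hij
      have h2 := (hyba i).trans ((avoid (hya i) hxu h1).trans (hyba j).symm)
      rw [hai (eq_of_reachable_avoiding hF (ha i).1 (ha j).1 h2)]
    · exact absurd (Quotient.exact hij) (hab i j)
    · exact absurd (Setoid.symm' s (Quotient.exact hij)) (hab j i)
    · have h1 : s (yb i) (yb j) := Quotient.exact hij
      have h2 := (hybb i).trans ((avoid (hyb i) hxv h1).trans (hybb j).symm)
      rw [hbi (eq_of_reachable_avoiding hF (hb i).1 (hb j).1 h2)]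
  have hmem : ∀ i, q i ∈ (coarseGraph F s).neighborSet (Quotient.mk s x) := by
    rintro (i | i)
    · exact ⟨fun h => hya i (Quotient.exact h), xa i, ya i,
        (Quotient.sound (hxa i)).symm, rfl, hadja i⟩
    · exact ⟨fun h => hyb i (Quotient.exact h), xb i, yb i,
        (Quotient.sound (hxb i)).symm, rfl, hadjb i⟩
  have e : Fin 4 ≃ Bool ⊕ Bool := (Fintype.equivFinOfCardEq (by simp)).symm
  exact (le_encard_iff_exists_fin _ 4).2 ⟨q ∘ e, hq.comp e.injective, fun i => hmem _⟩

/-! ### Merging non-forking clusters into forking ones -/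

theorem IsBranching.of_local {G G' : SimpleGraph V} {u : V} (hu : IsBranching G u)
    (h : ∀ x y, G.Reachable u x → G.Adj x y → G'.Adj x y) : IsBranching G' u := by
  obtain ⟨a, ha, hh⟩ := hu
  refine ⟨a, ha, fun i => ⟨h _ _ (SimpleGraph.Reachable.refl _) (hh i).1, (hh i).2.mono ?_⟩⟩
  intro w hw
  refine reachable_of_adj_imp hw fun x y hx hxy => ⟨h x y ?_ hxy.1, hxy.2⟩
  exact mem_branch_reachable (hh i).1 hx

theorem InForking.of_reachable {G : SimpleGraph V} {x y : V} (h : InForking G x)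
    (hxy : G.Reachable x y) : InForking G y := by
  unfold InForking at h ⊢
  rwa [← SimpleGraph.ConnectedComponent.sound hxy]

/-- If the labels do not change on forking clusters, then these are contained in forking
clusters of the new labeling. -/
theorem InForking.of_eq_on_forking {α : Type*} {F : SimpleGraph V} (hF : F.IsAcyclic)
    {L L' : V → α} (hL : ∀ v, InForking (clust F L) v → L' v = L v) {v : V}
    (hv : InForking (clust F L) v) : InForking (clust F L') v := by
  have hadj : ∀ x y, InForking (clust F L) x → (clust F L).Adj x y → (clust F L').Adj x y := by
    intro x y hx hxy
    refine ⟨hxy.1, ?_⟩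
    rw [hL x hx, hL y (hx.of_reachable hxy.reachable)]
    exact hxy.2
  have h1 := (inForking_iff (hF.anti (clust_le F L)) v).1 hv
  obtain ⟨u, hvu, hu⟩ := h1
  refine (inForking_iff (hF.anti (clust_le F L')) v).2 ⟨u, ?_, ?_⟩
  · exact reachable_of_adj_imp hvu fun x y hx hxy => hadj x y (hv.of_reachable hx) hxy
  · exact hu.of_local fun x y hx hxy => hadj x y (hv.of_reachable (hvu.trans hx)) hxy

theorem mergeStep_of_inForking {F : SimpleGraph V} {L : V → Bool} {v : V}
    (hv : InForking (clust F L) v) : mergeStep F L v = L v := by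
  unfold mergeStep
  rw [if_neg (fun h => h.1 hv)]

theorem inForking_mergeStep_of_adj {F : SimpleGraph V} (hF : F.IsAcyclic) {L : V → Bool} {x y : V}
    (hy : InForking (clust F L) y) (hxy : F.Adj x y) :
    InForking (clust F (mergeStep F L)) x := by
  have hpers := fun v (hv : InForking (clust F L) v) =>
    InForking.of_eq_on_forking hF (L' := mergeStep F L) (fun v hv => mergeStep_of_inForking hv) hv
  by_cases hx : InForking (clust F L) x
  · exact hpers x hx
  · have hne : L x ≠ L y := fun h =>
      hx (hy.of_reachable (SimpleGraph.Adj.reachable ⟨hxy.symm, h.symm⟩))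
    have h1 : mergeStep F L x = !(L x) := by
      unfold mergeStep
      rw [if_pos ⟨hx, x, y, SimpleGraph.Reachable.refl _, hxy, hy⟩]
    refine (hpers y hy).of_reachable (SimpleGraph.Adj.reachable ⟨hxy.symm, ?_⟩)
    rw [h1, mergeStep_of_inForking hy]
    cases hx' : L x <;> cases hy' : L y <;> simp_all

open Classical in
/-- The labeling at which the iterated rounds of merging stabilize, where they do. -/
noncomputable def mergeLim (F : SimpleGraph V) (L : V → Bool) : V → Bool :=
  fun v => decide (∀ᶠ k : ℕ in atTop, (mergeStep F)^[k] L v = true)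

theorem mergeLim_eq {F : SimpleGraph V} {L : V → Bool} {v : V} {b : Bool}
    (h : ∀ᶠ k : ℕ in atTop, (mergeStep F)^[k] L v = b) : mergeLim F L v = b := by
  unfold mergeLim
  cases b
  · rw [decide_eq_false_iff_not]
    intro h'
    obtain ⟨k, h1, h2⟩ := (h.and h').exists
    rw [h1] at h2
    exact absurd h2 (by decide)
  · simpa using h

theorem IsMergeOf.mergeLim_eq {F : SimpleGraph V} {L L' : V → Bool} (h : IsMergeOf F L L') :
    mergeLim F L = L' := funext fun v => FactorIID.mergeLim_eq (h v)

section

variable {F : SimpleGraph V} (hF : F.IsAcyclic) {L : V → Bool}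
include hF

theorem inForking_iterate {k : ℕ} {v : V} (hv : InForking (clust F ((mergeStep F)^[k] L)) v)
    (m : ℕ) : InForking (clust F ((mergeStep F)^[k + m] L)) v ∧
      (mergeStep F)^[k + m] L v = (mergeStep F)^[k] L v := by
  induction m with
  | zero => exact ⟨hv, rfl⟩
  | succ m ih =>
    rw [← add_assoc, Function.iterate_succ_apply']
    refine ⟨InForking.of_eq_on_forking hF (fun v hv => mergeStep_of_inForking hv) ih.1, ?_⟩
    rw [mergeStep_of_inForking ih.1, ih.2]

theorem eventually_eq_of_inForking {k : ℕ} {v : V}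
    (hv : InForking (clust F ((mergeStep F)^[k] L)) v) :
    ∀ᶠ n : ℕ in atTop, (mergeStep F)^[n] L v = (mergeStep F)^[k] L v := by
  filter_upwards [eventually_ge_atTop k] with n hn
  obtain ⟨m, rfl⟩ := Nat.exists_eq_add_of_le hn
  exact (inForking_iterate hF hv m).2

variable (hL : ∀ v, ∃ y, F.Reachable v y ∧ InForking (clust F L) y)
include hL

theorem exists_inForking_iterate (v : V) :
    ∃ k, InForking (clust F ((mergeStep F)^[k] L)) v := by
  obtain ⟨y, hvy, hy⟩ := hL v
  refine reachable_induction (P := fun x => ∃ k, InForking (clust F ((mergeStep F)^[k] L)) x)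
    ⟨0, hy⟩ ?_ hvy.symm
  rintro a b _ ⟨k, hk⟩ hab
  refine ⟨k + 1, ?_⟩
  rw [Function.iterate_succ_apply']
  exact inForking_mergeStep_of_adj hF hk hab.symm

theorem isMergeOf_mergeLim : IsMergeOf F L (mergeLim F L) := by
  intro v
  obtain ⟨k, hk⟩ := exists_inForking_iterate hF hL v
  have h := eventually_eq_of_inForking hF hk
  rw [mergeLim_eq h]
  exact h

theorem inForking_mergeLim (v : V) : InForking (clust F (mergeLim F L)) v := by
  obtain ⟨k, hk⟩ := exists_inForking_iterate hF hL v
  exact InForking.of_eq_on_forking hF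
    (fun w hw => mergeLim_eq (eventually_eq_of_inForking hF hw)) hk

end

theorem mergeStep_eq_of_adj {F : SimpleGraph V} {L : V → Bool} {x y : V} (h : F.Adj x y)
    (hL : L x = L y) : mergeStep F L x = mergeStep F L y := by
  have hxy : (clust F L).Reachable x y := SimpleGraph.Adj.reachable ⟨h, hL⟩
  have h1 : InForking (clust F L) x ↔ InForking (clust F L) y :=
    ⟨fun h => h.of_reachable hxy, fun h => h.of_reachable hxy.symm⟩
  have h2 : ∀ z, (clust F L).Reachable x z ↔ (clust F L).Reachable y z := fun z =>
    ⟨fun h => hxy.symm.trans h, fun h => hxy.trans h⟩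
  have h3 : (¬ InForking (clust F L) x ∧
        ∃ a b, (clust F L).Reachable x a ∧ F.Adj a b ∧ InForking (clust F L) b) ↔
      (¬ InForking (clust F L) y ∧
        ∃ a b, (clust F L).Reachable y a ∧ F.Adj a b ∧ InForking (clust F L) b) := by
    simp only [h1, h2]
  unfold mergeStep
  by_cases h4 : ¬ InForking (clust F L) y ∧
      ∃ a b, (clust F L).Reachable y a ∧ F.Adj a b ∧ InForking (clust F L) b
  · rw [if_pos h4, if_pos (h3.2 h4), hL]
  · rw [if_neg h4, if_neg (fun h => h4 (h3.1 h)), hL]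

theorem mergeLim_eq_of_adj {F : SimpleGraph V} {L : V → Bool} {x y : V} (h : F.Adj x y)
    (hL : L x = L y) : mergeLim F L x = mergeLim F L y := by
  have : ∀ k : ℕ, (mergeStep F)^[k] L x = (mergeStep F)^[k] L y := by
    intro k
    induction k with
    | zero => exact hL
    | succ k ih =>
      rw [Function.iterate_succ_apply']
      exact mergeStep_eq_of_adj h ih
  unfold mergeLim
  congr 1
  simp only [this]

theorem mergeStep_not (F : SimpleGraph V) (L : V → Bool) :
    mergeStep F (fun v => !(L v)) = fun v => !(mergeStep F L v) := by
  have : clust F (fun v => !(L v)) = clust F L := by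
    ext x y
    simp [clust]
  funext v
  unfold mergeStep
  rw [this]
  split_ifs <;> rfl

theorem IsMergeOf.not {F : SimpleGraph V} {L L' : V → Bool} (h : IsMergeOf F L L') :
    IsMergeOf F (fun v => !(L v)) (fun v => !(L' v)) := by
  have : ∀ k : ℕ, (mergeStep F)^[k] (fun v => !(L v)) = fun v => !((mergeStep F)^[k] L v) := by
    intro k
    induction k with
    | zero => rfl
    | succ k ih =>
      rw [Function.iterate_succ_apply', ih, mergeStep_not, Function.iterate_succ_apply']
  intro v
  filter_upwards [h v] with k hk
  simp only [this, hk]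

/-! ### Contracting cells, and ternary subtrees of the coarse-grained trees -/

/-- Walks in the coarse-grained graph lift to walks in the original graph. -/
theorem FiniteConnectedCells.lift {F H : SimpleGraph V} {s : Setoid V}
    (hs : FiniteConnectedCells F s) {Q : SimpleGraph (Quotient s)} {x : V} {d : Quotient s}
    (hcell : ∀ a b, F.Adj a b → s a b → Q.Reachable (Quotient.mk s x) (Quotient.mk s a) →
      H.Adj a b)
    (hQ : ∀ a b, Q.Reachable (Quotient.mk s x) a → Q.Adj a b → ∃ y z, Quotient.mk s y = a ∧
      Quotient.mk s z = b ∧ H.Adj y z)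
    (h : Q.Reachable (Quotient.mk s x) d) {z : V} (hz : Quotient.mk s z = d) :
    H.Reachable x z := by
  have incell : ∀ y z, s y z → Q.Reachable (Quotient.mk s x) (Quotient.mk s y) →
      H.Reachable y z := by
    intro y z hyz hr
    refine (hs.connected y z hyz).mono ?_
    intro a b hab
    refine hcell a b hab.1 (s.trans' (s.symm' hab.2.1) hab.2.2) ?_
    rwa [show Quotient.mk s a = Quotient.mk s y from (Quotient.sound hab.2.1).symm]
  revert z
  refine reachable_induction (H := Q) (P := fun d => ∀ {z}, Quotient.mk s z = d → H.Reachable x z)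
    ?_ ?_ h
  · intro z hz
    exact incell x z (Quotient.exact hz.symm) (SimpleGraph.Reachable.refl _)
  · intro a b hxa ih hab z hz
    obtain ⟨y, w, hy, hw, hyw⟩ := hQ a b hxa hab
    refine (reachable_step (ih hy) hyw).trans (incell w z (Quotient.exact (hw.trans hz.symm)) ?_)
    rw [hw]
    exact reachable_step hxa hab

theorem coarseGraph_isAcyclic {F : SimpleGraph V} (hF : F.IsAcyclic) {s : Setoid V}
    (hs : FiniteConnectedCells F s) : (coarseGraph F s).IsAcyclic := by
  rw [SimpleGraph.isAcyclic_iff_forall_adj_isBridge]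
  rintro _ _ ⟨hne, x, y, rfl, rfl, hxy⟩
  have hbr := SimpleGraph.isAcyclic_iff_forall_adj_isBridge.1 hF hxy
  rw [SimpleGraph.isBridge_iff] at hbr ⊢
  intro hr
  refine hbr (hs.lift (H := F \ SimpleGraph.fromEdgeSet {s(x, y)}) ?_ ?_ hr rfl)
  · intro a b hab hsab _
    refine ⟨hab, fun h => hne ?_⟩
    have h1 := Sym2.eq_iff.1 (show s(a, b) = s(x, y) from h.1)
    rcases h1 with ⟨rfl, rfl⟩ | ⟨rfl, rfl⟩
    · exact Quotient.sound hsab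
    · exact (Quotient.sound hsab).symm
  · rintro a b _ ⟨⟨hab, y', z', rfl, rfl, hyz⟩, hnot⟩
    refine ⟨y', z', rfl, rfl, hyz, fun h => hnot ⟨?_, hab⟩⟩
    have h1 := Sym2.eq_iff.1 (show s(y', z') = s(x, y) from h.1)
    refine Sym2.eq_iff.2 ?_
    rcases h1 with ⟨rfl, rfl⟩ | ⟨rfl, rfl⟩
    · exact Or.inl ⟨rfl, rfl⟩
    · exact Or.inr ⟨rfl, rfl⟩

theorem coarseGraph_reachable {F : SimpleGraph V} {s : Setoid V}
    (hs : FiniteConnectedCells F s) {x z : V}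
    (h : (coarseGraph F s).Reachable (Quotient.mk s x) (Quotient.mk s z)) : F.Reachable x z := by
  refine hs.lift (fun a b h _ _ => h) ?_ h rfl
  rintro a b _ ⟨_, y, z, hy, hz, hyz⟩
  exact ⟨y, z, hy, hz, hyz⟩

/-- A branching cell of a percolation on the coarse-grained graph contains a branching vertex of
the corresponding percolation on the original graph. -/
theorem exists_isBranching_of_coarse {F : SimpleGraph V} {s : Setoid V}
    (hs : FiniteConnectedCells F s) (X : Quotient s → Bool) {c : Quotient s}
    (hc : IsBranching (clust (coarseGraph F s) X) c) :
    ∃ u, Quotient.mk s u = c ∧ IsBranching (clust F fun v => X (Quotient.mk s v)) u := by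
  obtain ⟨a, ha, hh⟩ := hc
  have : ∀ i, ∃ x y, Quotient.mk s x = c ∧ Quotient.mk s y = a i ∧
      (clust F fun v => X (Quotient.mk s v)).Adj x y := by
    intro i
    obtain ⟨⟨_, x, y, hx, hy, hxy⟩, hX⟩ := (hh i).1
    exact ⟨x, y, hx, hy, hxy, by simp only [hx, hy, hX]⟩
  choose x y hx hy hxy using this
  have hne : ∀ i, a i ≠ c := fun i h => (hh i).1.ne h.symm
  refine exists_isBranching_of_exits (H := clust F fun v => X (Quotient.mk s v))
    (C := {z | Quotient.mk s z = c}) ?_ x y hx (fun i h => hne i ((hy i).symm.trans h)) ?_ hxy ?_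
  · intro x' hx' y' hy'
    rw [Set.mem_ofPred_eq] at hx' hy'
    have h1 : s x' y' := Quotient.exact (hx'.trans hy'.symm)
    refine (hs.connected x' y' h1).mono ?_
    intro p q hpq
    have hp : Quotient.mk s x' = Quotient.mk s p := Quotient.sound hpq.2.1
    have hq : Quotient.mk s x' = Quotient.mk s q := Quotient.sound hpq.2.2
    refine ⟨⟨hpq.1, ?_⟩, ?_, ?_⟩
    · simp only [← hp, ← hq]
    · exact hp.symm.trans hx'
    · exact hq.symm.trans hx'
  · intro i j hij
    exact ha ((hy i).symm.trans ((congrArg (Quotient.mk s) hij).trans (hy j)))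
  · intro i
    refine Set.Infinite.of_image (Quotient.mk s) (((hh i).2).mono ?_)
    intro d hd
    obtain ⟨z, rfl⟩ := Quotient.exists_rep d
    refine ⟨z, ?_, rfl⟩
    have hd' : (within (clust (coarseGraph F s) X) {c}ᶜ).Reachable
        (Quotient.mk s (y i)) (Quotient.mk s z) := by rw [hy i]; exact hd
    refine hs.lift ?_ ?_ hd' rfl
    · intro p q hpq hs' hr
      have hpc : Quotient.mk s p ≠ c := by
        refine mem_of_within_reachable (C := {c}ᶜ) ?_ hr
        rw [hy i]; exact hne i
      have hpq' : Quotient.mk s p = Quotient.mk s q := Quotient.sound hs'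
      refine ⟨⟨hpq, by simp only [hpq']⟩, hpc, ?_⟩
      intro h
      exact hpc (hpq'.trans h)
    · rintro p q _ ⟨⟨⟨_, p', q', hp, hq, hpq⟩, hX⟩, h1, h2⟩
      refine ⟨p', q', hp, hq, ⟨hpq, by simp only [hp, hq, hX]⟩, ?_, ?_⟩
      · intro h; exact h1 (hp.symm.trans h)
      · intro h; exact h2 (hq.symm.trans h)

/-- In the full ternary tree, whose vertices are the words over three letters, the root is joined
to level `n` by a path of vertices labeled `true`. -/
def Survives : ℕ → (List (Fin 3) → Bool) → Prop
  | 0, Y => Y [] = true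
  | n + 1, Y => Y [] = true ∧ ∃ i, Survives n (fun l => Y (i :: l))

theorem Survives.root {n : ℕ} {Y : List (Fin 3) → Bool} (h : Survives n Y) : Y [] = true := by
  cases n with
  | zero => exact h
  | succ n => exact h.1

/-- Some vertex of the ternary tree is labeled `true` and is the root of three infinite disjoint
branches labeled `true`. -/
def HasTriple (Y : List (Fin 3) → Bool) : Prop :=
  ∃ w, Y w = true ∧ ∀ i n, Survives n (fun l => Y (w ++ i :: l))

section

variable {W : Type*} (c : W → W → Fin 3 → W)

/-- Follow a word downwards from a directed edge `e`, where `c u a` lists three continuations of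
the directed edge `(u, a)`. -/
def descend (e : W × W) (l : List (Fin 3)) : W × W :=
  l.foldl (fun e i => (e.2, c e.1 e.2 i)) e

theorem descend_cons (e : W × W) (i : Fin 3) (l : List (Fin 3)) :
    descend c e (i :: l) = descend c (e.2, c e.1 e.2 i) l := rfl

theorem descend_append (e : W × W) (l l' : List (Fin 3)) :
    descend c e (l ++ l') = descend c (descend c e l) l' := List.foldl_append ..

variable {c} {G : SimpleGraph W} (hG : G.IsAcyclic)
  (hc1 : ∀ u a, Function.Injective (c u a)) (hc2 : ∀ u a i, G.Adj a (c u a i))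
  (hc3 : ∀ u a i, c u a i ≠ u)

include hG in
theorem branch_subset_branch {u a b : W} (hu : G.Adj u a) (hab : G.Adj a b) (hb : b ≠ u) :
    branch G a b ⊆ branch G u a := by
  intro w hw
  have hmem : ∀ z ∈ branch G a b, z ≠ u := by
    rintro z hz rfl
    exact hb (eq_of_reachable_avoiding hG hab hu.symm hz)
  refine SimpleGraph.Reachable.trans (SimpleGraph.Adj.reachable (v := b) ⟨hab, hu.ne', hb⟩) ?_
  refine reachable_of_adj_imp hw fun x y hx hxy => ⟨hxy.1, hmem x hx, hmem y ?_⟩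
  exact reachable_step hx hxy

include hG hc2 hc3

theorem descend_mem_branch {e : W × W} (he : G.Adj e.1 e.2) (l : List (Fin 3)) :
    (descend c e l).2 ∈ branch G e.1 e.2 := by
  induction l generalizing e with
  | nil => exact SimpleGraph.Reachable.refl _
  | cons i l ih =>
    exact branch_subset_branch hG he (hc2 _ _ i) (hc3 _ _ i)
      (ih (e := (e.2, c e.1 e.2 i)) (hc2 _ _ _))

include hc1 in
theorem descend_injective {e : W × W} (he : G.Adj e.1 e.2) :
    Function.Injective fun l => (descend c e l).2 := by
  have hroot : ∀ (e : W × W) i l, G.Adj e.1 e.2 →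
      (descend c e (i :: l)).2 ∈ branch G e.2 (c e.1 e.2 i) := fun e i l h =>
    descend_mem_branch hG hc2 hc3 (e := (e.2, c e.1 e.2 i)) (hc2 _ _ _) l
  have hnot : ∀ (e : W × W) i, e.2 ∉ branch G e.2 (c e.1 e.2 i) := by
    intro e i h
    exact mem_of_within_reachable (C := {e.2}ᶜ) (hc2 _ _ i).ne' h rfl
  intro l l' hll
  simp only at hll
  induction l generalizing e l' with
  | nil =>
    cases l' with
    | nil => rfl
    | cons j l' =>
      refine absurd ?_ (hnot e j)
      have := hroot e j l' he
      rwa [← hll] at this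
  | cons i l ih =>
    cases l' with
    | nil =>
      refine absurd ?_ (hnot e i)
      have := hroot e i l he
      rwa [hll] at this
    | cons j l' =>
      have h1 := hroot e i l he
      have h2 := hroot e j l' he
      rw [hll] at h1
      obtain rfl : i = j := hc1 _ _ (eq_of_reachable_avoiding hG (hc2 _ _ i) (hc2 _ _ j)
        (SimpleGraph.Reachable.trans h1 (SimpleGraph.Reachable.symm h2)))
      rw [ih (e := (e.2, c e.1 e.2 i)) (hc2 _ _ _) hll]

variable {X : W → Bool}

theorem Survives.exists_reachable {n : ℕ} {e : W × W} (he : G.Adj e.1 e.2)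
    (h : Survives n fun l => X (descend c e l).2) :
    ∃ l : List (Fin 3), l.length = n ∧
      (within (clust G X) (branch G e.1 e.2)).Reachable e.2 (descend c e l).2 := by
  induction n generalizing e with
  | zero => exact ⟨[], rfl, SimpleGraph.Reachable.refl _⟩
  | succ n ih =>
    obtain ⟨h1, i, hi⟩ := h
    obtain ⟨l, hl, hr⟩ := ih (e := (e.2, c e.1 e.2 i)) (hc2 _ _ _) hi
    have hsub := branch_subset_branch hG he (hc2 _ _ i) (hc3 _ _ i)
    refine ⟨i :: l, by simp [hl], ?_⟩
    refine SimpleGraph.Reachable.trans (SimpleGraph.Adj.reachable ?_)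
      (hr.mono (within_mono le_rfl hsub))
    exact ⟨⟨hc2 _ _ i, h1.trans hi.root.symm⟩, SimpleGraph.Reachable.refl _,
      hsub (SimpleGraph.Reachable.refl _)⟩

include hc1

theorem infinite_branch_of_survives {e : W × W} (he : G.Adj e.1 e.2)
    (h : ∀ n, Survives n fun l => X (descend c e l).2) :
    (branch (clust G X) e.1 e.2).Infinite := by
  choose l hl hr using fun n => (h n).exists_reachable hG hc2 hc3 he
  refine Set.infinite_of_injective_forall_mem (f := fun n => (descend c e (l n)).2) ?_ ?_
  · intro m n hmn
    rw [← hl m, ← hl n, descend_injective hG hc1 hc2 hc3 he hmn]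
  · intro n
    refine (hr n).mono (within_mono le_rfl ?_)
    intro z hz
    exact mem_of_within_reachable (C := {e.1}ᶜ) he.ne' hz

theorem exists_isBranching_of_hasTriple {e : W × W} (he : G.Adj e.1 e.2)
    (h : HasTriple fun l => X (descend c e l).2) :
    ∃ u, G.Reachable e.2 u ∧ IsBranching (clust G X) u := by
  obtain ⟨w, hw, hs⟩ := h
  refine ⟨(descend c e w).2, (descend_mem_branch hG hc2 hc3 he w).mono (within_le _ _),
    c (descend c e w).1 (descend c e w).2, hc1 _ _, fun i => ⟨⟨hc2 _ _ i, ?_⟩, ?_⟩⟩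
  · have := (hs i 0).root
    simp only [descend_append] at this
    exact hw.trans this.symm
  · refine infinite_branch_of_survives hG hc1 hc2 hc3
      (e := ((descend c e w).2, c (descend c e w).1 (descend c e w).2 i)) (hc2 _ _ i) fun n => ?_
    have := hs i n
    simpa only [descend_append, descend_cons] using this

end

/-- A forest of minimal degree at least four contains, below every vertex, an injectively embedded
full ternary tree such that percolation configurations with a triple on it have a branching
vertex in the corresponding tree. -/
theorem exists_ternary_embedding {W : Type*} {G : SimpleGraph W} (hG : G.IsAcyclic)
    (hdeg : ∀ w, 4 ≤ (G.neighborSet w).encard) (v : W) :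
    ∃ ι : List (Fin 3) → W, Function.Injective ι ∧ ∀ X : W → Bool,
      HasTriple (fun l => X (ι l)) → ∃ u, G.Reachable v u ∧ IsBranching (clust G X) u := by
  have : ∀ u a : W, ∃ f : Fin 3 → W, Function.Injective f ∧ ∀ i, G.Adj a (f i) ∧ f i ≠ u := by
    intro u a
    have h1 : (3 : ℕ) ≤ (G.neighborSet a \ {u}).encard := by
      have h2 := hdeg a
      exact (le_of_eq (ENat.natCast_sub 4 1)).trans ((tsub_le_tsub_right h2 1).trans
        (Set.encard_tsub_one_le_encard_sdiff_singleton _ u))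
    obtain ⟨f, hf, hf'⟩ := (le_encard_iff_exists_fin _ _).1 h1
    exact ⟨f, hf, fun i => ⟨(hf' i).1, (hf' i).2⟩⟩
  choose c hc hc' using this
  obtain ⟨u, hu⟩ : (G.neighborSet v).Nonempty := by
    rw [← Set.encard_pos]
    exact lt_of_lt_of_le (by norm_num) (hdeg v)
  have he : G.Adj (u, v).1 (u, v).2 := hu.symm
  have h2 := fun u a i => (hc' u a i).1
  have h3 := fun u a i => (hc' u a i).2
  exact ⟨fun l => (descend c (u, v) l).2, descend_injective hG hc h2 h3 he,
    fun X hX => exists_isBranching_of_hasTriple hG hc h2 h3 he hX⟩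

end

/-! ### Fair coins -/

/-- The law of a fair bit. -/
noncomputable def coin : Measure Bool := (2⁻¹ : ENNReal) • Measure.count

theorem coin_singleton (b : Bool) : coin {b} = 2⁻¹ := by simp [coin]

instance : IsProbabilityMeasure coin := ⟨by
  rw [coin, Measure.smul_apply, Measure.count_univ, ENat.card_eq_coe_fintype_card, smul_eq_mul,
    Fintype.card_bool]
  exact ENNReal.inv_mul_cancel (by simp) (by simp)⟩

/-- The law of a family of independent fair bits. -/
noncomputable def fair (I : Type*) : Measure (I → Bool) := Measure.infinitePi fun _ : I => coin

instance (I : Type*) : IsProbabilityMeasure (fair I) := by unfold fair; infer_instance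

theorem coin_map_not : coin.map not = coin := by
  ext s _
  rw [Measure.map_apply (by fun_prop) (by measurability)]
  simp only [coin, Measure.smul_apply]
  congr 1
  rw [← Bool.involutive_not.image_eq_preimage_symm, Measure.count_injective_image]
  exact Bool.involutive_not.injective

/-- A subfamily of independent fair bits consists of independent fair bits. -/
theorem fair_map_injective {I J : Type*} {ι : J → I} (hι : Function.Injective ι) :
    (fair I).map (fun x j => x (ι j)) = fair J := by
  refine Measure.eq_infinitePi _ fun s t ht => ?_
  rw [Measure.map_apply (by fun_prop) (.pi s.countable_toSet fun _ _ => ht _)]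
  have : (fun (x : I → Bool) j => x (ι j)) ⁻¹' (Set.pi s t) =
      Set.pi (s.map ⟨ι, hι⟩ : Finset I) (Function.extend ι t fun _ => Set.univ) := by
    ext x
    simp [Set.mem_pi, hι.extend_apply]
  rw [this, fair, Measure.infinitePi_pi]
  · rw [Finset.prod_map]
    simp [hι.extend_apply]
  · intro i _
    measurability

/-- The event that a sequence of bits starts with the first `n` bits of `ε`. -/
def prefixSet (n : ℕ) (ε : ℕ → Bool) : Set (ℕ → Bool) := {x | ∀ i < n, x i = ε i}

theorem measurableSet_prefixSet (n : ℕ) (ε : ℕ → Bool) : MeasurableSet (prefixSet n ε) := by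
  unfold prefixSet
  rw [measurableSet_setOfPred]
  refine Measurable.forall fun i => Measurable.imp measurable_const ?_
  exact measurableSet_setOfPred.1 (measurableSet_eq_fun (by fun_prop) (by fun_prop))

theorem fair_prefixSet (n : ℕ) (ε : ℕ → Bool) : fair ℕ (prefixSet n ε) = 2⁻¹ ^ n := by
  have : prefixSet n ε = Set.pi (Finset.range n) fun i => {ε i} := by
    ext x; simp [prefixSet, Set.mem_pi]
  rw [this, fair, Measure.infinitePi_pi _ (fun _ _ => by measurability)]
  simp [coin_singleton]

/-- A random sequence of bits consists of independent fair bits as soon as each word of length `n`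
is a prefix with probability `2⁻ⁿ`. -/
theorem eq_fair_of_prefixSet {ν : Measure (ℕ → Bool)} [IsProbabilityMeasure ν]
    (h : ∀ n ε, ν (prefixSet n ε) = 2⁻¹ ^ n) : ν = fair ℕ := by
  refine ext_of_generate_finite {S | ∃ n ε, S = prefixSet n ε} ?_ ?_ ?_ (by simp)
  · apply le_antisymm
    · have : ∀ i, Measurable[MeasurableSpace.generateFrom {S | ∃ n ε, S = prefixSet n ε}]
          (fun x : ℕ → Bool => x i) := by
        intro i
        refine @measurable_to_bool _ (MeasurableSpace.generateFrom _) _ ?_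
        have hU : (fun x : ℕ → Bool => x i) ⁻¹' {true} = ⋃ e : Fin i → Bool,
            prefixSet (i + 1) (fun j => if hj : j < i then e ⟨j, hj⟩ else true) := by
          ext x
          simp only [Set.mem_preimage, Set.mem_singleton_iff, Set.mem_iUnion, prefixSet,
            Set.mem_ofPred_eq]
          constructor
          · intro hx
            refine ⟨fun j => x j, fun j hj => ?_⟩
            split_ifs with h1
            · rfl
            · rw [show j = i by omega, hx]
          · rintro ⟨e, he⟩
            simpa using he i (by omega)
        rw [hU]
        exact MeasurableSet.iUnion fun e => MeasurableSpace.measurableSet_generateFrom ⟨_, _, rfl⟩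
      exact iSup_le fun i => (measurable_iff_comap_le.1 (this i))
    · refine MeasurableSpace.generateFrom_le ?_
      rintro _ ⟨n, ε, rfl⟩
      exact measurableSet_prefixSet n ε
  · rintro _ ⟨n, ε, rfl⟩ _ ⟨m, ε', rfl⟩ ⟨x, hx, hx'⟩
    rcases le_total n m with hnm | hnm
    · refine ⟨m, ε', Set.inter_eq_right.2 fun y hy i hi => ?_⟩
      rw [hy i (by omega), ← hx' i (by omega), hx i hi]
    · refine ⟨n, ε, Set.inter_eq_left.2 fun y hy i hi => ?_⟩
      rw [hy i (by omega), ← hx i (by omega), hx' i hi]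
  · rintro _ ⟨n, ε, rfl⟩
    rw [h, fair_prefixSet]

section

variable {I : Type*} (J : Set I)

open Classical in
/-- Replace the bits of `z` at the indices in `J` by those of `ξ`. -/
noncomputable def resample (z ξ : I → Bool) : I → Bool := fun i => if i ∈ J then ξ i else z i

theorem measurable_resample :
    Measurable fun p : (I → Bool) × (I → Bool) => resample J p.1 p.2 := by
  refine measurable_pi_lambda _ fun i => ?_
  unfold resample
  by_cases h : i ∈ J <;> simp only [h, if_true, if_false] <;> fun_prop

/-- Resampling some of the bits does not change their joint law. -/
theorem map_resample :
    ((fair I).prod (fair I)).map (fun p => resample J p.1 p.2) = fair I := by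
  classical
  refine Measure.eq_infinitePi _ fun s t ht => ?_
  rw [Measure.map_apply (measurable_resample J) (.pi s.countable_toSet fun _ _ => ht _)]
  have : (fun p : (I → Bool) × (I → Bool) => resample J p.1 p.2) ⁻¹' (Set.pi s t) =
      (Set.pi s fun i => if i ∈ J then Set.univ else t i) ×ˢ
        (Set.pi s fun i => if i ∈ J then t i else Set.univ) := by
    ext ⟨z, ξ⟩
    simp only [Set.mem_preimage, Set.mem_pi, Set.mem_prod, resample, ← forall₂_and]
    refine forall₂_congr fun i _ => ?_
    by_cases hJ : i ∈ J <;> simp [hJ]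
  rw [this, Measure.prod_prod, fair, Measure.infinitePi_pi _ (fun _ _ => by measurability),
    Measure.infinitePi_pi _ (fun _ _ => by measurability), ← Finset.prod_mul_distrib]
  refine Finset.prod_congr rfl fun i _ => ?_
  by_cases hJ : i ∈ J <;> simp only [hJ, if_true, if_false, measure_univ, one_mul, mul_one]

theorem fair_eq_lintegral_resample {N : Set (I → Bool)} (hN : MeasurableSet N) :
    fair I N = ∫⁻ z, fair I {ξ | resample J z ξ ∈ N} ∂(fair I) := by
  conv_lhs => rw [← map_resample J]
  rw [Measure.map_apply (measurable_resample J) hN,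
    Measure.prod_apply (measurable_resample J hN)]
  rfl

/-- A property holds almost surely if it does so after resampling, conditionally on the bits that
are kept. -/
theorem ae_of_ae_resample {P : (I → Bool) → Prop} (hP : Measurable P)
    (h : ∀ᵐ z ∂(fair I), ∀ᵐ ξ ∂(fair I), P (resample J z ξ)) : ∀ᵐ z ∂(fair I), P z := by
  rw [ae_iff, fair_eq_lintegral_resample J (measurableSet_setOfPred.2 hP.not)]
  rw [lintegral_eq_zero_iff']
  · filter_upwards [h] with z hz
    exact hz
  · exact (measurable_measure_prodMk_left
      (measurable_resample J (measurableSet_setOfPred.2 hP.not))).aemeasurable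

end

/-! ### Percolation on the ternary tree -/

theorem measurable_survives (n : ℕ) : Measurable fun Y : List (Fin 3) → Bool => Survives n Y := by
  have hroot : Measurable fun Y : List (Fin 3) → Bool => Y [] = true :=
    measurableSet_setOfPred.1 (measurableSet_eq_fun (by fun_prop) (by fun_prop))
  induction n with
  | zero => exact hroot
  | succ n ih =>
    refine Measurable.and hroot (Measurable.exists fun i => ?_)
    exact ih.comp (measurable_pi_lambda _ fun l => measurable_pi_apply _)

theorem measurable_hasTriple : Measurable fun Y : List (Fin 3) → Bool => HasTriple Y := by
  refine Measurable.exists fun w => Measurable.and ?_ (Measurable.forall fun i =>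
    Measurable.forall fun n => ?_)
  · exact measurableSet_setOfPred.1 (measurableSet_eq_fun (by fun_prop) (by fun_prop))
  · exact (measurable_survives n).comp (measurable_pi_lambda _ fun l => measurable_pi_apply _)

theorem Survives.of_succ {n : ℕ} {Y : List (Fin 3) → Bool} (h : Survives (n + 1) Y) :
    Survives n Y := by
  induction n generalizing Y with
  | zero => exact h.1
  | succ n ih => exact ⟨h.1, h.2.imp fun i hi => ih hi⟩

/-- The three subtrees below the root carry independent configurations. -/
theorem fair_subtrees {B : Set (List (Fin 3) → Bool)} (hB : MeasurableSet B) :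
    (fair (List (Fin 3))).real {Y | ∀ i : Fin 3, (fun l => Y (i :: l)) ∈ B} =
      (fair (List (Fin 3))).real B ^ 3 := by
  have h1 : (fair (List (Fin 3))).map (fun Y (p : Fin 3 × List (Fin 3)) => Y (p.1 :: p.2)) =
      fair (Fin 3 × List (Fin 3)) := by
    refine fair_map_injective (ι := fun p : Fin 3 × List (Fin 3) => p.1 :: p.2) ?_
    rintro ⟨i, l⟩ ⟨j, m⟩ h
    simpa using h
  have h2 := Measure.infinitePi_map_curry (fun (_ : Fin 3) (_ : List (Fin 3)) => coin)
  have h3 : (fair (List (Fin 3))).map (fun Y (i : Fin 3) l => Y (i :: l)) =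
      Measure.infinitePi fun _ : Fin 3 => fair (List (Fin 3)) := by
    unfold fair at h1 ⊢
    rw [← h2, ← h1, Measure.map_map (by fun_prop) (by fun_prop)]
    rfl
  have h4 : {Y : List (Fin 3) → Bool | ∀ i : Fin 3, (fun l => Y (i :: l)) ∈ B} =
      (fun Y (i : Fin 3) l => Y (i :: l)) ⁻¹'
        (Set.pi (Finset.univ : Finset (Fin 3)) fun _ => B) := by
    ext Y
    simp [Set.mem_pi]
  rw [measureReal_def, h4, ← Measure.map_apply (by fun_prop) (.pi (Finset.countable_toSet _)
    fun _ _ => hB), h3, Measure.infinitePi_pi _ (fun _ _ => hB)]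
  simp [measureReal_def]

/-- The root label is independent of the subtrees. -/
theorem fair_root_and {P : (List (Fin 3) → Bool) → Prop} (hP : Measurable P)
    (hloc : ∀ Y Y' : List (Fin 3) → Bool, (∀ i l, Y (i :: l) = Y' (i :: l)) → (P Y ↔ P Y')) :
    (fair (List (Fin 3))).real {Y | Y [] = true ∧ P Y} =
      (1 / 2) * (fair (List (Fin 3))).real {Y | P Y} := by
  have hroot : Measurable fun Y : List (Fin 3) → Bool => Y [] = true :=
    measurableSet_setOfPred.1 (measurableSet_eq_fun (by fun_prop) (by fun_prop))
  have h1 : (fair (List (Fin 3))) {Y | Y [] = true} = 2⁻¹ := by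
    have := Measure.infinitePi_map_eval (fun _ : List (Fin 3) => coin) []
    rw [← coin_singleton true, ← this, Measure.map_apply (by fun_prop) (by measurability)]
    rfl
  rw [measureReal_def, fair_eq_lintegral_resample {[]} (measurableSet_setOfPred.2 (hroot.and hP))]
  have h2 : ∀ z : List (Fin 3) → Bool, (fair (List (Fin 3)))
      {ξ | resample {[]} z ξ ∈ {Y : List (Fin 3) → Bool | Y [] = true ∧ P Y}} =
      {Y | P Y}.indicator (fun _ => (2⁻¹ : ENNReal)) z := by
    intro z
    have h3 : ∀ ξ, P (resample {[]} z ξ) ↔ P z := by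
      intro ξ
      refine hloc _ _ fun i l => ?_
      simp [resample]
    simp only [Set.mem_ofPred_eq, h3]
    by_cases hz : P z
    · simp [hz, resample, h1]
    · simp [hz]
  simp only [h2]
  rw [lintegral_indicator (measurableSet_setOfPred.2 hP)]
  simp [measureReal_def]

/-- With survival probability at least `1 / 4` from each of three children, that from the root is at
least `(1 - (3 / 4) ^ 3) / 2`, which exceeds `1 / 4`. -/
theorem quarter_le_survives (n : ℕ) :
    1 / 4 ≤ (fair (List (Fin 3))).real {Y | Survives n Y} := by
  induction n with
  | zero =>
    have := fair_root_and (P := fun _ => True) measurable_const (fun _ _ _ => Iff.rfl)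
    simp only [and_true] at this
    change 1 / 4 ≤ (fair (List (Fin 3))).real {Y | Y [] = true}
    rw [this]
    simp
    norm_num
  | succ n ih =>
    have hS := measurable_survives n
    have h1 := fair_root_and (P := fun Y => ∃ i : Fin 3, Survives n (fun l => Y (i :: l)))
      (Measurable.exists fun i => hS.comp (measurable_pi_lambda _ fun l => measurable_pi_apply _))
      (fun Y Y' h => by simp only [h])
    have h2 := fair_subtrees (B := {Y | ¬ Survives n Y}) (measurableSet_setOfPred.2 hS.not)
    have h3 : {Y : List (Fin 3) → Bool | ∃ i : Fin 3, Survives n (fun l => Y (i :: l))} =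
        {Y : List (Fin 3) → Bool | ∀ i : Fin 3, (fun l => Y (i :: l)) ∈ {Y | ¬ Survives n Y}}ᶜ := by
      ext Y; simp
    have h4 : {Y | ¬ Survives n Y} = {Y | Survives n Y}ᶜ := rfl
    change 1 / 4 ≤ (fair (List (Fin 3))).real
      {Y | Y [] = true ∧ ∃ i : Fin 3, Survives n (fun l => Y (i :: l))}
    rw [h1, h3, probReal_compl_eq_one_sub, h2, h4,
      probReal_compl_eq_one_sub (measurableSet_setOfPred.2 hS)]
    · have h5 : (fair (List (Fin 3))).real {Y | Survives n Y} ≤ 1 := measureReal_le_one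
      have h6 : (1 - (fair (List (Fin 3))).real {Y | Survives n Y}) ^ 3 ≤ (3 / 4) ^ 3 :=
        pow_le_pow_left₀ (by linarith) (by linarith) 3
      linarith
    · have : Measurable fun Y : List (Fin 3) → Bool => ∀ i : Fin 3,
          ¬ Survives n (fun l => Y (i :: l)) := Measurable.forall fun i =>
        (hS.comp (measurable_pi_lambda _ fun l => measurable_pi_apply _)).not
      exact measurableSet_setOfPred.2 this

theorem quarter_le_survives_forever :
    1 / 4 ≤ (fair (List (Fin 3))).real {Y | ∀ n, Survives n Y} := by
  have h1 : {Y | ∀ n, Survives n Y} = ⋂ n, {Y | Survives n Y} := by ext; simp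
  have hanti : Antitone fun n => {Y | Survives n Y} :=
    antitone_nat_of_succ_le fun n Y hY => Survives.of_succ hY
  have h2 := tendsto_measure_iInter_atTop (μ := fair (List (Fin 3)))
    (fun n => (measurableSet_setOfPred.2 (measurable_survives n)).nullMeasurableSet) hanti
    ⟨0, measure_ne_top _ _⟩
  rw [h1, measureReal_def]
  have h3 := (ENNReal.tendsto_toReal (measure_ne_top _ _)).comp h2
  exact ge_of_tendsto' h3 fun n => quarter_le_survives n

/-- Percolation on the full ternary tree almost surely has a triple: the probability `p` of having
none satisfies `p ≤ p ^ 3`, because no subtree below the root may have one, and `p < 1`. -/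
theorem ae_hasTriple : ∀ᵐ Y ∂(fair (List (Fin 3))), HasTriple Y := by
  set μ := fair (List (Fin 3))
  set p := μ.real {Y | ¬ HasTriple Y} with hp
  have hmeas := measurableSet_setOfPred.2 measurable_hasTriple.not
  have hforever : Measurable fun Y : List (Fin 3) → Bool => ∀ n, Survives n Y :=
    Measurable.forall fun n => measurable_survives n
  have h1 : p ≤ p ^ 3 := by
    rw [hp, ← fair_subtrees hmeas]
    refine measureReal_mono ?_ (measure_ne_top _ _)
    rintro Y hY i ⟨w, hw, h⟩
    exact hY ⟨i :: w, hw, h⟩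
  have h2 : p < 1 := by
    have hforall : Measurable fun Y : List (Fin 3) → Bool =>
        ∀ i : Fin 3, (fun l => Y (i :: l)) ∈ {Y | ∀ n, Survives n Y} := Measurable.forall fun i =>
      hforever.comp (measurable_pi_lambda _ fun l => measurable_pi_apply _)
    have h3 := fair_root_and hforall (fun Y Y' h => by simp only [h])
    rw [fair_subtrees (measurableSet_setOfPred.2 hforever)] at h3
    have h4 : (1 / 4 : ℝ) ^ 3 ≤ μ.real {Y | ∀ n, Survives n Y} ^ 3 :=
      pow_le_pow_left₀ (by norm_num) quarter_le_survives_forever 3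
    have h5 : μ.real {Y | Y [] = true ∧
        ∀ i : Fin 3, (fun l => Y (i :: l)) ∈ {Y | ∀ n, Survives n Y}} ≤
        μ.real {Y | ¬ HasTriple Y}ᶜ := by
      refine measureReal_mono ?_ (measure_ne_top _ _)
      intro Y hY h
      exact h ⟨[], hY.1, fun i n => hY.2 i n⟩
    rw [probReal_compl_eq_one_sub hmeas, h3] at h5
    norm_num at h4
    linarith
  have h0 : 0 ≤ p := measureReal_nonneg
  have h3 : p = 0 := by
    by_contra hne
    have hpos : 0 < p := lt_of_le_of_ne h0 (Ne.symm hne)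
    nlinarith [mul_pos hpos (sub_pos.2 h2)]
  rw [ae_iff]
  exact (measureReal_eq_zero_iff).1 h3

theorem ae_hasTriple_of_injective {I : Type*} {ι : List (Fin 3) → I} (hι : Function.Injective ι) :
    ∀ᵐ X ∂(fair I), HasTriple fun l => X (ι l) := by
  have h := ae_hasTriple
  rw [← fair_map_injective hι] at h
  exact ae_of_ae_map (measurable_pi_lambda _ fun l => measurable_pi_apply _).aemeasurable h

/-! ### Mass transport -/

section

variable {Γ : Type*} [Group Γ]

/-- Translation of a configuration of bits indexed by `Γ × ℕ`. -/
def shift (γ : Γ) (z : Γ × ℕ → Bool) : Γ × ℕ → Bool := fun i => z (γ⁻¹ * i.1, i.2)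

theorem measurePreserving_shift (γ : Γ) :
    MeasurePreserving (shift γ) (fair (Γ × ℕ)) (fair (Γ × ℕ)) := by
  refine ⟨by unfold shift; fun_prop, ?_⟩
  refine fair_map_injective (ι := fun i : Γ × ℕ => (γ⁻¹ * i.1, i.2)) ?_
  rintro ⟨x, i⟩ ⟨y, j⟩ h
  simpa using h

/-- The mass transport principle: if every vertex sends mass to at most one vertex, in an
equivariant way, then almost surely every vertex receives mass from finitely many vertices. -/
theorem ae_finite_of_equivariant [Countable Γ] {M : (Γ × ℕ → Bool) → Γ → Γ → Prop}
    (hM : ∀ x y, Measurable fun z => M z x y)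
    (hequiv : ∀ γ z x y, M (shift γ z) x y ↔ M z (γ⁻¹ * x) (γ⁻¹ * y))
    (hfun : ∀ z x y y', M z x y → M z x y' → y = y') :
    ∀ᵐ z ∂(fair (Γ × ℕ)), ∀ y, {x | M z x y}.Finite := by
  rw [ae_all_iff]
  intro y
  refine ae_finite_setOfPred_mem (s := fun x => {z | M z x y}) ?_
  -- translate so that the mass sent from `x` to `y` becomes mass sent from `y`
  have h1 : ∀ x, fair (Γ × ℕ) {z | M z x y} = fair (Γ × ℕ) {z | M z y (y * x⁻¹ * y)} := by
    intro x
    rw [← (measurePreserving_shift (x * y⁻¹)).measure_preimage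
      (measurableSet_setOfPred.2 (hM x y)).nullMeasurableSet]
    congr 1
    ext z
    simp only [Set.mem_preimage, Set.mem_ofPred_eq, hequiv]
    simp [mul_assoc]
  let e : Γ ≃ Γ := (Equiv.inv Γ).trans ((Equiv.mulLeft y).trans (Equiv.mulRight y))
  have h2 : ∑' x, fair (Γ × ℕ) {z | M z x y} = ∑' w, fair (Γ × ℕ) {z | M z y w} := by
    conv_rhs => rw [← e.tsum_eq]
    exact tsum_congr h1
  -- the total mass sent from `y` is at most one, since the events of sending it to `w` are disjoint
  rw [h2, ← measure_iUnion]
  · exact measure_ne_top _ _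
  · intro a b hab
    rw [Function.onFun, Set.disjoint_left]
    intro z hz hz'
    exact hab (hfun z y a b hz hz')
  · exact fun w => measurableSet_setOfPred.2 (hM y w)

end

/-! ### Binary digits -/

/-- The sequence of binary digits of a number in `[0,1]`. -/
noncomputable def digits (x : unitInterval) : ℕ → Bool := fun i => binDigit (i + 1) x

/-- The natural number whose binary expansion consists of the first `n` bits of `b`. -/
def prefixNum (b : ℕ → Bool) : ℕ → ℕ
  | 0 => 0
  | n + 1 => 2 * prefixNum b n + (b n).toNat

/-- The number with binary expansion `0.b₀b₁b₂…`, as the supremum of its truncations. -/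
noncomputable def ofBits (b : ℕ → Bool) : ℝ := ⨆ n, (prefixNum b n : ℝ) / 2 ^ n

theorem measurable_binDigit (i : ℕ) : Measurable (binDigit i) := by
  have h : Measurable fun n : ℕ => decide ((n - 1) % 2 = 1) := measurable_from_top
  exact h.comp (Nat.measurable_ceil.comp (by fun_prop))

theorem measurable_digits : Measurable digits :=
  measurable_pi_lambda _ fun i => measurable_binDigit (i + 1)

theorem ceil_eq_prefixNum {x : unitInterval} (hx : 0 < (x : ℝ)) (n : ℕ) :
    ⌈(2 : ℝ) ^ n * (x : ℝ)⌉₊ = prefixNum (digits x) n + 1 := by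
  induction n with
  | zero =>
    rw [Nat.ceil_eq_iff (by simp)]
    simp [prefixNum, hx, x.2.2]
  | succ n ih =>
    have hp : 0 < (2 : ℝ) ^ n * x := by positivity
    have hp' : 0 < (2 : ℝ) ^ (n + 1) * x := by positivity
    have h2 : (2 : ℝ) ^ (n + 1) * x = 2 * (2 ^ n * x) := by ring
    obtain ⟨h3, h4⟩ := (Nat.ceil_eq_iff (by omega)).1 ih
    simp only [Nat.add_sub_cancel] at h3
    obtain ⟨M, hM⟩ : ∃ M, ⌈(2 : ℝ) ^ (n + 1) * (x : ℝ)⌉₊ = M + 1 :=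
      Nat.exists_eq_succ_of_ne_zero (Nat.ceil_pos.2 hp').ne'
    obtain ⟨h5, h6⟩ := (Nat.ceil_eq_iff (by omega)).1 hM
    simp only [Nat.add_sub_cancel] at h5
    have h7 : digits x n = decide (M % 2 = 1) := by
      simp only [digits, binDigit, hM, Nat.add_sub_cancel]
    push_cast at h4 h6
    have h8 : 2 * prefixNum (digits x) n < M + 1 := by
      have : (2 * prefixNum (digits x) n : ℝ) < M + 1 := by linarith
      exact_mod_cast this
    have h9 : M < 2 * prefixNum (digits x) n + 2 := by
      have : (M : ℝ) < 2 * prefixNum (digits x) n + 2 := by linarith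
      exact_mod_cast this
    rw [hM, prefixNum, h7]
    rcases Nat.mod_two_eq_zero_or_one M with h | h <;> simp [h] <;> omega

theorem prefixNum_digits_eq_iff {x : unitInterval} (hx : 0 < (x : ℝ)) (n N : ℕ) :
    prefixNum (digits x) n = N ↔ (N : ℝ) / 2 ^ n < x ∧ (x : ℝ) ≤ (N + 1) / 2 ^ n := by
  have h := ceil_eq_prefixNum hx n
  have h1 : prefixNum (digits x) n = N ↔ ⌈(2 : ℝ) ^ n * (x : ℝ)⌉₊ = N + 1 := by omega
  rw [h1, Nat.ceil_eq_iff (by omega), div_lt_iff₀ (by positivity), le_div_iff₀ (by positivity)]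
  simp only [Nat.add_sub_cancel, mul_comm (x : ℝ)]
  push_cast
  rfl

theorem prefixNum_eq_iff (b b' : ℕ → Bool) (n : ℕ) :
    prefixNum b n = prefixNum b' n ↔ ∀ i < n, b i = b' i := by
  induction n with
  | zero => simp [prefixNum]
  | succ n ih =>
    simp only [prefixNum, Nat.lt_succ_iff_lt_or_eq, or_imp, forall_and, ← ih, forall_eq]
    cases b n <;> cases b' n <;> simp <;> omega

theorem map_digits : (volume : Measure unitInterval).map digits = fair ℕ := by
  have := Measure.isProbabilityMeasure_map (μ := (volume : Measure unitInterval))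
    measurable_digits.aemeasurable
  refine eq_fair_of_prefixSet fun n ε => ?_
  rw [Measure.map_apply measurable_digits (measurableSet_prefixSet n ε)]
  have hlt : prefixNum ε n + 1 ≤ 2 ^ n := by
    induction n with
    | zero => simp [prefixNum]
    | succ n ih =>
      have := Bool.toNat_le (ε n)
      rw [prefixNum, pow_succ]; omega
  have hlt' : (prefixNum ε n : ℝ) + 1 ≤ 2 ^ n := by exact_mod_cast hlt
  let a : unitInterval := ⟨(prefixNum ε n : ℝ) / 2 ^ n, by positivity, by
    rw [div_le_one (by positivity)]; linarith⟩
  let c : unitInterval := ⟨((prefixNum ε n : ℝ) + 1) / 2 ^ n, by positivity, by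
    rw [div_le_one (by positivity)]; linarith⟩
  -- a word of length `n` fixes a half-open dyadic interval, up to the point `0`
  have hae : (digits ⁻¹' prefixSet n ε : Set unitInterval) =ᵐ[volume] Set.Ioc a c := by
    have h0 : ∀ᵐ x : unitInterval, x ≠ 0 := by
      rw [ae_iff]; simp
    filter_upwards [h0] with x hx
    have hx' : 0 < (x : ℝ) := unitInterval.pos_iff_ne_zero.2 hx
    apply propext
    change (∀ i < n, digits x i = ε i) ↔ _
    rw [← prefixNum_eq_iff, prefixNum_digits_eq_iff hx']
    rfl
  rw [measure_congr hae, unitInterval.volume_Ioc]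
  have : (c : ℝ) - a = (2⁻¹ : ℝ) ^ n := by
    simp only [a, c]
    rw [inv_pow]; field_simp; ring
  rw [this, ENNReal.ofReal_pow (by norm_num), ENNReal.ofReal_inv_of_pos (by norm_num)]
  simp

theorem prefixNum_div_monotone (b : ℕ → Bool) : Monotone fun n => (prefixNum b n : ℝ) / 2 ^ n := by
  refine monotone_nat_of_le_succ fun n => ?_
  rw [div_le_div_iff₀ (by positivity) (by positivity), prefixNum, pow_succ]
  push_cast
  have h1 : (0 : ℝ) ≤ (b n).toNat := by positivity
  have h2 : (0 : ℝ) < 2 ^ n := by positivity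
  nlinarith

theorem prefixNum_div_antitone (b : ℕ → Bool) :
    Antitone fun n => ((prefixNum b n : ℝ) + 1) / 2 ^ n := by
  refine antitone_nat_of_succ_le fun n => ?_
  rw [div_le_div_iff₀ (by positivity) (by positivity), prefixNum, pow_succ]
  push_cast
  have h1 : ((b n).toNat : ℝ) ≤ 1 := by exact_mod_cast Bool.toNat_le (b n)
  have h2 : (0 : ℝ) < 2 ^ n := by positivity
  nlinarith

theorem prefixNum_div_le (b : ℕ → Bool) (m n : ℕ) :
    (prefixNum b m : ℝ) / 2 ^ m ≤ ((prefixNum b n : ℝ) + 1) / 2 ^ n := by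
  refine (prefixNum_div_monotone b (le_max_left m n)).trans
    (le_trans ?_ (prefixNum_div_antitone b (le_max_right m n)))
  simp only
  gcongr
  linarith

theorem bddAbove_prefixNum_div (b : ℕ → Bool) :
    BddAbove (Set.range fun n => (prefixNum b n : ℝ) / 2 ^ n) :=
  ⟨_, by rintro _ ⟨m, rfl⟩; exact prefixNum_div_le b m 0⟩

theorem ofBits_mem (b : ℕ → Bool) : ofBits b ∈ unitInterval := by
  constructor
  · refine le_trans ?_ (le_ciSup (bddAbove_prefixNum_div b) 0)
    simp [prefixNum]
  · refine ciSup_le fun m => (prefixNum_div_le b m 0).trans ?_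
    simp [prefixNum]

/-- The number in `[0,1]` with given binary digits. -/
noncomputable def unitOfBits (b : ℕ → Bool) : unitInterval := ⟨ofBits b, ofBits_mem b⟩

theorem measurable_unitOfBits : Measurable unitOfBits := by
  have hnum : ∀ n, Measurable fun b : ℕ → Bool => prefixNum b n := by
    intro n
    induction n with
    | zero => exact measurable_const
    | succ n ih =>
      have : Measurable Bool.toNat := measurable_from_top
      exact (ih.const_mul 2).add (this.comp (measurable_pi_apply n))
  refine Measurable.subtype_mk (Measurable.iSup fun n => ?_)
  have : Measurable fun k : ℕ => (k : ℝ) / 2 ^ n := measurable_from_top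
  exact this.comp (hnum n)

/-- The convention that expansions of positive numbers have infinitely many ones matters here. -/
theorem digits_unitOfBits {b : ℕ → Bool} (hb : ∀ n, ∃ m, n ≤ m ∧ b m = true) :
    digits (unitOfBits b) = b := by
  have hlt : ∀ n, (prefixNum b n : ℝ) / 2 ^ n < ofBits b := by
    intro n
    obtain ⟨m, hnm, hm⟩ := hb n
    refine (prefixNum_div_monotone b hnm).trans_lt
      (lt_of_lt_of_le ?_ (le_ciSup (bddAbove_prefixNum_div b) (m + 1)))
    simp only
    rw [div_lt_div_iff₀ (by positivity) (by positivity), prefixNum, hm, pow_succ]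
    push_cast
    have h2 : (0 : ℝ) < 2 ^ m := by positivity
    simp only [Bool.toNat_true, Nat.cast_one]
    nlinarith
  have hpos : 0 < ((unitOfBits b : unitInterval) : ℝ) := by
    have := hlt 0
    simp only [prefixNum, Nat.cast_zero, zero_div] at this
    exact this
  funext i
  refine (prefixNum_eq_iff _ _ (i + 1)).1 ?_ i (Nat.lt_succ_self i)
  exact (prefixNum_digits_eq_iff hpos _ _).2 ⟨hlt _, ciSup_le fun m => prefixNum_div_le b m _⟩

theorem unitOfBits_digits {x : unitInterval} (hx : 0 < (x : ℝ)) : unitOfBits (digits x) = x := by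
  have h := fun n => (prefixNum_digits_eq_iff hx n _).1 rfl
  refine Subtype.ext (le_antisymm (ciSup_le fun n => (h n).1.le) ?_)
  refine le_of_forall_pos_le_add fun ε hε => ?_
  obtain ⟨n, hn⟩ := exists_pow_lt_of_lt_one hε (by norm_num : (1 / 2 : ℝ) < 1)
  have h1 := (h n).2
  have h2 := le_ciSup (bddAbove_prefixNum_div (digits x)) n
  rw [add_div] at h1
  have h3 : (1 : ℝ) / 2 ^ n = (1 / 2) ^ n := by rw [div_pow, one_pow]
  rw [h3] at h1
  change (x : ℝ) ≤ ofBits (digits x) + ε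
  unfold ofBits
  linarith

theorem map_unitOfBits : (fair ℕ).map unitOfBits = volume := by
  rw [← map_digits, Measure.map_map measurable_unitOfBits measurable_digits]
  have h0 : ∀ᵐ x : unitInterval, x ≠ 0 := by
    rw [ae_iff]; simp
  conv_rhs => rw [← Measure.map_id (μ := (volume : Measure unitInterval))]
  refine Measure.map_congr ?_
  filter_upwards [h0] with x hx
  exact unitOfBits_digits (unitInterval.pos_iff_ne_zero.2 hx)

theorem ae_fair_frequently_true : ∀ᵐ b ∂(fair ℕ), ∀ n, ∃ m, n ≤ m ∧ b m = true := by
  rw [ae_all_iff]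
  intro n
  rw [ae_iff]
  have hle : ∀ k : ℕ, fair ℕ {b | ¬ ∃ m, n ≤ m ∧ b m = true} ≤ (2⁻¹ : ENNReal) ^ k := by
    intro k
    have h1 : {b : ℕ → Bool | ¬ ∃ m, n ≤ m ∧ b m = true} ⊆
        Set.pi (Finset.Ico n (n + k)) fun _ => {false} := by
      intro b hb i hi
      by_contra h
      exact hb ⟨i, (Finset.mem_Ico.1 hi).1, by simpa using h⟩
    refine (measure_mono h1).trans ?_
    rw [fair, Measure.infinitePi_pi _ (fun _ _ => by measurability)]
    simp [coin_singleton]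
  have hlim := ENNReal.tendsto_pow_atTop_nhds_zero_of_lt_one
    (show (2⁻¹ : ENNReal) < 1 from ENNReal.one_half_lt_one)
  exact le_antisymm (ge_of_tendsto' hlim hle) bot_le

/-- All binary digits of a labeling. -/
noncomputable def digitMap {Γ : Type*} (ω : Γ → unitInterval) : Γ × ℕ → Bool :=
  fun i => digits (ω i.1) i.2

theorem measurable_digitMap {Γ : Type*} : Measurable (digitMap (Γ := Γ)) :=
  measurable_pi_lambda _ fun i =>
    (measurable_binDigit (i.2 + 1)).comp (measurable_pi_apply i.1)

theorem map_digitMap (Γ : Type*) : (iidUniform Γ).map digitMap = fair (Γ × ℕ) := by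
  have h1 : (iidUniform Γ).map (fun ω v => digits (ω v)) = Measure.infinitePi fun _ => fair ℕ := by
    unfold iidUniform
    rw [Measure.infinitePi_map_pi (fun _ : Γ => (volume : Measure unitInterval))
      (fun _ => measurable_digits)]
    simp only [map_digits]
  have h2 := Measure.infinitePi_map_curry_symm fun (_ : Γ) (_ : ℕ) => coin
  have h3 : Measurable fun (ω : Γ → unitInterval) v => digits (ω v) :=
    measurable_pi_lambda _ fun v => measurable_digits.comp (measurable_pi_apply v)
  unfold fair at h1 ⊢
  rw [← h2, ← h1, Measure.map_map (by fun_prop) h3]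
  rfl

/-! ### Coarsening a partition into finite cells -/

/-- `y` is the element of `C` with the smallest label, in the lexicographic order. -/
def IsLeader {V : Type*} (lab : V → ℕ → Bool) (C : Set V) (y : V) : Prop :=
  y ∈ C ∧ ∀ z ∈ C, ¬ toLex (lab z) < toLex (lab y)

theorem IsLeader.unique {V : Type*} {lab : V → ℕ → Bool} (hlab : Function.Injective lab)
    {C : Set V} {y y' : V} (h : IsLeader lab C y) (h' : IsLeader lab C y') : y = y' := by
  refine hlab (toLex.injective ?_)
  exact le_antisymm (not_lt.1 (h.2 _ h'.1)) (not_lt.1 (h'.2 _ h.1))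

theorem exists_isLeader {V : Type*} (lab : V → ℕ → Bool) {C : Set V} (hC : C.Finite)
    (hne : C.Nonempty) : ∃ y, IsLeader lab C y := by
  obtain ⟨y, hy, hmin⟩ := Set.exists_min_image C (fun x => toLex (lab x)) hC hne
  exact ⟨y, hy, fun z hz => not_lt.2 (hmin z hz)⟩

/-- A finite connected union of cells that contains branching vertices of two distinct cells. -/
structure IsSeedSet {V : Type*} (F : SimpleGraph V) (s : Setoid V) (K : Finset V) : Prop where
  saturated : ∀ x ∈ K, ∀ y, s x y → y ∈ K
  connected : ∀ x ∈ K, ∀ y ∈ K, (within F K).Reachable x y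
  two : ∃ u ∈ K, ∃ v ∈ K, ¬ s u v ∧ IsBranching F u ∧ IsBranching F v

/-- Codes for finite sets of labeled group elements: a finite set of group elements bounding the
differences of elements, a precision `m`, and a set of words of length `m`. -/
abbrev Code (Γ : Type*) := Finset Γ × (Σ m : ℕ, Finset (Fin m → Bool))

section

variable {Γ : Type*} [Group Γ] (F : SimpleGraph Γ) (s : Setoid Γ) (lab : Γ → ℕ → Bool)

/-- The seed set `K` is compatible with the code `c`. -/
def HasCode (c : Code Γ) (K : Finset Γ) : Prop :=
  IsSeedSet F s K ∧ (∀ x ∈ K, ∀ y ∈ K, x⁻¹ * y ∈ c.1) ∧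
    K.image (fun x (i : Fin c.2.1) => lab x i) = c.2.2

/-- No other seed set that meets `K` is compatible with the code `c` of `K`. -/
def IsIsolated (c : Code Γ) (K : Finset Γ) : Prop :=
  HasCode F s lab c K ∧ ∀ K', HasCode F s lab c K' → ¬ Disjoint K K' → K' = K

variable [Encodable Γ]

/-- Seeds are the seed sets isolated by a code that is minimal in their tree; this selects
equivariantly a nonempty family of pairwise disjoint seed sets in each tree. -/
def IsSeed (K : Finset Γ) : Prop :=
  ∃ c, IsIsolated F s lab c K ∧ ∀ c' K', IsIsolated F s lab c' K' →
    Encodable.encode c' < Encodable.encode c → ∀ x ∈ K, ∀ y ∈ K', ¬ F.Reachable x y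

/-- The growth of the seeds.  At time `0` the vertices of each seed are assigned to its leader; in
each later round all unassigned cells adjacent to assigned vertices join one of these. -/
def AssignedBy : ℕ → Γ → Γ → Prop
  | 0, x, y => ∃ K : Finset Γ, IsSeed F s lab K ∧ x ∈ K ∧ IsLeader lab K y
  | k + 1, x, y => AssignedBy k x y ∨ ((∀ y', ¬ AssignedBy k x y') ∧
      IsLeader lab {y' | ∃ x' x'', s x x' ∧ F.Adj x' x'' ∧ AssignedBy k x'' y'} y)

/-- `x` is eventually assigned to `y`. -/
def Assigned (x y : Γ) : Prop := ∃ k, AssignedBy F s lab k x y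

/-- The partition into the sets of vertices that are assigned to the same vertex. -/
def coarsen : Setoid Γ where
  r x y := ∀ z, Assigned F s lab x z ↔ Assigned F s lab y z
  iseqv := ⟨fun _ _ => Iff.rfl, fun h z => (h z).symm, fun h h' z => (h z).trans (h' z)⟩

variable {F s lab}

omit [Encodable Γ] in
theorem IsIsolated.eq_of_mem {c : Code Γ} {K K' : Finset Γ} (h : IsIsolated F s lab c K)
    (h' : IsIsolated F s lab c K') {x : Γ} (hx : x ∈ K) (hx' : x ∈ K') : K = K' :=
  (h.2 K' h'.1 (Finset.not_disjoint_iff.2 ⟨x, hx, hx'⟩)).symm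

theorem IsSeed.eq_of_mem {K K' : Finset Γ} (h : IsSeed F s lab K) (h' : IsSeed F s lab K') {x : Γ}
    (hx : x ∈ K) (hx' : x ∈ K') : K = K' := by
  obtain ⟨c, hc, hmin⟩ := h
  obtain ⟨c', hc', hmin'⟩ := h'
  rcases lt_trichotomy (Encodable.encode c) (Encodable.encode c') with h1 | h1 | h1
  · exact absurd (SimpleGraph.Reachable.refl x) (hmin' c K hc h1 x hx' x hx)
  · have := Encodable.encode_injective h1
    subst this
    exact hc.eq_of_mem hc' hx hx'
  · exact absurd (SimpleGraph.Reachable.refl x) (hmin c' K' hc' h1 x hx x hx')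

theorem IsSeed.isSeedSet {K : Finset Γ} (h : IsSeed F s lab K) : IsSeedSet F s K :=
  let ⟨_, hc, _⟩ := h; hc.1.1

theorem AssignedBy.mono {k l : ℕ} (hkl : k ≤ l) {x y : Γ} (h : AssignedBy F s lab k x y) :
    AssignedBy F s lab l x y := by
  induction hkl with
  | refl => exact h
  | step _ ih => exact Or.inl ih

theorem AssignedBy.congr {k : ℕ} {x x' : Γ} (hx : s x x') {y : Γ}
    (h : AssignedBy F s lab k x y) : AssignedBy F s lab k x' y := by
  induction k generalizing x x' y with
  | zero =>
    obtain ⟨K, hK, hxK, hy⟩ := h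
    exact ⟨K, hK, hK.isSeedSet.saturated x hxK x' hx, hy⟩
  | succ k ih =>
    rcases h with h | ⟨h1, h2⟩
    · exact Or.inl (ih hx h)
    · refine Or.inr ⟨fun y' h => h1 y' (ih (s.symm' hx) h), ?_⟩
      have : ∀ z, s x' z ↔ s x z := fun z => ⟨fun h => s.trans' hx h, fun h =>
        s.trans' (s.symm' hx) h⟩
      simpa only [this] using h2

theorem AssignedBy.unique (hlab : Function.Injective lab) {k : ℕ} {x y y' : Γ}
    (h : AssignedBy F s lab k x y) (h' : AssignedBy F s lab k x y') : y = y' := by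
  induction k with
  | zero =>
    obtain ⟨K, hK, hxK, hy⟩ := h
    obtain ⟨K', hK', hxK', hy'⟩ := h'
    obtain rfl := hK.eq_of_mem hK' hxK hxK'
    exact hy.unique hlab hy'
  | succ k ih =>
    rcases h with h | ⟨h1, h2⟩ <;> rcases h' with h' | ⟨h1', h2'⟩
    · exact ih h h'
    · exact absurd h (h1' _)
    · exact absurd h' (h1 _)
    · exact h2.unique hlab h2'

theorem Assigned.unique (hlab : Function.Injective lab) {x y y' : Γ}
    (h : Assigned F s lab x y) (h' : Assigned F s lab x y') : y = y' := by
  obtain ⟨k, hk⟩ := h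
  obtain ⟨l, hl⟩ := h'
  exact (hk.mono (le_max_left k l)).unique hlab (hl.mono (le_max_right k l))

theorem AssignedBy.exists_seed {k : ℕ} {x y : Γ} (h : AssignedBy F s lab k x y) :
    ∃ K : Finset Γ, IsSeed F s lab K ∧ IsLeader lab K y := by
  induction k generalizing x with
  | zero =>
    obtain ⟨K, hK, _, hy⟩ := h
    exact ⟨K, hK, hy⟩
  | succ k ih =>
    rcases h with h | ⟨_, ⟨_, x'', _, _, h⟩, _⟩
    · exact ih h
    · exact ih h

theorem AssignedBy.reachable (hs : FiniteConnectedCells F s) {k : ℕ} {x y : Γ}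
    (h : AssignedBy F s lab k x y) :
    (within F {w | AssignedBy F s lab k w y}).Reachable x y := by
  induction k generalizing x with
  | zero =>
    obtain ⟨K, hK, hxK, hy⟩ := h
    refine (hK.isSeedSet.connected x hxK y hy.1).mono (within_mono le_rfl ?_)
    intro w hw
    exact ⟨K, hK, hw, hy⟩
  | succ k ih =>
    have hmono : within F {w | AssignedBy F s lab k w y} ≤
        within F {w | AssignedBy F s lab (k + 1) w y} := within_mono le_rfl fun w hw => Or.inl hw
    have h0 := h
    rcases h with h | ⟨_, ⟨x', x'', hx', hadj, h'⟩, _⟩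
    · exact (ih h).mono hmono
    · have hcell : ∀ w, s x w → AssignedBy F s lab (k + 1) w y := fun w hw => h0.congr hw
      have h1 : (within F {w | AssignedBy F s lab (k + 1) w y}).Reachable x x' :=
        (hs.connected x x' hx').mono (within_mono le_rfl hcell)
      exact (reachable_step h1 ⟨hadj, hcell x' hx', Or.inl h'⟩).trans ((ih h').mono hmono)

theorem Assigned.reachable (hs : FiniteConnectedCells F s) {x y : Γ}
    (h : Assigned F s lab x y) : (within F {w | Assigned F s lab w y}).Reachable x y := by
  obtain ⟨k, hk⟩ := h
  exact (hk.reachable hs).mono (within_mono le_rfl fun w hw => ⟨k, hw⟩)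

end

/-- Reachable vertices lie in a common finite connected union of cells. -/
theorem FiniteConnectedCells.exists_finset {V : Type*} {F : SimpleGraph V} {s : Setoid V}
    (hs : FiniteConnectedCells F s) {u v : V} (h : F.Reachable u v) :
    ∃ K : Finset V, u ∈ K ∧ v ∈ K ∧ (∀ x ∈ K, ∀ y, s x y → y ∈ K) ∧
      ∀ x ∈ K, (within F K).Reachable u x := by
  classical
  refine reachable_induction (P := fun v => ∃ K : Finset V, u ∈ K ∧ v ∈ K ∧
    (∀ x ∈ K, ∀ y, s x y → y ∈ K) ∧ ∀ x ∈ K, (within F K).Reachable u x) ?_ ?_ h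
  · refine ⟨(hs.finite u).toFinset, by simp, by simp, ?_, ?_⟩
    · intro x hx y hxy
      simp only [Set.Finite.mem_toFinset, Set.mem_ofPred_eq] at hx ⊢
      exact s.trans' hx hxy
    · intro x hx
      simp only [Set.Finite.mem_toFinset, Set.mem_ofPred_eq] at hx
      simpa using hs.connected u x hx
  · rintro y z _ ⟨K, huK, hyK, hsat, hconn⟩ hyz
    refine ⟨K ∪ (hs.finite z).toFinset, by simp [huK], by simp, ?_, ?_⟩
    · intro x hx w hxw
      simp only [Finset.mem_union, Set.Finite.mem_toFinset, Set.mem_ofPred_eq] at hx ⊢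
      exact hx.imp (fun h => hsat x h w hxw) fun h => s.trans' h hxw
    · have h1 : within F K ≤ within F (K ∪ (hs.finite z).toFinset : Finset V) :=
        within_mono le_rfl (by simp)
      intro x hx
      rcases Finset.mem_union.1 hx with hx' | hx'
      · exact (hconn x hx').mono h1
      · have h2 : s z x := by simpa using hx'
        refine (reachable_step ((hconn y hyK).mono h1) ⟨hyz, by simp [hyK], by simp⟩).trans ?_
        refine (hs.connected z x h2).mono (within_mono le_rfl ?_)
        intro w hw
        have : s z w := hw
        simp [this]

/-- The situation in which a partition can be coarsened: labels are distinct, degrees and cells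
are finite, and each tree has branching vertices in two distinct cells. -/
structure CanCoarsen {V : Type*} (F : SimpleGraph V) (s : Setoid V) (lab : V → ℕ → Bool) :
    Prop where
  injective : Function.Injective lab
  locallyFinite : ∀ x, (F.neighborSet x).Finite
  cells : FiniteConnectedCells F s
  branching : ∀ x, ∃ u v, F.Reachable x u ∧ F.Reachable x v ∧ ¬ s u v ∧
    IsBranching F u ∧ IsBranching F v

section

variable {Γ : Type*} [Group Γ] {F : SimpleGraph Γ} {s : Setoid Γ} {lab : Γ → ℕ → Bool}

omit [Group Γ] in
theorem CanCoarsen.exists_isSeedSet (h : CanCoarsen F s lab) (x : Γ) :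
    ∃ K, IsSeedSet F s K ∧ ∃ y ∈ K, F.Reachable x y := by
  obtain ⟨u, v, hu, hv, huv, hbu, hbv⟩ := h.branching x
  obtain ⟨K, huK, hvK, hsat, hconn⟩ := h.cells.exists_finset (hu.symm.trans hv)
  exact ⟨K, ⟨hsat, fun a ha b hb => (hconn a ha).symm.trans (hconn b hb),
    u, huK, v, hvK, huv, hbu, hbv⟩, u, huK, hu⟩

/-- On a finite set, distinct labels are distinguished by finitely many bits. -/
theorem exists_prefix_injOn {V : Type*} {lab : V → ℕ → Bool} (hlab : Function.Injective lab)
    (N : Finset V) : ∃ m : ℕ, Set.InjOn (fun x (i : Fin m) => lab x i) N := by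
  classical
  have : ∀ p : V × V, ∃ i, p.1 ≠ p.2 → lab p.1 i ≠ lab p.2 i := by
    intro p
    by_cases hp : p.1 = p.2
    · exact ⟨0, fun h => absurd hp h⟩
    · obtain ⟨i, hi⟩ := Function.ne_iff.1 (hlab.ne hp)
      exact ⟨i, fun _ => hi⟩
  choose i hi using this
  refine ⟨(N ×ˢ N).sup i + 1, fun x hx y hy hxy => ?_⟩
  by_contra hne
  have hle : i (x, y) ≤ (N ×ˢ N).sup i := Finset.le_sup (Finset.mem_product.2 ⟨hx, hy⟩)
  exact hi (x, y) hne (congrFun hxy ⟨i (x, y), by omega⟩)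

/-- A seed set is isolated by its code at any precision that distinguishes all vertices near it. -/
theorem IsSeedSet.exists_isIsolated (hlab : Function.Injective lab) {K : Finset Γ}
    (hK : IsSeedSet F s K) : ∃ c, IsIsolated F s lab c K := by
  classical
  let r : Finset Γ := Finset.image₂ (fun x y => x⁻¹ * y) K K
  -- every compatible set that meets `K` is contained in this finite set
  let N : Finset Γ := Finset.image₂ (fun x y => x * y) K r
  obtain ⟨m, hm⟩ := exists_prefix_injOn hlab N
  have hsub : ∀ K' : Finset Γ, (∀ x ∈ K', ∀ y ∈ K', x⁻¹ * y ∈ r) → ¬ Disjoint K K' →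
      ∀ y ∈ K', y ∈ N := by
    intro K' hK' hd y hy
    obtain ⟨w, hw, hw'⟩ := Finset.not_disjoint_iff.1 hd
    exact Finset.mem_image₂.2 ⟨w, hw, w⁻¹ * y, hK' w hw' y hy, by simp⟩
  have hr : ∀ x ∈ K, ∀ y ∈ K, x⁻¹ * y ∈ r := fun x hx y hy =>
    Finset.mem_image₂.2 ⟨x, hx, y, hy, rfl⟩
  refine ⟨⟨r, m, K.image (fun x (i : Fin m) => lab x i)⟩, ⟨hK, hr, rfl⟩, ?_⟩
  rintro K' ⟨_, hr', him⟩ hd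
  have hd' : ¬ Disjoint K K := by
    obtain ⟨w, hw, _⟩ := Finset.not_disjoint_iff.1 hd
    exact Finset.not_disjoint_iff.2 ⟨w, hw, hw⟩
  have key : ∀ A B : Finset Γ, (∀ y ∈ A, y ∈ N) → (∀ y ∈ B, y ∈ N) →
      A.image (fun x (i : Fin m) => lab x i) = B.image (fun x (i : Fin m) => lab x i) →
      ∀ x ∈ A, x ∈ B := by
    intro A B hA hB hAB x hx
    have h1 := Finset.mem_image_of_mem (fun x (i : Fin m) => lab x i) hx
    rw [hAB, Finset.mem_image] at h1
    obtain ⟨y, hy, hyx⟩ := h1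
    rwa [← hm (hB y hy) (hA x hx) hyx]
  ext x
  exact ⟨key K' K (hsub K' hr' hd) (hsub K hr hd') him x,
    key K K' (hsub K hr hd') (hsub K' hr' hd) him.symm x⟩

variable [Encodable Γ]

theorem CanCoarsen.exists_isSeed (h : CanCoarsen F s lab) (x : Γ) :
    ∃ K, IsSeed F s lab K ∧ ∃ y ∈ K, F.Reachable x y := by
  have hex : ∃ n, ∃ c K, Encodable.encode c = n ∧ IsIsolated F s lab c K ∧
      ∃ y ∈ K, F.Reachable x y := by
    obtain ⟨K, hK, hy⟩ := h.exists_isSeedSet x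
    obtain ⟨c, hc⟩ := hK.exists_isIsolated h.injective
    exact ⟨_, c, K, rfl, hc, hy⟩
  classical
  obtain ⟨c, K, hcn, hc, y, hy, hxy⟩ := Nat.find_spec hex
  refine ⟨K, ⟨c, hc, ?_⟩, y, hy, hxy⟩
  intro c' K' hc' hlt a ha b hb hab
  rw [hcn] at hlt
  refine Nat.find_min hex hlt ⟨c', K', rfl, hc', b, hb, ?_⟩
  refine (hxy.trans ?_).trans hab
  exact (hc.1.1.connected y hy a ha).mono (within_le _ _)

theorem CanCoarsen.exists_assigned (h : CanCoarsen F s lab) (x : Γ) :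
    ∃ y, Assigned F s lab x y := by
  obtain ⟨K, hK, w, hw, hxw⟩ := h.exists_isSeed x
  obtain ⟨y, hy⟩ := exists_isLeader lab K.finite_toSet ⟨w, hw⟩
  have h0 : ∃ k y, AssignedBy F s lab k w y := ⟨0, y, K, hK, hw, hy⟩
  have : ∃ k y, AssignedBy F s lab k x y := by
    refine reachable_induction (P := fun x => ∃ k y, AssignedBy F s lab k x y) h0 ?_ hxw.symm
    rintro a b _ ⟨k, y, hk⟩ hab
    by_cases hb : ∃ y', AssignedBy F s lab k b y'
    · exact ⟨k, hb⟩
    · push Not at hb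
      have hfin : {y' | ∃ x' x'', s b x' ∧ F.Adj x' x'' ∧ AssignedBy F s lab k x'' y'}.Finite := by
        have h1 : {x'' | ∃ x', s b x' ∧ F.Adj x' x''}.Finite := by
          refine ((h.cells.finite b).biUnion fun x' _ => h.locallyFinite x').subset ?_
          rintro x'' ⟨x', h1, h2⟩
          exact Set.mem_biUnion h1 h2
        have h2 : ∀ x'', {y' | AssignedBy F s lab k x'' y'}.Finite := fun x'' =>
          Set.Subsingleton.finite fun y1 h1 y2 h2 => AssignedBy.unique h.injective h1 h2
        refine (h1.biUnion fun x'' _ => h2 x'').subset ?_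
        rintro y' ⟨x', x'', h3, h4, h5⟩
        exact Set.mem_biUnion (show x'' ∈ {x'' | ∃ x', s b x' ∧ F.Adj x' x''} from ⟨x', h3, h4⟩) h5
      obtain ⟨y', hy'⟩ := exists_isLeader lab hfin ⟨y, b, a, s.refl' b, hab.symm, hk⟩
      exact ⟨k + 1, y', Or.inr ⟨hb, hy'⟩⟩
  obtain ⟨k, y, hk⟩ := this
  exact ⟨y, k, hk⟩

theorem CanCoarsen.coarsen_iff (h : CanCoarsen F s lab) {x y z : Γ} (hx : Assigned F s lab x z) :
    coarsen F s lab x y ↔ Assigned F s lab y z := by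
  constructor
  · intro hxy
    exact (hxy z).1 hx
  · intro hy w
    constructor
    · intro hw
      rwa [← hx.unique h.injective hw]
    · intro hw
      rwa [← hy.unique h.injective hw]

theorem le_coarsen : s ≤ coarsen F s lab := by
  intro x y hxy z
  exact ⟨fun ⟨k, hk⟩ => ⟨k, hk.congr hxy⟩, fun ⟨k, hk⟩ => ⟨k, hk.congr (s.symm' hxy)⟩⟩

theorem CanCoarsen.finiteConnectedCells (h : CanCoarsen F s lab)
    (hfin : ∀ z, {x | Assigned F s lab x z}.Finite) :
    FiniteConnectedCells F (coarsen F s lab) := by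
  refine ⟨fun x => ?_, fun x y hxy => ?_⟩
  · obtain ⟨z, hz⟩ := h.exists_assigned x
    exact (hfin z).subset fun y hy => (h.coarsen_iff hz).1 hy
  · obtain ⟨z, hz⟩ := h.exists_assigned x
    have h1 : {w | coarsen F s lab x w} = {w | Assigned F s lab w z} := by
      ext w; exact h.coarsen_iff hz
    rw [h1]
    exact (hz.reachable h.cells).trans (((h.coarsen_iff hz).1 hxy).reachable h.cells).symm

/-- Each cell of the coarsened partition contains branching vertices of two cells of the original
partition. -/
theorem CanCoarsen.exists_two_branching (h : CanCoarsen F s lab) (x : Γ) :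
    ∃ u v, coarsen F s lab x u ∧ coarsen F s lab x v ∧ ¬ s u v ∧
      IsBranching F u ∧ IsBranching F v := by
  obtain ⟨z, hz⟩ := h.exists_assigned x
  obtain ⟨K, hK, hzK⟩ := hz.choose_spec.exists_seed
  obtain ⟨u, hu, v, hv, huv, hbu, hbv⟩ := hK.isSeedSet.two
  exact ⟨u, v, (h.coarsen_iff hz).2 ⟨0, K, hK, hu, hzK⟩,
    (h.coarsen_iff hz).2 ⟨0, K, hK, hv, hzK⟩, huv, hbu, hbv⟩

theorem CanCoarsen.isCoarseGraining (h : CanCoarsen F s lab) (hF : F.IsAcyclic)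
    (hfin : ∀ z, {x | Assigned F s lab x z}.Finite) {T : SimpleGraph Γ} (hT : F ≤ T) :
    IsCoarseGraining T F (coarsen F s lab) := by
  have hc := h.finiteConnectedCells hfin
  refine ⟨hc.finite, fun x => ?_, fun x y hxy => (hc.connected x y hxy).mono (within_le _ _), ?_⟩
  · have : Nonempty {y | (coarsen F s lab).r x y} := ⟨⟨x, (coarsen F s lab).refl' x⟩⟩
    refine ⟨fun y z => ?_⟩
    rw [induce_reachable_iff]
    exact (hc.reachable y.2 z.2).mono (within_mono hT le_rfl)
  · intro c
    obtain ⟨x, rfl⟩ := Quotient.exists_rep c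
    obtain ⟨u, v, hu, hv, huv, hbu, hbv⟩ := h.exists_two_branching x
    refine four_le_neighborSet hF hc hu hv ?_ hbu hbv
    rintro rfl
    exact huv (s.refl' u)

end

/-! ### Measurability -/

section

variable {α V : Type*} [MeasurableSpace α] [Countable V]

theorem measurable_reachable {F : α → SimpleGraph V} (hF : ∀ x y, Measurable fun a => (F a).Adj x y)
    (x y : V) : Measurable fun a => (F a).Reachable x y := by
  have h1 : ∀ (n : ℕ) (y : V), Measurable fun a => ∃ p : (F a).Walk x y, p.length = n := by
    intro n
    induction n with
    | zero =>
      intro y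
      have : (fun a => ∃ p : (F a).Walk x y, p.length = 0) = fun _ => x = y := by
        funext a
        exact propext SimpleGraph.Walk.exists_length_eq_zero_iff
      rw [this]
      exact measurable_const
    | succ n ih =>
      intro y
      have : (fun a => ∃ p : (F a).Walk x y, p.length = n + 1) =
          fun a => ∃ z, (∃ p : (F a).Walk x z, p.length = n) ∧ (F a).Adj z y := by
        funext a
        apply propext
        constructor
        · rintro ⟨p, hp⟩
          obtain ⟨z, q, h, rfl⟩ : ∃ z, ∃ (q : (F a).Walk x z) (h : (F a).Adj z y),
              p = q.concat h := by
            cases p with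
            | nil => simp at hp
            | cons h p =>
              obtain ⟨z, q, h', hq⟩ := SimpleGraph.Walk.exists_cons_eq_concat h p
              exact ⟨z, q, h', hq⟩
          exact ⟨z, ⟨q, by simpa using hp⟩, h⟩
        · rintro ⟨z, ⟨q, hq⟩, h⟩
          exact ⟨q.concat h, by simp [hq]⟩
      rw [this]
      exact Measurable.exists fun z => (ih z).and (hF z y)
  have h2 : (fun a => (F a).Reachable x y) =
      fun a => ∃ n, ∃ p : (F a).Walk x y, p.length = n := by
    funext a
    exact propext ⟨fun ⟨p⟩ => ⟨_, p, rfl⟩, fun ⟨_, p, _⟩ => ⟨p⟩⟩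
  rw [h2]
  exact Measurable.exists fun n => h1 n y

omit [Countable V] in
theorem measurable_within {F : α → SimpleGraph V} (hF : ∀ x y, Measurable fun a => (F a).Adj x y)
    (C : Set V) (x y : V) : Measurable fun a => (within (F a) C).Adj x y :=
  (hF x y).and measurable_const

theorem measurable_infinite {p : α → V → Prop} (hp : ∀ x, Measurable fun a => p a x) :
    Measurable fun a => {x | p a x}.Infinite := by
  have : (fun a => {x | p a x}.Infinite) = fun a => ∀ K : Finset V, ∃ x, x ∉ K ∧ p a x := by
    funext a
    apply propext
    constructor
    · intro h K
      obtain ⟨x, hx, hxK⟩ := h.exists_notMem_finset K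
      exact ⟨x, hxK, hx⟩
    · intro h hfin
      obtain ⟨x, hx, hpx⟩ := h hfin.toFinset
      exact hx (hfin.mem_toFinset.2 hpx)
  rw [this]
  exact Measurable.forall fun K => Measurable.exists fun x => measurable_const.and (hp x)

theorem measurable_isBranching {F : α → SimpleGraph V}
    (hF : ∀ x y, Measurable fun a => (F a).Adj x y) (u : V) :
    Measurable fun a => IsBranching (F a) u := by
  refine Measurable.exists fun a => measurable_const.and (Measurable.forall fun i =>
    (hF _ _).and (measurable_infinite fun w => ?_))
  exact measurable_reachable (measurable_within hF _) _ _

theorem measurable_eq_of_discrete {β : Type*} [MeasurableSpace β] [MeasurableSingletonClass β]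
    [Countable β] {f g : α → β} (hf : Measurable f) (hg : Measurable g) :
    Measurable fun a => f a = g a :=
  measurableSet_setOfPred.1 (measurableSet_eq_fun hf hg)

variable {lab : α → V → ℕ → Bool} (hlab : ∀ x i, Measurable fun a => lab a x i)
include hlab

omit [Countable V] in
theorem measurable_lex_lt (x y : V) :
    Measurable fun a => toLex (lab a x) < toLex (lab a y) := by
  have : (fun a => toLex (lab a x) < toLex (lab a y)) =
      fun a => ∃ i, (∀ j, j < i → lab a x j = lab a y j) ∧
        (lab a x i = false ∧ lab a y i = true) := by
    funext a
    apply propext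
    have h : toLex (lab a x) < toLex (lab a y) ↔ ∃ i, (∀ j, j < i → lab a x j = lab a y j) ∧
        lab a x i < lab a y i := Iff.rfl
    rw [h]
    simp only [Bool.lt_iff]
  rw [this]
  refine Measurable.exists fun i => Measurable.and (Measurable.forall fun j =>
    measurable_const.imp (measurable_eq_of_discrete (hlab _ _) (hlab _ _))) ?_
  exact (measurable_eq_of_discrete (hlab _ _) measurable_const).and
    (measurable_eq_of_discrete (hlab _ _) measurable_const)

theorem measurable_isLeader {C : α → Set V} (hC : ∀ x, Measurable fun a => x ∈ C a) (y : V) :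
    Measurable fun a => IsLeader (lab a) (C a) y :=
  (hC y).and (Measurable.forall fun z => (hC z).imp (measurable_lex_lt hlab _ _).not)

end

section

variable {α Γ : Type*} [MeasurableSpace α] [Group Γ] {F : α → SimpleGraph Γ} {s : α → Setoid Γ}
  {lab : α → Γ → ℕ → Bool}

omit [Group Γ] in
theorem measurable_isSeedSet [Countable Γ] (hF : ∀ x y, Measurable fun a => (F a).Adj x y)
    (hs : ∀ x y, Measurable fun a => s a x y) (K : Finset Γ) :
    Measurable fun a => IsSeedSet (F a) (s a) K := by
  have : (fun a => IsSeedSet (F a) (s a) K) = fun a => (∀ x, x ∈ K → ∀ y, s a x y → y ∈ K) ∧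
      (∀ x, x ∈ K → ∀ y, y ∈ K → (within (F a) K).Reachable x y) ∧
      ∃ u, u ∈ K ∧ ∃ v, v ∈ K ∧ ¬ s a u v ∧ IsBranching (F a) u ∧ IsBranching (F a) v := by
    funext a
    exact propext ⟨fun h => ⟨h.1, h.2, h.3⟩, fun h => ⟨h.1, h.2.1, h.2.2⟩⟩
  rw [this]
  refine Measurable.and ?_ (Measurable.and ?_ ?_)
  · exact Measurable.forall fun x => measurable_const.imp (Measurable.forall fun y =>
      (hs x y).imp measurable_const)
  · exact Measurable.forall fun x => measurable_const.imp (Measurable.forall fun y =>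
      measurable_const.imp (measurable_reachable (measurable_within hF _) _ _))
  · exact Measurable.exists fun u => measurable_const.and (Measurable.exists fun v =>
      measurable_const.and ((hs u v).not.and ((measurable_isBranching hF u).and
        (measurable_isBranching hF v))))

variable (hF : ∀ x y, Measurable fun a => (F a).Adj x y) (hs : ∀ x y, Measurable fun a => s a x y)
  (hlab : ∀ x i, Measurable fun a => lab a x i)
include hF hs hlab

theorem measurable_hasCode [Countable Γ] (c : Code Γ) (K : Finset Γ) :
    Measurable fun a => HasCode (F a) (s a) (lab a) c K := by
  refine (measurable_isSeedSet hF hs K).and (measurable_const.and ?_)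
  simp only [Finset.ext_iff, Finset.mem_image, funext_iff]
  exact Measurable.forall fun w => Measurable.iff (Measurable.exists fun x =>
    measurable_const.and (Measurable.forall fun i =>
      measurable_eq_of_discrete (hlab _ _) measurable_const)) measurable_const

variable [Encodable Γ]

theorem measurable_isSeed (K : Finset Γ) :
    Measurable fun a => IsSeed (F a) (s a) (lab a) K := by
  have hiso : ∀ c K, Measurable fun a => IsIsolated (F a) (s a) (lab a) c K := fun c K =>
    (measurable_hasCode hF hs hlab c K).and (Measurable.forall fun K' =>
      (measurable_hasCode hF hs hlab c K').imp measurable_const)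
  refine Measurable.exists fun c => (hiso c K).and (Measurable.forall fun c' =>
    Measurable.forall fun K' => (hiso c' K').imp (measurable_const.imp (Measurable.forall fun x =>
      measurable_const.imp (Measurable.forall fun y => measurable_const.imp
        (measurable_reachable hF x y).not))))

theorem measurable_assignedBy (k : ℕ) (x y : Γ) :
    Measurable fun a => AssignedBy (F a) (s a) (lab a) k x y := by
  induction k generalizing x y with
  | zero =>
    exact Measurable.exists fun K => (measurable_isSeed hF hs hlab K).and
      (measurable_const.and (measurable_isLeader hlab (fun _ => measurable_const) y))
  | succ k ih =>
    refine (ih x y).or ((Measurable.forall fun y' => (ih x y').not).and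
      (measurable_isLeader hlab (fun y' => ?_) y))
    exact Measurable.exists fun x' => Measurable.exists fun x'' =>
      (hs x x').and ((hF x' x'').and (ih x'' y'))

theorem measurable_assigned (x y : Γ) :
    Measurable fun a => Assigned (F a) (s a) (lab a) x y :=
  Measurable.exists fun k => measurable_assignedBy hF hs hlab k x y

theorem measurable_coarsen (x y : Γ) :
    Measurable fun a => coarsen (F a) (s a) (lab a) x y :=
  Measurable.forall fun z => (measurable_assigned hF hs hlab x z).iff
    (measurable_assigned hF hs hlab y z)

end

section

variable {α V : Type*} [MeasurableSpace α] [Countable V] {F : α → SimpleGraph V}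
  {L : α → V → Bool}

omit [Countable V] in
theorem measurable_clust {β : Type*} {F : α → SimpleGraph V} {L : α → V → β}
    (hF : ∀ x y, Measurable fun a => (F a).Adj x y)
    (hL : ∀ x y, Measurable fun a => L a x = L a y) (x y : V) :
    Measurable fun a => (clust (F a) (L a)).Adj x y := (hF x y).and (hL x y)

variable (hac : ∀ a, (F a).IsAcyclic) (hF : ∀ x y, Measurable fun a => (F a).Adj x y)
include hac hF

theorem measurable_inForking (x : V) : Measurable fun a => InForking (F a) x := by
  simp only [fun a => inForking_iff (hac a)]
  exact Measurable.exists fun u => (measurable_reachable hF x u).and (measurable_isBranching hF u)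

theorem measurable_mergeStep (hL : ∀ x, Measurable fun a => L a x) (x : V) :
    Measurable fun a => mergeStep (F a) (L a) x := by
  classical
  have hcl := measurable_clust hF (L := L)
    (fun x y => measurable_eq_of_discrete (hL x) (hL y))
  have hfork := measurable_inForking (fun a => (hac a).anti (clust_le (F a) (L a))) hcl
  unfold mergeStep
  refine Measurable.ite (measurableSet_setOfPred.2 ?_) ?_ (hL x)
  · exact (hfork x).not.and (Measurable.exists fun y => Measurable.exists fun z =>
      (measurable_reachable hcl x y).and ((hF y z).and (hfork z)))
  · exact (measurable_from_top : Measurable not).comp (hL x)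

theorem measurable_mergeLim (hL : ∀ x, Measurable fun a => L a x) (x : V) :
    Measurable fun a => mergeLim (F a) (L a) x := by
  have hit : ∀ (k : ℕ) (x : V), Measurable fun a => (mergeStep (F a))^[k] (L a) x := by
    intro k
    induction k with
    | zero => exact hL
    | succ k ih =>
      simp only [Function.iterate_succ_apply']
      exact measurable_mergeStep hac hF ih
  refine measurable_to_bool ?_
  have : (fun a => mergeLim (F a) (L a) x) ⁻¹' {true} =
      {a | ∃ n, ∀ k, n ≤ k → (mergeStep (F a))^[k] (L a) x = true} := by
    ext a
    simp [mergeLim, eventually_atTop]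
  rw [this]
  exact measurableSet_setOfPred.2 (Measurable.exists fun n => Measurable.forall fun k =>
    measurable_const.imp (measurable_eq_of_discrete (hit k x) measurable_const))

end

/-! ### Equivariance -/

section

variable {V W : Type*} {F' : SimpleGraph V} {F : SimpleGraph W} (e : V ≃ W)
  (hF : ∀ x y, F'.Adj x y ↔ F.Adj (e x) (e y))
include hF

theorem reachable_congr (x y : V) : F'.Reachable x y ↔ F.Reachable (e x) (e y) := by
  let i : F' ≃g F := ⟨e, fun {a b} => (hF a b).symm⟩
  exact (SimpleGraph.Iso.reachable_iff (φ := i)).symm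

theorem isAcyclic_congr : F'.IsAcyclic ↔ F.IsAcyclic := by
  let i : F' ≃g F := ⟨e, fun {a b} => (hF a b).symm⟩
  exact i.isAcyclic_iff

theorem within_congr {C' : Set V} {C : Set W} (hC : ∀ x, x ∈ C' ↔ e x ∈ C) (x y : V) :
    (within F' C').Adj x y ↔ (within F C).Adj (e x) (e y) :=
  and_congr (hF x y) (and_congr (hC x) (hC y))

theorem isBranching_congr (u : V) : IsBranching F' u ↔ IsBranching F (e u) := by
  have hb : ∀ a, (branch F' u a).Infinite ↔ (branch F (e u) (e a)).Infinite := by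
    intro a
    have : branch F' u a = e ⁻¹' branch F (e u) (e a) := by
      ext w
      exact reachable_congr e (within_congr e hF (fun x => by simp)) a w
    rw [this, ← Set.infinite_image_iff e.injective.injOn,
      Set.image_preimage_eq _ e.surjective]
  constructor
  · rintro ⟨a, ha, h⟩
    exact ⟨e ∘ a, e.injective.comp ha, fun i => ⟨(hF _ _).1 (h i).1, (hb _).1 (h i).2⟩⟩
  · rintro ⟨a, ha, h⟩
    refine ⟨e.symm ∘ a, e.symm.injective.comp ha, fun i => ⟨(hF _ _).2 ?_, (hb _).2 ?_⟩⟩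
    · simpa using (h i).1
    · simpa using (h i).2

theorem inForking_congr (hac : F.IsAcyclic) (x : V) : InForking F' x ↔ InForking F (e x) := by
  rw [inForking_iff hac, inForking_iff ((isAcyclic_congr e hF).2 hac)]
  constructor
  · rintro ⟨u, h1, h2⟩
    exact ⟨e u, (reachable_congr e hF _ _).1 h1, (isBranching_congr e hF _).1 h2⟩
  · rintro ⟨u, h1, h2⟩
    exact ⟨e.symm u, (reachable_congr e hF _ _).2 (by simpa using h1),
      (isBranching_congr e hF _).2 (by simpa using h2)⟩

theorem clust_congr {β : Type*} {L' : V → β} {L : W → β} (hL : ∀ x, L' x = L (e x)) (x y : V) :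
    (clust F' L').Adj x y ↔ (clust F L).Adj (e x) (e y) := by
  refine and_congr (hF x y) ?_
  rw [hL, hL]

theorem mergeStep_congr (hac : F.IsAcyclic) {L' : V → Bool} {L : W → Bool}
    (hL : ∀ x, L' x = L (e x)) (x : V) : mergeStep F' L' x = mergeStep F L (e x) := by
  have hcl := clust_congr e hF hL
  have hfork := inForking_congr e hcl (hac.anti (clust_le F L))
  have h3 : (¬ InForking (clust F' L') x ∧
        ∃ a b, (clust F' L').Reachable x a ∧ F'.Adj a b ∧ InForking (clust F' L') b) ↔
      (¬ InForking (clust F L) (e x) ∧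
        ∃ a b, (clust F L).Reachable (e x) a ∧ F.Adj a b ∧ InForking (clust F L) b) := by
    refine and_congr (not_congr (hfork x)) (e.exists_congr fun a => e.exists_congr fun b => ?_)
    rw [reachable_congr e hcl, hF, hfork]
  unfold mergeStep
  by_cases h4 : ¬ InForking (clust F L) (e x) ∧
      ∃ a b, (clust F L).Reachable (e x) a ∧ F.Adj a b ∧ InForking (clust F L) b
  · rw [if_pos h4, if_pos (h3.2 h4), hL]
  · rw [if_neg h4, if_neg (fun h => h4 (h3.1 h)), hL]

theorem mergeLim_congr (hac : F.IsAcyclic) {L' : V → Bool} {L : W → Bool}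
    (hL : ∀ x, L' x = L (e x)) (x : V) : mergeLim F' L' x = mergeLim F L (e x) := by
  have : ∀ (k : ℕ) (x : V), (mergeStep F')^[k] L' x = (mergeStep F)^[k] L (e x) := by
    intro k
    induction k with
    | zero => exact hL
    | succ k ih =>
      simp only [Function.iterate_succ_apply']
      exact mergeStep_congr e hF hac ih
  unfold mergeLim
  congr 1
  simp only [this]

end

theorem isLeader_congr {V W : Type*} (e : V ≃ W) {lab' : V → ℕ → Bool} {lab : W → ℕ → Bool}
    (hlab : ∀ x, lab' x = lab (e x)) {C' : Set V} {C : Set W} (hC : ∀ x, x ∈ C' ↔ e x ∈ C)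
    (y : V) : IsLeader lab' C' y ↔ IsLeader lab C (e y) := by
  refine and_congr (hC y) (e.forall_congr fun z => ?_)
  rw [hC, hlab, hlab]

section

variable {Γ : Type*} [Group Γ] {F F' : SimpleGraph Γ} {s s' : Setoid Γ} {lab lab' : Γ → ℕ → Bool}
  (e : Γ ≃ Γ) (he : ∀ x y, (e x)⁻¹ * e y = x⁻¹ * y)
  (hF : ∀ x y, F'.Adj x y ↔ F.Adj (e x) (e y)) (hs : ∀ x y, s' x y ↔ s (e x) (e y))
  (hlab : ∀ x, lab' x = lab (e x))

include hF hs in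
omit [Group Γ] in
theorem isSeedSet_congr (K : Finset Γ) :
    IsSeedSet F' s' K ↔ IsSeedSet F s (K.map e.toEmbedding) := by
  have hK : ∀ x, x ∈ K ↔ e x ∈ K.map e.toEmbedding := by simp
  have hK' : ∀ x, x ∈ (K : Set Γ) ↔ e x ∈ ((K.map e.toEmbedding : Finset Γ) : Set Γ) := by simp
  have h1 : (∀ x ∈ K, ∀ y, s' x y → y ∈ K) ↔
      ∀ x ∈ K.map e.toEmbedding, ∀ y, s x y → y ∈ K.map e.toEmbedding :=
    e.forall_congr fun x => by
      rw [← hK]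
      refine imp_congr_right fun _ => e.forall_congr fun y => by rw [hs, ← hK]
  have h2 : (∀ x ∈ K, ∀ y ∈ K, (within F' K).Reachable x y) ↔
      ∀ x ∈ K.map e.toEmbedding, ∀ y ∈ K.map e.toEmbedding,
        (within F (K.map e.toEmbedding : Finset Γ)).Reachable x y :=
    e.forall_congr fun x => by
      rw [← hK]
      refine imp_congr_right fun _ => e.forall_congr fun y => by
        rw [← hK, reachable_congr e (within_congr e hF hK')]
  have h3 : (∃ u ∈ K, ∃ v ∈ K, ¬ s' u v ∧ IsBranching F' u ∧ IsBranching F' v) ↔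
      ∃ u ∈ K.map e.toEmbedding, ∃ v ∈ K.map e.toEmbedding,
        ¬ s u v ∧ IsBranching F u ∧ IsBranching F v :=
    e.exists_congr fun u => by
      rw [← hK]
      refine and_congr_right fun _ => e.exists_congr fun v => by
        rw [← hK, hs, isBranching_congr e hF, isBranching_congr e hF]
  exact ⟨fun h => ⟨h1.1 h.1, h2.1 h.2, h3.1 h.3⟩, fun h => ⟨h1.2 h.1, h2.2 h.2, h3.2 h.3⟩⟩

include he hF hs hlab

theorem hasCode_congr (c : Code Γ) (K : Finset Γ) :
    HasCode F' s' lab' c K ↔ HasCode F s lab c (K.map e.toEmbedding) := by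
  classical
  have hK : ∀ x, x ∈ K ↔ e x ∈ K.map e.toEmbedding := by simp
  refine and_congr (isSeedSet_congr e hF hs K) (and_congr (e.forall_congr fun x => ?_) ?_)
  · rw [← hK]
    refine imp_congr_right fun _ => e.forall_congr fun y => ?_
    rw [← hK, he]
  · rw [Finset.map_eq_image, Finset.image_image]
    simp only [hlab]
    rfl

theorem isIsolated_congr (c : Code Γ) (K : Finset Γ) :
    IsIsolated F' s' lab' c K ↔ IsIsolated F s lab c (K.map e.toEmbedding) := by
  refine and_congr (hasCode_congr e he hF hs hlab c K)
    ((Equiv.finsetCongr e).forall_congr fun K' => ?_)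
  rw [hasCode_congr e he hF hs hlab c K', Equiv.finsetCongr_apply, Finset.disjoint_map,
    Finset.map_inj]

variable [Encodable Γ]

theorem isSeed_congr (K : Finset Γ) :
    IsSeed F' s' lab' K ↔ IsSeed F s lab (K.map e.toEmbedding) := by
  have hK : ∀ (K : Finset Γ) x, x ∈ K ↔ e x ∈ K.map e.toEmbedding := by simp
  refine exists_congr fun c => and_congr (isIsolated_congr e he hF hs hlab c K)
    (forall_congr' fun c' => (Equiv.finsetCongr e).forall_congr fun K' => ?_)
  rw [isIsolated_congr e he hF hs hlab c' K', Equiv.finsetCongr_apply]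
  refine imp_congr_right fun _ => imp_congr_right fun _ => e.forall_congr fun x => ?_
  rw [← hK]
  refine imp_congr_right fun _ => e.forall_congr fun y => ?_
  rw [← hK, reachable_congr e hF]

theorem assignedBy_congr (k : ℕ) (x y : Γ) :
    AssignedBy F' s' lab' k x y ↔ AssignedBy F s lab k (e x) (e y) := by
  have hK : ∀ (K : Finset Γ) x, x ∈ K ↔ e x ∈ K.map e.toEmbedding := by simp
  induction k generalizing x y with
  | zero =>
    refine (Equiv.finsetCongr e).exists_congr fun K => ?_
    rw [isSeed_congr e he hF hs hlab K, Equiv.finsetCongr_apply, ← hK,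
      isLeader_congr e hlab (C := ((K.map e.toEmbedding : Finset Γ) : Set Γ)) (by simp)]
  | succ k ih =>
    refine or_congr (ih x y) (and_congr (e.forall_congr fun y' => not_congr (ih x y')) ?_)
    refine isLeader_congr e hlab (fun y' => ?_) y
    exact e.exists_congr fun x' => e.exists_congr fun x'' =>
      and_congr (hs _ _) (and_congr (hF _ _) (ih _ _))

theorem assigned_congr (x y : Γ) : Assigned F' s' lab' x y ↔ Assigned F s lab (e x) (e y) :=
  exists_congr fun k => assignedBy_congr e he hF hs hlab k x y

theorem coarsen_congr (x y : Γ) : coarsen F' s' lab' x y ↔ coarsen F s lab (e x) (e y) :=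
  e.forall_congr fun z => iff_congr (assigned_congr e he hF hs hlab x z)
    (assigned_congr e he hF hs hlab y z)

end

/-! ### The construction bit by bit -/

section

variable {Γ : Type*}

/-- The labels used to break ties. -/
def labOf (z : Γ × ℕ → Bool) : Γ → ℕ → Bool := fun v i => z (v, 2 * i + 1)

/-- The fair bits used in step `n` of the construction. -/
def bitOf (z : Γ × ℕ → Bool) (n : ℕ) : Γ → Bool := fun v => z (v, 2 * n)

open Classical in
/-- The labeling that is constant on the cells of `s` and equal to `X` at their leaders. -/
noncomputable def leaderBit (s : Setoid Γ) (lab : Γ → ℕ → Bool) (X : Γ → Bool) : Γ → Bool :=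
  fun x => decide (∃ y, IsLeader lab {w | s x w} y ∧ X y = true)

theorem leaderBit_eq {s : Setoid Γ} {lab : Γ → ℕ → Bool} (hlab : Function.Injective lab)
    {X : Γ → Bool} {x y : Γ} (hy : IsLeader lab {w | s x w} y) : leaderBit s lab X x = X y := by
  unfold leaderBit
  have : (∃ y, IsLeader lab {w | s x w} y ∧ X y = true) ↔ X y = true :=
    ⟨fun ⟨y', h, h'⟩ => by rwa [hy.unique hlab h], fun h => ⟨y, hy, h⟩⟩
  simp only [this, Bool.decide_eq_true]

theorem leaderBit_congr_rel {s : Setoid Γ} {lab : Γ → ℕ → Bool} {X : Γ → Bool} {x y : Γ}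
    (h : s x y) : leaderBit s lab X x = leaderBit s lab X y := by
  have : {w | s x w} = {w | s y w} := Set.ext fun w =>
    ⟨fun h' => s.trans' (s.symm' h) h', fun h' => s.trans' h h'⟩
  unfold leaderBit
  rw [this]

theorem leaderBit_congr (e : Γ ≃ Γ) {s s' : Setoid Γ} {lab lab' : Γ → ℕ → Bool} {X X' : Γ → Bool}
    (hs : ∀ x y, s' x y ↔ s (e x) (e y)) (hlab : ∀ x, lab' x = lab (e x))
    (hX : ∀ x, X' x = X (e x)) (x : Γ) : leaderBit s' lab' X' x = leaderBit s lab X (e x) := by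
  unfold leaderBit
  congr 1
  refine propext (e.exists_congr fun y => ?_)
  rw [hX, isLeader_congr e hlab (C' := {w | s' x w}) (C := {w | s (e x) w}) fun w => hs x w]

theorem measurable_leaderBit {α : Type*} [MeasurableSpace α] [Countable Γ] {s : α → Setoid Γ}
    {lab : α → Γ → ℕ → Bool} {X : α → Γ → Bool} (hs : ∀ x y, Measurable fun a => s a x y)
    (hlab : ∀ x i, Measurable fun a => lab a x i) (hX : ∀ x, Measurable fun a => X a x) (x : Γ) :
    Measurable fun a => leaderBit (s a) (lab a) (X a) x := by
  refine measurable_to_bool ?_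
  have : (fun a => leaderBit (s a) (lab a) (X a) x) ⁻¹' {true} =
      {a | ∃ y, IsLeader (lab a) {w | s a x w} y ∧ X a y = true} := by
    ext a
    simp [leaderBit]
  rw [this]
  exact measurableSet_setOfPred.2 (Measurable.exists fun y =>
    (measurable_isLeader hlab (fun w => hs x w) y).and
      (measurable_eq_of_discrete (hX y) measurable_const))

variable [Group Γ] [Encodable Γ] (T : SimpleGraph Γ) (z : Γ × ℕ → Bool)

/-- The forest given by the first `n` bits, together with the partition used in step `n - 1`
(at first, the partition into points). -/
noncomputable def process : ℕ → SimpleGraph Γ × Setoid Γ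
  | 0 => (T, ⊥)
  | n + 1 => (clust (process n).1 (mergeLim (process n).1 (leaderBit
      (coarsen (process n).1 (process n).2 (labOf z)) (labOf z) (bitOf z n))),
      coarsen (process n).1 (process n).2 (labOf z))

/-- The forest given by the first `n` bits. -/
noncomputable def forest (n : ℕ) : SimpleGraph Γ := (process T z n).1

/-- The partition used to construct the next bit in the forest given by the first `n` bits. -/
noncomputable def cells (n : ℕ) : Setoid Γ := (process T z (n + 1)).2

/-- The percolation on the cells of the `n`-th partition. -/
noncomputable def cellBits (n : ℕ) : Γ → Bool := leaderBit (cells T z n) (labOf z) (bitOf z n)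

/-- The `n`-th bit of the labeling, counting from zero. -/
noncomputable def bits (n : ℕ) : Γ → Bool := mergeLim (forest T z n) (cellBits T z n)

theorem forest_succ (n : ℕ) : forest T z (n + 1) = clust (forest T z n) (bits T z n) := rfl

theorem cells_eq (n : ℕ) :
    cells T z n = coarsen (forest T z n) (process T z n).2 (labOf z) := rfl

theorem forest_le (n : ℕ) : forest T z n ≤ T := by
  induction n with
  | zero => exact le_rfl
  | succ n ih => exact (clust_le _ _).trans ih

theorem forest_eq_clust (n : ℕ) :
    forest T z n = clust T fun v (i : Fin n) => bits T z i v := by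
  induction n with
  | zero =>
    ext x y
    exact (and_iff_left (funext fun i => i.elim0)).symm
  | succ n ih =>
    rw [forest_succ]
    ext x y
    have h1 : (forest T z n).Adj x y ↔ T.Adj x y ∧
        (fun i : Fin n => bits T z i x) = fun i : Fin n => bits T z i y := by rw [ih]; rfl
    change (forest T z n).Adj x y ∧ bits T z n x = bits T z n y ↔ T.Adj x y ∧
        (fun i : Fin (n + 1) => bits T z i x) = fun i : Fin (n + 1) => bits T z i y
    rw [h1, and_assoc]
    refine and_congr_right fun _ => ?_
    simp only [funext_iff, Fin.forall_fin_succ']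
    simp

variable {T} in
theorem forest_isAcyclic (hT : T.IsAcyclic) (n : ℕ) : (forest T z n).IsAcyclic :=
  hT.anti (forest_le T z n)

/-- The first `n` steps of the construction only depend on the labels and on the bits used in
these steps. -/
theorem process_congr {z z' : Γ × ℕ → Bool} (hlab : labOf z = labOf z') {n : ℕ}
    (hbit : ∀ k < n, bitOf z k = bitOf z' k) : process T z n = process T z' n := by
  induction n with
  | zero => rfl
  | succ n ih =>
    rw [process, process, ih fun k hk => hbit k (by omega), hlab, hbit n (Nat.lt_succ_self n)]

variable {T}

omit [Group Γ] [Encodable Γ] in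
theorem measurable_labOf (x : Γ) (i : ℕ) : Measurable fun z : Γ × ℕ → Bool => labOf z x i :=
  measurable_pi_apply _

omit [Group Γ] [Encodable Γ] in
theorem measurable_bitOf (n : ℕ) (x : Γ) : Measurable fun z : Γ × ℕ → Bool => bitOf z n x :=
  measurable_pi_apply _

theorem measurable_process (hT : T.IsAcyclic) (n : ℕ) :
    (∀ x y, Measurable fun z => (process T z n).1.Adj x y) ∧
      ∀ x y, Measurable fun z => (process T z n).2 x y := by
  induction n with
  | zero =>
    exact ⟨fun x y => (measurable_const : Measurable fun _ : Γ × ℕ → Bool => T.Adj x y),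
      fun x y => (measurable_const : Measurable fun _ : Γ × ℕ → Bool => (⊥ : Setoid Γ) x y)⟩
  | succ n ih =>
    have hc := fun x y => measurable_coarsen ih.1 ih.2 measurable_labOf x y
    refine ⟨fun x y => ?_, hc⟩
    have hm := measurable_mergeLim (fun z => forest_isAcyclic z hT n) ih.1
      (measurable_leaderBit hc measurable_labOf (measurable_bitOf n))
    exact measurable_clust ih.1 (fun x y => measurable_eq_of_discrete (hm x) (hm y)) x y

theorem measurable_forest (hT : T.IsAcyclic) (n : ℕ) (x y : Γ) :
    Measurable fun z => (forest T z n).Adj x y := (measurable_process hT n).1 x y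

theorem measurable_cells (hT : T.IsAcyclic) (n : ℕ) (x y : Γ) :
    Measurable fun z => cells T z n x y := (measurable_process hT (n + 1)).2 x y

theorem measurable_cellBits (hT : T.IsAcyclic) (n : ℕ) (x : Γ) :
    Measurable fun z => cellBits T z n x :=
  measurable_leaderBit (measurable_cells hT n) measurable_labOf (measurable_bitOf n) x

theorem measurable_bits (hT : T.IsAcyclic) (n : ℕ) (x : Γ) :
    Measurable fun z => bits T z n x :=
  measurable_mergeLim (fun z => forest_isAcyclic z hT n) (measurable_forest hT n)
    (measurable_cellBits hT n) x

/-- The graph is invariant under left translations. -/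
def IsTranslationInvariant (T : SimpleGraph Γ) : Prop :=
  ∀ γ x y : Γ, T.Adj (γ * x) (γ * y) ↔ T.Adj x y

omit [Encodable Γ] in
theorem mulLeft_inv_mul (γ x y : Γ) :
    (Equiv.mulLeft γ⁻¹ x)⁻¹ * Equiv.mulLeft γ⁻¹ y = x⁻¹ * y := by simp [mul_assoc]

theorem process_shift (hT : T.IsAcyclic) (hinv : IsTranslationInvariant T) (γ : Γ) (n : ℕ) :
    (∀ x y, (process T (shift γ z) n).1.Adj x y ↔
      (process T z n).1.Adj (Equiv.mulLeft γ⁻¹ x) (Equiv.mulLeft γ⁻¹ y)) ∧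
    ∀ x y, (process T (shift γ z) n).2 x y ↔
      (process T z n).2 (Equiv.mulLeft γ⁻¹ x) (Equiv.mulLeft γ⁻¹ y) := by
  induction n with
  | zero =>
    refine ⟨fun x y => (hinv _ _ _).symm, fun x y => ?_⟩
    exact (Equiv.injective _).eq_iff.symm
  | succ n ih =>
    have hc := coarsen_congr (lab := labOf z) (lab' := labOf (shift γ z)) (Equiv.mulLeft γ⁻¹)
      (mulLeft_inv_mul γ) ih.1 ih.2 (fun x => rfl)
    refine ⟨?_, hc⟩
    exact clust_congr _ ih.1 (mergeLim_congr _ ih.1 (forest_isAcyclic z hT n)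
      (leaderBit_congr _ hc (fun x => rfl) fun x => rfl))

theorem cells_shift (hT : T.IsAcyclic) (hinv : IsTranslationInvariant T) (γ : Γ) (n : ℕ)
    (x y : Γ) : cells T (shift γ z) n x y ↔ cells T z n (γ⁻¹ * x) (γ⁻¹ * y) :=
  (process_shift z hT hinv γ (n + 1)).2 x y

theorem cellBits_shift (hT : T.IsAcyclic) (hinv : IsTranslationInvariant T) (γ : Γ) (n : ℕ)
    (x : Γ) : cellBits T (shift γ z) n x = cellBits T z n (γ⁻¹ * x) :=
  leaderBit_congr (lab := labOf z) (lab' := labOf (shift γ z)) (X := bitOf z n)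
    (X' := bitOf (shift γ z) n) (Equiv.mulLeft γ⁻¹) (cells_shift z hT hinv γ n) (fun _ => rfl)
    (fun _ => rfl) x

theorem bits_shift (hT : T.IsAcyclic) (hinv : IsTranslationInvariant T) (γ : Γ) (n : ℕ)
    (x : Γ) : bits T (shift γ z) n x = bits T z n (γ⁻¹ * x) :=
  mergeLim_congr (Equiv.mulLeft γ⁻¹) (process_shift z hT hinv γ n).1 (forest_isAcyclic z hT n)
    (cellBits_shift z hT hinv γ n) x

/-! ### Almost sure properties of the construction -/

omit [Group Γ] in
/-- A sequence of fair bits has no atoms. -/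
theorem fair_singleton_nat (ε : ℕ → Bool) : fair ℕ {ε} = 0 := by
  have hle : ∀ k : ℕ, fair ℕ {ε} ≤ (2⁻¹ : ENNReal) ^ k := by
    intro k
    rw [← fair_prefixSet k ε]
    refine measure_mono ?_
    rintro _ rfl i _
    rfl
  have hlim := ENNReal.tendsto_pow_atTop_nhds_zero_of_lt_one
    (show (2⁻¹ : ENNReal) < 1 from ENNReal.one_half_lt_one)
  exact le_antisymm (ge_of_tendsto' hlim hle) bot_le

omit [Group Γ] in
theorem ae_injective_labOf : ∀ᵐ z ∂(fair (Γ × ℕ)), Function.Injective (labOf z) := by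
  -- resampling all bits at `x` makes its label differ from the fixed label of `y`
  have : ∀ x y : Γ, x ≠ y → ∀ᵐ z ∂(fair (Γ × ℕ)), ∃ i, labOf z x i ≠ labOf z y i := by
    intro x y hxy
    refine ae_of_ae_resample {i | i.1 = x} (Measurable.exists fun i =>
      (measurable_eq_of_discrete (measurable_labOf x i) (measurable_labOf y i)).not) ?_
    refine Eventually.of_forall fun z => ?_
    have h1 : (fair (Γ × ℕ)).map (fun ξ i => ξ (x, 2 * i + 1)) = fair ℕ := by
      refine fair_map_injective (ι := fun i : ℕ => (x, 2 * i + 1)) fun i j h => ?_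
      have := congrArg Prod.snd h
      simp only at this
      omega
    have h2 : ∀ᵐ b ∂(fair ℕ), b ≠ labOf z y := by
      rw [ae_iff]
      simpa using fair_singleton_nat (labOf z y)
    rw [← h1] at h2
    have h3 := ae_of_ae_map (measurable_pi_lambda _ fun i => measurable_pi_apply _).aemeasurable h2
    filter_upwards [h3] with ξ hξ
    obtain ⟨i, hi⟩ := Function.ne_iff.1 hξ
    refine ⟨i, ?_⟩
    simpa [labOf, resample, hxy.symm] using hi
  have h : ∀ᵐ z ∂(fair (Γ × ℕ)), ∀ x y : Γ, x ≠ y → ∃ i, labOf z x i ≠ labOf z y i := by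
    rw [ae_all_iff]; intro x
    rw [ae_all_iff]; intro y
    by_cases hxy : x = y
    · exact Eventually.of_forall fun _ h => absurd hxy h
    · filter_upwards [this x y hxy] with z hz _ using hz
  filter_upwards [h] with z hz x y hxy
  by_contra hne
  obtain ⟨i, hi⟩ := hz x y hne
  exact hi (congrFun hxy i)

omit [Group Γ] [Encodable Γ] in
/-- A finite branch of smallest size would contain a smaller one. -/
theorem infinite_branch_of_isCubicTree (hT : IsCubicTree T) {u a : Γ} (h : T.Adj u a) :
    (branch T u a).Infinite := by
  intro hfin
  induction hn : (branch T u a).ncard using Nat.strong_induction_on generalizing u a with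
  | _ n ih =>
    obtain ⟨c, hc, hcu⟩ : ∃ c ∈ T.neighborSet a, c ≠ u := by
      refine Set.exists_ne_of_one_lt_encard ?_ u
      rw [hT.2 a]
      norm_num
    have hsub := branch_subset_branch hT.1.isAcyclic h hc hcu
    have hssub : branch T a c ⊂ branch T u a := by
      refine ⟨hsub, fun h' => ?_⟩
      have h1 : a ∈ branch T a c := h' (SimpleGraph.Reachable.refl a)
      exact mem_of_within_reachable (C := {a}ᶜ) (T.ne_of_adj hc).symm h1 rfl
    exact ih _ (hn ▸ Set.ncard_lt_ncard hssub hfin) hc (hfin.subset hsub) rfl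

omit [Group Γ] [Encodable Γ] in
theorem isBranching_of_isCubicTree (hT : IsCubicTree T) (u : Γ) : IsBranching T u := by
  obtain ⟨a, ha, h⟩ := (le_encard_iff_exists_fin (T.neighborSet u) 3).1 (hT.2 u).ge
  exact ⟨a, ha, fun i => ⟨h i, infinite_branch_of_isCubicTree hT (h i)⟩⟩

omit [Group Γ] [Encodable Γ] in
theorem IsBranching.infinite_reachable {F : SimpleGraph Γ} {u : Γ} (hu : IsBranching F u) :
    {w | F.Reachable u w}.Infinite := by
  obtain ⟨a, _, h⟩ := hu
  exact (h 0).2.mono fun w hw => mem_branch_reachable (h 0).1 hw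

/-- Almost surely, in step `n`, the conditions for the step are met: the partition can be
coarsened, the coarsened cells are finite, and percolation on them yields forking clusters in each
tree. -/
structure GoodStep (T : SimpleGraph Γ) (z : Γ × ℕ → Bool) (n : ℕ) : Prop where
  canCoarsen : CanCoarsen (forest T z n) (process T z n).2 (labOf z)
  finite : ∀ y, {x | Assigned (forest T z n) (process T z n).2 (labOf z) x y}.Finite
  forking : ∀ v, ∃ y, (forest T z n).Reachable v y ∧
    InForking (clust (forest T z n) (cellBits T z n)) y

theorem GoodStep.cells_finiteConnected {n : ℕ} (h : GoodStep T z n) :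
    FiniteConnectedCells (forest T z n) (cells T z n) :=
  h.canCoarsen.finiteConnectedCells h.finite

variable (hT : IsCubicTree T) (hinv : IsTranslationInvariant T)
include hT

theorem GoodStep.inForking {n : ℕ} (h : GoodStep T z n) (v : Γ) :
    InForking (forest T z (n + 1)) v :=
  inForking_mergeLim (forest_isAcyclic z hT.1.isAcyclic n) h.forking v

theorem GoodStep.isMergeOf {n : ℕ} (h : GoodStep T z n) :
    IsMergeOf (forest T z n) (cellBits T z n) (bits T z n) :=
  isMergeOf_mergeLim (forest_isAcyclic z hT.1.isAcyclic n) h.forking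

omit hT in
theorem GoodStep.bits_eq_of_cells {n : ℕ} (h : GoodStep T z n) {x y : Γ} (hxy : cells T z n x y) :
    bits T z n x = bits T z n y := by
  have h1 := h.cells_finiteConnected.connected x y hxy
  refine reachable_induction (P := fun w => bits T z n x = bits T z n w) rfl ?_ h1
  intro a b _ h2 h3
  refine h2.trans (mergeLim_eq_of_adj h3.1 (leaderBit_congr_rel ?_))
  exact Setoid.trans' _ (Setoid.symm' _ h3.2.1) h3.2.2

omit hT in
theorem GoodStep.finiteConnected_succ {n : ℕ} (h : GoodStep T z n) :
    FiniteConnectedCells (forest T z (n + 1)) (process T z (n + 1)).2 := by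
  refine ⟨h.cells_finiteConnected.finite, fun x y hxy => ?_⟩
  refine (h.cells_finiteConnected.connected x y hxy).mono ?_
  intro a b hab
  refine ⟨⟨hab.1, h.bits_eq_of_cells z ?_⟩, hab.2⟩
  exact Setoid.trans' _ (Setoid.symm' _ hab.2.1) hab.2.2

include hinv in
/-- If all trees are forking, then almost surely they all have infinitely many furcations: otherwise
all vertices of an infinite tree could send mass to the leader of its finite set of furcations. -/
theorem ae_infinite_branching (n : ℕ) (hfork : ∀ᵐ z ∂(fair (Γ × ℕ)), ∀ v,
    InForking (forest T z n) v) : ∀ᵐ z ∂(fair (Γ × ℕ)), ∀ v,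
    {u | (forest T z n).Reachable v u ∧ IsBranching (forest T z n) u}.Infinite := by
  have hac := hT.1.isAcyclic
  let B : (Γ × ℕ → Bool) → Γ → Set Γ := fun z v =>
    {u | (forest T z n).Reachable v u ∧ IsBranching (forest T z n) u}
  have hB : ∀ v u, Measurable fun z => u ∈ B z v := fun v u =>
    (measurable_reachable (measurable_forest hac n) v u).and
      (measurable_isBranching (measurable_forest hac n) u)
  have hshift := fun γ z => (process_shift z hac hinv γ n).1
  have hBs : ∀ γ z v u, u ∈ B (shift γ z) v ↔ γ⁻¹ * u ∈ B z (γ⁻¹ * v) := fun γ z v u =>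
    and_congr (reachable_congr _ (hshift γ z) v u) (isBranching_congr _ (hshift γ z) u)
  have hL := fun x y => measurable_isLeader (V := Γ) measurable_labOf (hB x) y
  have hLs : ∀ γ z x y, IsLeader (labOf (shift γ z)) (B (shift γ z) x) y ↔
      IsLeader (labOf z) (B z (γ⁻¹ * x)) (γ⁻¹ * y) := fun γ z x y =>
    isLeader_congr (lab := labOf z) (lab' := labOf (shift γ z)) (Equiv.mulLeft γ⁻¹) (fun _ => rfl)
      (hBs γ z x) y
  -- the uniqueness clause makes the relation functional even where labels coincide
  have h := ae_finite_of_equivariant (M := fun z x y => IsLeader (labOf z) (B z x) y ∧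
      ∀ y', IsLeader (labOf z) (B z x) y' → y' = y)
    (fun x y => (hL x y).and (Measurable.forall fun y' => (hL x y').imp measurable_const)) ?_ ?_
  · filter_upwards [h, hfork, ae_injective_labOf] with z hz hf hlab v hfin
    obtain ⟨u, hvu, hu⟩ := (inForking_iff (forest_isAcyclic z hac n) v).1 (hf v)
    obtain ⟨y, hy⟩ := exists_isLeader (labOf z) hfin ⟨u, hvu, hu⟩
    refine hu.infinite_reachable ((hz y).subset fun w hw => ?_)
    have hBw : B z w = B z v := by
      ext u'
      exact and_congr_left fun _ => ⟨fun h => (hvu.trans hw).trans h,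
        fun h => (hvu.trans hw).symm.trans h⟩
    change IsLeader (labOf z) (B z w) y ∧ ∀ y', IsLeader (labOf z) (B z w) y' → y' = y
    rw [hBw]
    exact ⟨hy, fun y' hy' => hy'.unique hlab hy⟩
  · intro γ z x y
    refine and_congr (hLs γ z x y) ((Equiv.mulLeft γ⁻¹).forall_congr fun y' => ?_)
    rw [hLs]
    exact imp_congr_right fun _ => (mul_right_inj γ⁻¹).symm
  · intro z x y y' h1 h2
    exact h2.2 y h1.1

include hinv in
theorem ae_canCoarsen (n : ℕ) (hfork : ∀ᵐ z ∂(fair (Γ × ℕ)), ∀ v, InForking (forest T z n) v)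
    (hcells : ∀ᵐ z ∂(fair (Γ × ℕ)), FiniteConnectedCells (forest T z n) (process T z n).2) :
    ∀ᵐ z ∂(fair (Γ × ℕ)), CanCoarsen (forest T z n) (process T z n).2 (labOf z) := by
  filter_upwards [ae_infinite_branching hT hinv n hfork, hcells, ae_injective_labOf]
    with z hinf hc hlab
  refine ⟨hlab, fun x => ?_, hc, fun x => ?_⟩
  · refine Set.Finite.subset (Set.finite_of_encard_eq_coe (k := 3) (hT.2 x)) ?_
    exact fun y hy => forest_le T z n hy
  · obtain ⟨u, hxu, hu⟩ := (hinf x).nonempty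
    obtain ⟨v, ⟨hxv, hv⟩, huv⟩ := ((hinf x).sdiff (hc.finite u)).nonempty
    exact ⟨u, v, hxu, hxv, huv, hu, hv⟩

include hinv in
/-- The growing seeds remain finite, since all vertices could send mass to the leader of the seed
that they join. -/
theorem ae_finite_assigned (n : ℕ) (hcan : ∀ᵐ z ∂(fair (Γ × ℕ)),
    CanCoarsen (forest T z n) (process T z n).2 (labOf z)) : ∀ᵐ z ∂(fair (Γ × ℕ)), ∀ y,
    {x | Assigned (forest T z n) (process T z n).2 (labOf z) x y}.Finite := by
  have hac := hT.1.isAcyclic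
  have hA := fun x y => measurable_assigned (measurable_forest hac n)
    (measurable_process hac n).2 measurable_labOf x y
  have hAs := fun γ z => assigned_congr (lab := labOf z) (lab' := labOf (shift γ z))
    (Equiv.mulLeft γ⁻¹) (mulLeft_inv_mul γ) (process_shift z hac hinv γ n).1
    (process_shift z hac hinv γ n).2 (fun _ => rfl)
  have h := ae_finite_of_equivariant
    (M := fun z x y => Assigned (forest T z n) (process T z n).2 (labOf z) x y ∧
      ∀ y', Assigned (forest T z n) (process T z n).2 (labOf z) x y' → y' = y)
    (fun x y => (hA x y).and (Measurable.forall fun y' => (hA x y').imp measurable_const)) ?_ ?_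
  · filter_upwards [h, hcan] with z hz hc y
    refine (hz y).subset fun x hx => ⟨hx, fun y' hy' => ?_⟩
    exact Assigned.unique hc.injective hy' hx
  · intro γ z x y
    refine and_congr (hAs γ z x y) ((Equiv.mulLeft γ⁻¹).forall_congr fun y' => ?_)
    refine imp_congr (hAs γ z x y') ?_
    exact (mul_right_inj γ⁻¹).symm
  · intro z x y y' h1 h2
    exact h2.2 y h1.1

omit hT [Group Γ] [Encodable Γ] in
theorem labOf_resample (n : ℕ) (z ξ : Γ × ℕ → Bool) :
    labOf (resample {i | i.2 = 2 * n} z ξ) = labOf z := by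
  funext v i
  have : ¬ (2 * i + 1 = 2 * n) := by omega
  simp [labOf, resample, this]

omit hT [Group Γ] [Encodable Γ] in
theorem bitOf_resample_of_ne {n k : ℕ} (h : k ≠ n) (z ξ : Γ × ℕ → Bool) :
    bitOf (resample {i | i.2 = 2 * n} z ξ) k = bitOf z k := by
  funext v
  simp [bitOf, resample, h]

omit hT [Group Γ] [Encodable Γ] in
theorem bitOf_resample (n : ℕ) (z ξ : Γ × ℕ → Bool) :
    bitOf (resample {i | i.2 = 2 * n} z ξ) n = bitOf ξ n := by
  funext v
  simp [bitOf, resample]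

omit hT in
theorem process_resample {n k : ℕ} (hk : k ≤ n) (z ξ : Γ × ℕ → Bool) :
    process T (resample {i | i.2 = 2 * n} z ξ) k = process T z k :=
  process_congr T (labOf_resample n z ξ) fun _ hl => bitOf_resample_of_ne (by omega) z ξ

omit hT in
theorem forest_resample {n k : ℕ} (hk : k ≤ n) (z ξ : Γ × ℕ → Bool) :
    forest T (resample {i | i.2 = 2 * n} z ξ) k = forest T z k := by
  rw [forest, process_resample hk]; rfl

omit hT in
theorem cells_resample {n k : ℕ} (hk : k ≤ n) (z ξ : Γ × ℕ → Bool) :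
    cells T (resample {i | i.2 = 2 * n} z ξ) k = cells T z k := by
  rw [cells_eq, cells_eq, forest_resample hk, process_resample hk, labOf_resample]

omit hT in
theorem cellBits_resample (n : ℕ) (z ξ : Γ × ℕ → Bool) :
    cellBits T (resample {i | i.2 = 2 * n} z ξ) n =
      leaderBit (cells T z n) (labOf z) (bitOf ξ n) := by
  rw [cellBits, cells_resample le_rfl, labOf_resample, bitOf_resample]

omit hT in
theorem cellBits_resample_of_lt {n k : ℕ} (hk : k < n) (z ξ : Γ × ℕ → Bool) :
    cellBits T (resample {i | i.2 = 2 * n} z ξ) k = cellBits T z k := by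
  rw [cellBits, cells_resample hk.le, labOf_resample, bitOf_resample_of_ne hk.ne]; rfl

omit hT in
theorem bits_resample_of_lt {n k : ℕ} (hk : k < n) (z ξ : Γ × ℕ → Bool) :
    bits T (resample {i | i.2 = 2 * n} z ξ) k = bits T z k := by
  rw [bits, cellBits_resample_of_lt hk, forest_resample hk.le]; rfl

omit hT [Group Γ] [Encodable Γ] in
/-- Percolation on the cells of a partition whose coarse-grained trees have minimal degree at least
four almost surely produces forking clusters in each tree. -/
theorem ae_exists_inForking [Countable Γ] {F : SimpleGraph Γ} (hF : F.IsAcyclic) {s : Setoid Γ}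
    (hs : FiniteConnectedCells F s) (hdeg : ∀ c, 4 ≤ ((coarseGraph F s).neighborSet c).encard)
    {lab : Γ → ℕ → Bool} (hlab : Function.Injective lab) (n : ℕ) :
    ∀ᵐ ξ ∂(fair (Γ × ℕ)), ∀ v, ∃ y, F.Reachable v y ∧
      InForking (clust F (leaderBit s lab (bitOf ξ n))) y := by
  rw [ae_all_iff]
  intro v
  have hex : ∀ c : Quotient s, ∃ x, Quotient.mk s x = c ∧ IsLeader lab {w | s x w} x := by
    intro c
    obtain ⟨x, rfl⟩ := Quotient.exists_rep c
    obtain ⟨y, hy⟩ := exists_isLeader lab (hs.finite x) ⟨x, s.refl' x⟩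
    have hxy : s x y := hy.1
    have : {w | s x w} = {w | s y w} := by
      ext w
      exact ⟨fun h => s.trans' (s.symm' hxy) h, fun h => s.trans' hxy h⟩
    exact ⟨y, Quotient.sound (s.symm' hxy), this ▸ hy⟩
  choose ℓ hℓ hlead using hex
  have hℓinj : Function.Injective ℓ := fun c d h => by rw [← hℓ c, ← hℓ d, h]
  obtain ⟨ι, hι, hι'⟩ := exists_ternary_embedding (coarseGraph_isAcyclic hF hs) hdeg
    (Quotient.mk s v)
  have hinj : Function.Injective fun l => (ℓ (ι l), 2 * n) := fun l l' h =>
    hι (hℓinj (congrArg Prod.fst h))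
  filter_upwards [ae_hasTriple_of_injective hinj] with ξ hξ
  obtain ⟨c, hvc, hc⟩ := hι' (fun c => bitOf ξ n (ℓ c)) hξ
  obtain ⟨u, rfl, hu⟩ := exists_isBranching_of_coarse hs _ hc
  have heq : (fun v => bitOf ξ n (ℓ (Quotient.mk s v))) = leaderBit s lab (bitOf ξ n) := by
    funext w
    have h1 : s w (ℓ (Quotient.mk s w)) := Quotient.exact (hℓ (Quotient.mk s w)).symm
    rw [leaderBit_congr_rel h1, leaderBit_eq hlab (hlead _)]
  rw [heq] at hu
  exact ⟨u, coarseGraph_reachable hs hvc, (inForking_iff (hF.anti (clust_le _ _)) u).2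
    ⟨u, SimpleGraph.Reachable.refl _, hu⟩⟩

theorem ae_forking (n : ℕ)
    (hcan : ∀ᵐ z ∂(fair (Γ × ℕ)), CanCoarsen (forest T z n) (process T z n).2 (labOf z))
    (hfin : ∀ᵐ z ∂(fair (Γ × ℕ)), ∀ y,
      {x | Assigned (forest T z n) (process T z n).2 (labOf z) x y}.Finite) :
    ∀ᵐ z ∂(fair (Γ × ℕ)), ∀ v, ∃ y, (forest T z n).Reachable v y ∧
      InForking (clust (forest T z n) (cellBits T z n)) y := by
  have hac := hT.1.isAcyclic
  have hcl := measurable_clust (measurable_forest hac n) (L := fun z => cellBits T z n)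
    fun x y => measurable_eq_of_discrete (measurable_cellBits hac n x) (measurable_cellBits hac n y)
  refine ae_of_ae_resample {i | i.2 = 2 * n} (Measurable.forall fun v => Measurable.exists fun y =>
    (measurable_reachable (measurable_forest hac n) v y).and (measurable_inForking
      (fun z => (forest_isAcyclic z hac n).anti (clust_le _ _)) hcl y)) ?_
  filter_upwards [hcan, hfin] with z hz hz'
  have hacz := forest_isAcyclic z hac n
  have hcg := hz.isCoarseGraining hacz hz' (forest_le T z n)
  have h := ae_exists_inForking hacz (hz.finiteConnectedCells hz') hcg.four_le_degree hz.injective n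
  filter_upwards [h] with ξ hξ
  rw [cellBits_resample, forest_resample le_rfl]
  exact hξ

include hinv in
theorem ae_goodStep (n : ℕ) : ∀ᵐ z ∂(fair (Γ × ℕ)), GoodStep T z n := by
  have key : ∀ n, (∀ᵐ z ∂(fair (Γ × ℕ)), ∀ v, InForking (forest T z n) v) →
      (∀ᵐ z ∂(fair (Γ × ℕ)), FiniteConnectedCells (forest T z n) (process T z n).2) →
      ∀ᵐ z ∂(fair (Γ × ℕ)), GoodStep T z n := by
    intro n h1 h2
    have h3 := ae_canCoarsen hT hinv n h1 h2
    have h4 := ae_finite_assigned hT hinv n h3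
    filter_upwards [h3, h4, ae_forking hT n h3 h4] with z h5 h6 h7
    exact ⟨h5, h6, h7⟩
  induction n with
  | zero =>
    refine key 0 (Eventually.of_forall fun z v => ?_) (Eventually.of_forall fun z => ⟨?_, ?_⟩)
    · exact (inForking_iff hT.1.isAcyclic v).2 ⟨v, SimpleGraph.Reachable.refl _,
        isBranching_of_isCubicTree hT v⟩
    · intro x
      exact (Set.finite_singleton x).subset fun y hy => (show x = y from hy).symm
    · intro x y hxy
      rw [show x = y from hxy]
  | succ n ih =>
    refine key (n + 1) ?_ ?_
    · filter_upwards [ih] with z hz using hz.inForking z hT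
    · filter_upwards [ih] with z hz using hz.finiteConnected_succ z

end

/-! ### Resampling and flipping the bits of one step -/

section

variable {I : Type*} (J : Set I)

/-- Flip the bits of `z` at the indices in `J`. -/
noncomputable def flipAt (z : I → Bool) : I → Bool := resample J z fun i => !(z i)

theorem measurePreserving_flipAt : MeasurePreserving (flipAt J) (fair I) (fair I) := by
  classical
  have h : flipAt J = fun z i => (if i ∈ J then not else id) (z i) := by
    funext z i
    by_cases hi : i ∈ J <;> simp [flipAt, resample, hi]
  have hm : ∀ i, Measurable (if i ∈ J then not else id : Bool → Bool) :=
    fun _ => measurable_from_top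
  rw [h]
  refine ⟨measurable_pi_lambda _ fun i => (hm i).comp (measurable_pi_apply i), ?_⟩
  unfold fair
  rw [Measure.infinitePi_map_pi (fun _ => coin) (f := fun i => if i ∈ J then not else id) hm]
  congr 1
  funext i
  by_cases hi : i ∈ J
  · simp only [hi, if_true]; exact coin_map_not
  · simp only [hi, if_false]; exact Measure.map_id

/-- The measurable sets that are unaffected by a change of the bits at the indices in `J`. -/
@[reducible] def invariantSpace : MeasurableSpace (I → Bool) where
  MeasurableSet' E := MeasurableSet E ∧ ∀ z ξ, resample J z ξ ∈ E ↔ z ∈ E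
  measurableSet_empty := ⟨MeasurableSet.empty, fun _ _ => Iff.rfl⟩
  measurableSet_compl E h := ⟨h.1.compl, fun z ξ => not_congr (h.2 z ξ)⟩
  measurableSet_iUnion E h := ⟨MeasurableSet.iUnion fun i => (h i).1, fun z ξ => by
    simp only [Set.mem_iUnion, (h _).2]⟩

theorem flipAt_mem_iff {E : Set (I → Bool)} (hE : MeasurableSet[invariantSpace J] E)
    (z : I → Bool) : flipAt J z ∈ E ↔ z ∈ E := hE.2 z _

end

section

variable {Γ : Type*} [Group Γ] [Encodable Γ] {T : SimpleGraph Γ} {z : Γ × ℕ → Bool} {n : ℕ}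

/-- The indices of the bits used in step `n`. -/
abbrev stepIndices (Γ : Type*) (n : ℕ) : Set (Γ × ℕ) := {i | i.2 = 2 * n}

theorem GoodStep.exists_isLeader (h : GoodStep T z n) (x : Γ) :
    ∃ y, IsLeader (labOf z) {w | cells T z n x w} y :=
  FactorIID.exists_isLeader _ (h.cells_finiteConnected.finite x)
    ⟨x, show cells T z n x x from Setoid.refl' _ x⟩

theorem GoodStep.cellBits_flipAt (h : GoodStep T z n) :
    cellBits T (flipAt (stepIndices Γ n) z) n = fun x => !(cellBits T z n x) := by
  funext x
  obtain ⟨y, hy⟩ := h.exists_isLeader x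
  rw [flipAt, cellBits_resample, leaderBit_eq h.canCoarsen.injective hy, cellBits,
    leaderBit_eq h.canCoarsen.injective hy]
  rfl

/-- Merging commutes with exchanging the two labels. -/
theorem GoodStep.bits_flipAt (hT : IsCubicTree T) (h : GoodStep T z n) :
    bits T (flipAt (stepIndices Γ n) z) n = fun x => !(bits T z n x) := by
  rw [bits, h.cellBits_flipAt, flipAt, forest_resample le_rfl]
  exact (h.isMergeOf z hT).not.mergeLim_eq

variable (hT : IsCubicTree T) (hinv : IsTranslationInvariant T)
include hT

theorem measurable_bits_family (n : ℕ) : Measurable fun z => bits T z n :=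
  measurable_pi_lambda _ fun v => measurable_bits hT.1.isAcyclic n v

theorem measurableSet_cells {k : ℕ} (hk : k ≤ n) (x y : Γ) :
    MeasurableSet[invariantSpace (stepIndices Γ n)] {z | cells T z k x y} :=
  ⟨measurableSet_setOfPred.2 (measurable_cells hT.1.isAcyclic k x y), fun z ξ => by
    rw [Set.mem_ofPred_eq, stepIndices, cells_resample hk]; rfl⟩

theorem measurableSet_cellBits {k : ℕ} (hk : k < n) (x : Γ) :
    MeasurableSet[invariantSpace (stepIndices Γ n)] {z | cellBits T z k x = true} :=
  ⟨measurableSet_setOfPred.2 (measurable_eq_of_discrete (measurable_cellBits hT.1.isAcyclic k x)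
    measurable_const), fun z ξ => by simp only [Set.mem_ofPred_eq, cellBits_resample_of_lt hk]⟩

theorem measurableSet_bits {k : ℕ} (hk : k < n) (x : Γ) (b : Bool) :
    MeasurableSet[invariantSpace (stepIndices Γ n)] {z | bits T z k x = b} :=
  ⟨measurableSet_setOfPred.2 (measurable_eq_of_discrete (measurable_bits hT.1.isAcyclic k x)
    measurable_const), fun z ξ => by simp only [Set.mem_ofPred_eq, bits_resample_of_lt hk]⟩

theorem measurableSet_firstBits {t : Set (Γ → Fin n → Bool)} (ht : MeasurableSet t) :
    MeasurableSet[invariantSpace (stepIndices Γ n)]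
      {z | (fun v (i : Fin n) => bits T z i v) ∈ t} := by
  refine ⟨?_, fun z ξ => ?_⟩
  · have hm : Measurable fun z v (i : Fin n) => bits T z i v :=
      measurable_pi_lambda _ fun v => measurable_pi_lambda _ fun i =>
        measurable_bits hT.1.isAcyclic i v
    exact hm ht
  · simp only [Set.mem_ofPred_eq, bits_resample_of_lt (Fin.is_lt _)]

include hinv

/-- Flipping the bits of step `n` shows that, jointly with everything determined before, the next
bits have a symmetric law. -/
theorem fair_inter_bits {E : Set (Γ × ℕ → Bool)}
    (hE : MeasurableSet[invariantSpace (stepIndices Γ n)] E) {A : Set (Γ → Bool)}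
    (hA : MeasurableSet A) :
    fair (Γ × ℕ) (E ∩ {z | bits T z n ∈ A}) =
      fair (Γ × ℕ) (E ∩ {z | (fun x => !(bits T z n x)) ∈ A}) := by
  have hm : MeasurableSet {z | bits T z n ∈ A} := measurable_bits_family hT n hA
  rw [← (measurePreserving_flipAt (stepIndices Γ n)).measure_preimage
    (hE.1.inter hm).nullMeasurableSet]
  refine measure_congr ?_
  filter_upwards [ae_goodStep hT hinv n] with z hz
  apply propext
  refine and_congr (flipAt_mem_iff _ hE z) ?_
  change bits T (flipAt (stepIndices Γ n) z) n ∈ A ↔ _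
  rw [hz.bits_flipAt hT]
  rfl

theorem fair_inter_bit {E : Set (Γ × ℕ → Bool)}
    (hE : MeasurableSet[invariantSpace (stepIndices Γ n)] E) (v : Γ) (b : Bool) :
    fair (Γ × ℕ) (E ∩ {z | bits T z n v = b}) = 2⁻¹ * fair (Γ × ℕ) E := by
  have hA : MeasurableSet {L : Γ → Bool | L v = b} :=
    measurableSet_setOfPred.2 (measurable_eq_of_discrete (measurable_pi_apply v) measurable_const)
  have h1 := fair_inter_bits hT hinv hE hA
  have h2 : E ∩ {z | (fun x => !(bits T z n x)) ∈ {L : Γ → Bool | L v = b}} =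
      E \ {z | bits T z n v = b} := by
    ext z
    refine and_congr_right fun _ => ?_
    simp only [Set.mem_ofPred_eq]
    cases b <;> cases bits T z n v <;> simp
  rw [h2] at h1
  have h3 := measure_inter_add_sdiff (μ := fair (Γ × ℕ)) E
    (measurable_bits_family hT n hA)
  change fair (Γ × ℕ) (E ∩ {z | bits T z n v = b}) +
    fair (Γ × ℕ) (E \ {z | bits T z n v = b}) = _ at h3
  change fair (Γ × ℕ) (E ∩ {z | bits T z n v = b}) = _ at h1
  rw [← h1, ← two_mul] at h3
  rw [← h3, ← mul_assoc, ENNReal.inv_mul_cancel (by simp) (by simp), one_mul]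

/-- The next bit of a vertex is fair and independent of everything determined before. -/
theorem fair_inter_bit_mem {E : Set (Γ × ℕ → Bool)}
    (hE : MeasurableSet[invariantSpace (stepIndices Γ n)] E) (v : Γ) (s : Set Bool) :
    fair (Γ × ℕ) (E ∩ {z | bits T z n v ∈ s}) = coin s * fair (Γ × ℕ) E := by
  have hm := measurable_bits hT.1.isAcyclic (T := T) n v
  have h : ((fair (Γ × ℕ)).restrict E).map (fun z => bits T z n v) = fair (Γ × ℕ) E • coin := by
    refine Measure.ext_of_singleton fun b => ?_
    rw [Measure.map_apply hm (measurableSet_singleton b),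
      Measure.restrict_apply (hm (measurableSet_singleton b)), Measure.smul_apply, coin_singleton,
      smul_eq_mul, mul_comm, ← fair_inter_bit hT hinv hE v b, Set.inter_comm]
    rfl
  have hs : MeasurableSet s := by measurability
  have h2 := congrArg (fun ν => ν s) h
  simp only [Measure.smul_apply, smul_eq_mul] at h2
  rw [Measure.map_apply hm hs, Measure.restrict_apply (hm hs)] at h2
  rw [Set.inter_comm, mul_comm, ← h2]
  rfl

/-- The bits of a vertex are independent and fair. -/
theorem map_bits (v : Γ) : (fair (Γ × ℕ)).map (fun z n => bits T z n v) = fair ℕ := by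
  have hm : Measurable fun z n => bits T z n v :=
    measurable_pi_lambda _ fun n => measurable_bits hT.1.isAcyclic n v
  have := Measure.isProbabilityMeasure_map (μ := fair (Γ × ℕ)) hm.aemeasurable
  refine eq_fair_of_prefixSet fun n ε => ?_
  rw [Measure.map_apply hm (measurableSet_prefixSet n ε)]
  induction n with
  | zero =>
    have h0 : prefixSet 0 ε = Set.univ := by ext; simp [prefixSet]
    rw [h0]
    simp
  | succ n ih =>
    have hE : MeasurableSet[invariantSpace (stepIndices Γ n)]
        ((fun z n => bits T z n v) ⁻¹' prefixSet n ε) := by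
      have h1 : ((fun z n => bits T z n v) ⁻¹' prefixSet n ε) =
          ⋂ k : Fin n, {z | bits T z k v = ε k} := by
        ext z
        simp [prefixSet, Fin.forall_iff]
      rw [h1]
      exact @MeasurableSet.iInter _ _ (invariantSpace (stepIndices Γ n)) _ _ fun k =>
        measurableSet_bits hT k.2 v _
    have h2 := fair_inter_bit hT hinv hE v (ε n)
    rw [ih] at h2
    rw [pow_succ', ← h2]
    congr 1
    ext z
    change (∀ i < n + 1, bits T z i v = ε i) ↔
      (∀ i < n, bits T z i v = ε i) ∧ bits T z n v = ε n
    refine ⟨fun h => ⟨fun i hi => h i (by omega), h n (by omega)⟩, fun h i hi => ?_⟩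
    rcases Nat.lt_succ_iff_lt_or_eq.1 hi with hi | rfl
    · exact h.1 i hi
    · exact h.2

/-- Given everything determined before, the percolation on the cells consists of independent fair
bits. -/
theorem fair_inter_cellBits {E : Set (Γ × ℕ → Bool)}
    (hE : MeasurableSet[invariantSpace (stepIndices Γ n)] E) (A : Finset Γ) (ε : Γ → Bool)
    (hA : ∀ z ∈ E, ∀ x ∈ A, ∀ y ∈ A, x ≠ y → ¬ cells T z n x y) :
    fair (Γ × ℕ) (E ∩ {z | ∀ x ∈ A, cellBits T z n x = ε x}) =
      2⁻¹ ^ A.card * fair (Γ × ℕ) E := by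
  have hm : MeasurableSet {z | ∀ x ∈ A, cellBits T z n x = ε x} :=
    measurableSet_setOfPred.2 (Measurable.forall fun x => measurable_const.imp
      (measurable_eq_of_discrete (measurable_cellBits hT.1.isAcyclic n x) measurable_const))
  rw [fair_eq_lintegral_resample (stepIndices Γ n) (hE.1.inter hm)]
  have h1 : ∀ᵐ z ∂(fair (Γ × ℕ)), fair (Γ × ℕ) {ξ | resample (stepIndices Γ n) z ξ ∈
      E ∩ {z | ∀ x ∈ A, cellBits T z n x = ε x}} =
      E.indicator (fun _ => (2⁻¹ : ENNReal) ^ A.card) z := by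
    filter_upwards [ae_goodStep hT hinv n] with z hz
    simp only [Set.mem_inter_iff, hE.2, Set.mem_ofPred_eq, cellBits_resample]
    by_cases hzE : z ∈ E
    · choose ℓ hℓ using hz.exists_isLeader
      have hinj : Function.Injective fun x : A => (ℓ x, 2 * n) := by
        rintro ⟨x, hx⟩ ⟨y, hy⟩ hxy
        by_contra hne
        refine hA z hzE x hx y hy (fun h => hne (Subtype.ext h)) ?_
        have h2 : ℓ x = ℓ y := congrArg Prod.fst hxy
        have h3 : cells T z n x (ℓ x) := (hℓ x).1
        have h4 : cells T z n y (ℓ y) := (hℓ y).1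
        exact Setoid.trans' _ h3 (h2 ▸ Setoid.symm' _ h4)
      have h5 : {ξ | z ∈ E ∧ ∀ x ∈ A, leaderBit (cells T z n) (labOf z) (bitOf ξ n) x = ε x} =
          (fun (ξ : Γ × ℕ → Bool) (x : A) => ξ (ℓ x, 2 * n)) ⁻¹'
            (Set.pi (Finset.univ : Finset A) fun x => {ε x}) := by
        ext ξ
        simp only [hzE, true_and, leaderBit_eq hz.canCoarsen.injective (hℓ _), bitOf]
        simp [Set.mem_pi]
      have hm' : Measurable fun (ξ : Γ × ℕ → Bool) (x : A) => ξ (ℓ x, 2 * n) :=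
        measurable_pi_lambda _ fun x => measurable_pi_apply _
      rw [h5, ← Measure.map_apply hm'
        (.pi (Finset.countable_toSet _) fun _ _ => measurableSet_singleton _),
        fair_map_injective hinj, fair,
        Measure.infinitePi_pi _ (fun _ _ => measurableSet_singleton _)]
      simp [coin_singleton, hzE]
    · simp [hzE]
  rw [lintegral_congr_ae h1, lintegral_indicator hE.1]
  simp

/-! ### The labeling -/

omit hT hinv in
/-- All bits are constant along the edges inside a cell. -/
theorem reachable_of_cells (hgood : ∀ n, GoodStep T z n) {x y : Γ} (hxy : cells T z n x y) :
    (clust T fun v k => bits T z k v).Reachable x y := by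
  have hle : ∀ {k l}, k ≤ l → ∀ a b, cells T z k a b → cells T z l a b := by
    intro k l hkl a b h
    induction hkl with
    | refl => exact h
    | step _ ih => exact le_coarsen ih
  refine ((hgood n).cells_finiteConnected.connected x y hxy).mono ?_
  intro a b hab
  refine ⟨forest_le T z n hab.1, funext fun k => ?_⟩
  rcases lt_or_ge k n with hk | hk
  · have h1 := hab.1
    rw [forest_eq_clust] at h1
    exact congrFun h1.2 ⟨k, hk⟩
  · refine (hgood k).bits_eq_of_cells z (hle hk _ _ ?_)
    exact Setoid.trans' _ (Setoid.symm' _ hab.2.1) hab.2.2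

omit hT hinv in
/-- The cells of `x` are contained in its cluster and grow strictly, because each new cell contains
furcations in two old ones. -/
theorem infinite_cluster (hgood : ∀ n, GoodStep T z n) (x : Γ) :
    {y | (clust T fun v k => bits T z k v).Reachable x y}.Infinite := by
  intro hfin
  have hsub : ∀ n, {y | cells T z n x y} ⊆ {y | (clust T fun v k => bits T z k v).Reachable x y} :=
    fun n y hy => reachable_of_cells hgood hy
  have hlt : ∀ n, {y | cells T z n x y}.ncard < {y | cells T z (n + 1) x y}.ncard := by
    intro n
    refine Set.ncard_lt_ncard ⟨fun y hy => le_coarsen hy, fun h => ?_⟩ (hfin.subset (hsub _))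
    obtain ⟨u, v, hu, hv, huv, _⟩ := (hgood (n + 1)).canCoarsen.exists_two_branching x
    exact huv (Setoid.trans' _ (Setoid.symm' _ (h hu)) (h hv))
  have hge : ∀ n, n ≤ {y | cells T z n x y}.ncard := by
    intro n
    induction n with
    | zero => exact Nat.zero_le _
    | succ n ih => exact ih.trans_lt (hlt n)
  have h1 := hge ({y | (clust T fun v k => bits T z k v).Reachable x y}.ncard + 1)
  have h2 := Set.ncard_le_ncard
    (hsub ({y | (clust T fun v k => bits T z k v).Reachable x y}.ncard + 1)) hfin
  omega

end

section

variable {Γ : Type*} [Group Γ] [Encodable Γ] (T : SimpleGraph Γ) (z : Γ × ℕ → Bool)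

/-- All clusters of the sequences of bits are infinite, and these sequences are binary expansions
with infinitely many ones. -/
def IsRegular : Prop :=
  (∀ v, {w | (clust T fun v k => bits T z k v).Reachable v w}.Infinite) ∧
    ∀ v n, ∃ m, n ≤ m ∧ bits T z m v = true

open Classical in
/-- The labeling with binary digits given by the construction; on the null event that the
construction fails, all labels are zero. -/
noncomputable def label : Γ → unitInterval := fun v =>
  if IsRegular T z then unitOfBits (fun n => bits T z n v) else 0

variable {T z}

theorem label_of_isRegular (h : IsRegular T z) (v : Γ) :
    label T z v = unitOfBits fun n => bits T z n v := if_pos h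

theorem nextBit_label (h : IsRegular T z) (n : ℕ) : nextBit n (label T z) = bits T z n := by
  funext v
  have := digits_unitOfBits (h.2 v)
  rw [nextBit, label_of_isRegular h]
  exact congrFun this n

theorem firstBits_label (h : IsRegular T z) (n : ℕ) :
    firstBits n (label T z) = fun v (i : Fin n) => bits T z i v := by
  funext v i
  exact congrFun (nextBit_label h i) v

theorem measurable_isRegular (hT : T.IsAcyclic) : Measurable fun z => IsRegular T z := by
  refine Measurable.and (Measurable.forall fun v => measurable_infinite fun w =>
    measurable_reachable (measurable_clust (fun _ _ => measurable_const) fun x y => ?_) v w)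
    (Measurable.forall fun v => Measurable.forall fun n => Measurable.exists fun m =>
      measurable_const.and (measurable_eq_of_discrete (measurable_bits hT m v) measurable_const))
  simp only [funext_iff]
  exact Measurable.forall fun k =>
    measurable_eq_of_discrete (measurable_bits hT k x) (measurable_bits hT k y)

theorem measurable_label (hT : T.IsAcyclic) : Measurable fun z => label T z := by
  refine measurable_pi_lambda _ fun v => ?_
  exact Measurable.ite (measurableSet_setOfPred.2 (measurable_isRegular hT))
    (measurable_unitOfBits.comp (measurable_pi_lambda _ fun n => measurable_bits hT n v))
    measurable_const

theorem label_shift (hT : T.IsAcyclic) (hinv : IsTranslationInvariant T) (γ : Γ)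
    (z : Γ × ℕ → Bool) (v : Γ) : label T (shift γ z) v = label T z (γ⁻¹ * v) := by
  have hb := bits_shift z hT hinv γ
  have h1 : IsRegular T (shift γ z) ↔ IsRegular T z := by
    refine and_congr ((Equiv.mulLeft γ⁻¹).forall_congr fun v => ?_)
      ((Equiv.mulLeft γ⁻¹).forall_congr fun v => ?_)
    · have hcl := clust_congr (Equiv.mulLeft γ⁻¹) (fun x y => (hinv γ⁻¹ x y).symm)
        (L' := fun v k => bits T (shift γ z) k v) (L := fun v k => bits T z k v)
        (fun x => funext fun k => hb k x)
      have h2 : {w | (clust T fun v k => bits T (shift γ z) k v).Reachable v w} =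
          Equiv.mulLeft γ⁻¹ ⁻¹'
            {w | (clust T fun v k => bits T z k v).Reachable (Equiv.mulLeft γ⁻¹ v) w} := by
        ext w
        exact reachable_congr _ hcl v w
      rw [h2, ← Set.infinite_image_iff (Equiv.injective _).injOn,
        Set.image_preimage_eq _ (Equiv.surjective _)]
    · simp only [hb]
      rfl
  unfold label
  by_cases h : IsRegular T z
  · rw [if_pos (h1.2 h), if_pos h]
    simp only [hb]
  · rw [if_neg (mt h1.1 h), if_neg h]

theorem infinite_label_cluster (hT : IsCubicTree T) (z : Γ × ℕ → Bool) (v : Γ) :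
    {w | (clust T (label T z)).Reachable v w}.Infinite := by
  by_cases h : IsRegular T z
  · refine (h.1 v).mono fun w hw => hw.mono ?_
    rintro x y ⟨hxy, hL⟩
    refine ⟨hxy, ?_⟩
    rw [label_of_isRegular h, label_of_isRegular h]
    exact congrArg unitOfBits hL
  · refine (isBranching_of_isCubicTree hT v).infinite_reachable.mono fun w hw => hw.mono ?_
    intro x y hxy
    refine ⟨hxy, ?_⟩
    simp only [label, h, if_false]

variable (hT : IsCubicTree T) (hinv : IsTranslationInvariant T)
include hT hinv

theorem ae_all_goodStep : ∀ᵐ z ∂(fair (Γ × ℕ)), ∀ n, GoodStep T z n :=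
  ae_all_iff.2 fun n => ae_goodStep hT hinv n

theorem ae_isRegular : ∀ᵐ z ∂(fair (Γ × ℕ)), IsRegular T z := by
  have h : ∀ᵐ z ∂(fair (Γ × ℕ)), ∀ v n, ∃ m, n ≤ m ∧ bits T z m v = true := by
    rw [ae_all_iff]
    intro v
    have h1 := ae_fair_frequently_true
    rw [← map_bits hT hinv v] at h1
    exact ae_of_ae_map (measurable_pi_lambda _ fun n =>
      measurable_bits hT.1.isAcyclic n v).aemeasurable h1
  filter_upwards [ae_all_goodStep hT hinv, h] with z hz hz'
  exact ⟨fun v => infinite_cluster hz v, hz'⟩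

theorem map_label (v : Γ) : (fair (Γ × ℕ)).map (fun z => label T z v) = volume := by
  have hm : Measurable fun z n => bits T z n v :=
    measurable_pi_lambda _ fun n => measurable_bits hT.1.isAcyclic n v
  have h1 : (fun z => label T z v) =ᵐ[fair (Γ × ℕ)]
      unitOfBits ∘ fun z n => bits T z n v := by
    filter_upwards [ae_isRegular hT hinv] with z hz using label_of_isRegular hz v
  rw [Measure.map_congr h1, ← Measure.map_map measurable_unitOfBits hm, map_bits hT hinv,
    map_unitOfBits]

omit [Group Γ] [Encodable Γ] hT hinv in
theorem ae_digitMap {P : (Γ × ℕ → Bool) → Prop} (h : ∀ᵐ z ∂(fair (Γ × ℕ)), P z) :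
    ∀ᵐ ω ∂(iidUniform Γ), P (digitMap ω) := by
  rw [← map_digitMap] at h
  exact ae_of_ae_map measurable_digitMap.aemeasurable h

omit [Group Γ] [Encodable Γ] hT hinv in
theorem iidUniform_preimage {A : Set (Γ × ℕ → Bool)} (hA : MeasurableSet A) :
    iidUniform Γ (digitMap ⁻¹' A) = fair (Γ × ℕ) A := by
  rw [← map_digitMap, Measure.map_apply measurable_digitMap hA]

/-- Up to null sets, everything that is determined before step `n` is unaffected by the bits used
in step `n`. -/
theorem exists_invariant_of_past (n : ℕ) {E : Set (Γ → unitInterval)}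
    (hE : MeasurableSet[past (fun ω => label T (digitMap ω)) (fun n ω => cells T (digitMap ω) n)
      (fun n ω => cellBits T (digitMap ω) n) n] E) :
    ∃ E', MeasurableSet[invariantSpace (stepIndices Γ n)] E' ∧
      E =ᵐ[iidUniform Γ] digitMap ⁻¹' E' := by
  have hle : past (fun ω => label T (digitMap ω)) (fun n ω => cells T (digitMap ω) n)
      (fun n ω => cellBits T (digitMap ω) n) n ≤
      eventuallyMeasurableSpace ((invariantSpace (stepIndices Γ n)).comap digitMap)
        (ae (iidUniform Γ)) := by
    refine MeasurableSpace.generateFrom_le ?_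
    rintro _ ((⟨k, hk, x, y, rfl⟩ | ⟨k, hk, x, rfl⟩) | ⟨k, hk, x, rfl⟩)
    · exact ⟨_, ⟨_, measurableSet_cells hT hk x y, rfl⟩, EventuallyEq.rfl⟩
    · exact ⟨_, ⟨_, measurableSet_cellBits hT hk x, rfl⟩, EventuallyEq.rfl⟩
    · refine ⟨_, ⟨_, measurableSet_bits hT hk x true, rfl⟩, ?_⟩
      filter_upwards [ae_digitMap (ae_isRegular hT hinv)] with ω hω
      have h1 := congrFun (nextBit_label hω k) x
      apply propext
      change nextBit k (label T (digitMap ω)) x = true ↔ bits T (digitMap ω) k x = true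
      rw [h1]
  obtain ⟨_, ⟨E', hE', rfl⟩, h⟩ := hle E hE
  exact ⟨E', hE', h⟩

/-- The event that the vertices of `A` are in distinct cells is itself determined before step `n`,
so it can be added to the given event of the past. -/
theorem isFairCellLabeling_cellBits (n : ℕ) :
    IsFairCellLabeling (iidUniform Γ) (past (fun ω => label T (digitMap ω))
      (fun n ω => cells T (digitMap ω) n) (fun n ω => cellBits T (digitMap ω) n) n)
      (fun ω => cells T (digitMap ω) n) (fun ω => cellBits T (digitMap ω) n) := by
  refine ⟨Eventually.of_forall fun ω x y hxy => leaderBit_congr_rel hxy, fun A ε E hE hA => ?_⟩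
  obtain ⟨E', hE', hEE'⟩ := exists_invariant_of_past hT hinv n hE
  let D : Set (Γ × ℕ → Bool) := {z | ∀ x ∈ A, ∀ y ∈ A, x ≠ y → ¬ cells T z n x y}
  have hD : MeasurableSet[invariantSpace (stepIndices Γ n)] D := by
    refine ⟨measurableSet_setOfPred.2 (Measurable.forall fun x => measurable_const.imp
      (Measurable.forall fun y => measurable_const.imp (measurable_const.imp
        (measurable_cells hT.1.isAcyclic n x y).not))), fun z ξ => ?_⟩
    simp only [D, Set.mem_ofPred_eq]
    rw [stepIndices, cells_resample le_rfl]
  have hED : E =ᵐ[iidUniform Γ] digitMap ⁻¹' (E' ∩ D) := by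
    filter_upwards [hEE'] with ω hω
    have h1 : ω ∈ E ↔ digitMap ω ∈ E' := iff_of_eq hω
    exact propext ⟨fun h => ⟨h1.1 h, hA ω h⟩, fun h => h1.2 h.1⟩
  have hE'D := @MeasurableSet.inter _ (invariantSpace (stepIndices Γ n)) _ _ hE' hD
  have hmain := fair_inter_cellBits hT hinv hE'D A ε fun z hz => hz.2
  have hm : MeasurableSet {z | ∀ x ∈ A, cellBits T z n x = ε x} :=
    measurableSet_setOfPred.2 (Measurable.forall fun x => measurable_const.imp
      (measurable_eq_of_discrete (measurable_cellBits hT.1.isAcyclic n x) measurable_const))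
  rw [← iidUniform_preimage (hE'D.1.inter hm), ← iidUniform_preimage hE'D.1] at hmain
  rw [one_div, measure_congr hED, ← hmain]
  exact measure_congr (hED.inter (EventuallyEq.refl _ _))

theorem indepFun_bits (n : ℕ) (v : Γ) :
    ProbabilityTheory.IndepFun (fun ω => bits T (digitMap ω) n v)
      (fun ω v (i : Fin n) => bits T (digitMap ω) i v) (iidUniform Γ) := by
  rw [ProbabilityTheory.indepFun_iff_measure_inter_preimage_eq_mul]
  intro s t hs ht
  have hm := measurable_bits (T := T) hT.1.isAcyclic n v
  have hs' : MeasurableSet {z | bits T z n v ∈ s} := hm hs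
  have hE := measurableSet_firstBits hT ht
  have h1 := fair_inter_bit_mem hT hinv hE v s
  have h2 := fair_inter_bit_mem hT hinv (@MeasurableSet.univ _ (invariantSpace (stepIndices Γ n)))
    v s
  rw [Set.univ_inter, measure_univ, mul_one] at h2
  rw [← h2, ← iidUniform_preimage (hE.1.inter hs'), ← iidUniform_preimage hE.1,
    ← iidUniform_preimage hs'] at h1
  rw [Set.inter_comm]
  exact h1

end

/-- A connected locally finite graph has countably many vertices. -/
theorem countable_of_connected {V : Type*} {T : SimpleGraph V} (hT : T.Connected)
    (hfin : ∀ v, (T.neighborSet v).Finite) : Countable V := by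
  obtain ⟨v⟩ := hT.nonempty
  let B : ℕ → Set V := fun n => Nat.rec {v} (fun _ B => ⋃ x ∈ B, T.neighborSet x) n
  have hB : ∀ n, (B n).Countable := by
    intro n
    induction n with
    | zero => exact Set.countable_singleton v
    | succ n ih => exact ih.biUnion fun x _ => (hfin x).countable
  have hcover : ∀ w, ∃ n, w ∈ B n := by
    intro w
    refine reachable_induction (P := fun w => ∃ n, w ∈ B n) ⟨0, rfl⟩ ?_ (hT.preconnected v w)
    rintro x y _ ⟨n, hn⟩ hxy
    exact ⟨n + 1, Set.mem_biUnion hn hxy⟩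
  rw [← Set.countable_univ_iff]
  refine (Set.countable_iUnion hB).mono fun w _ => ?_
  exact Set.mem_iUnion.2 (hcover w)

/-! ### The 3-regular tree as a Cayley graph -/

/-- A graph is acyclic if it has a height function such that adjacent vertices have different
heights, and each vertex has at most one lower neighbor: a highest vertex of a cycle would have two
lower neighbors. -/
theorem isAcyclic_of_height {V : Type*} {T : SimpleGraph V} (ℓ : V → ℕ)
    (hne : ∀ x y, T.Adj x y → ℓ x ≠ ℓ y)
    (huniq : ∀ x y y', T.Adj x y → T.Adj x y' → ℓ y < ℓ x → ℓ y' < ℓ x → y = y') :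
    T.IsAcyclic := by
  classical
  intro v c hc
  obtain ⟨u, hu, hmax⟩ := c.support.toFinset.exists_max_image ℓ ⟨v, by simp⟩
  rw [List.mem_toFinset] at hu
  have hc' := hc.rotate hu
  have hle : ∀ w ∈ (c.rotate u hu).support, ℓ w ≤ ℓ u := fun w hw => hmax w (by
    rw [List.mem_toFinset]
    exact (c.mem_support_rotate_iff u hu).1 hw)
  have h1 := (c.rotate u hu).adj_snd hc'.not_nil
  have h2 := ((c.rotate u hu).adj_penultimate hc'.not_nil).symm
  refine hc'.snd_ne_penultimate (huniq u _ _ h1 h2 ?_ ?_)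
  · exact lt_of_le_of_ne (hle _ (SimpleGraph.Walk.getVert_mem_support _ _)) (hne _ _ h1).symm
  · exact lt_of_le_of_ne (hle _ (SimpleGraph.Walk.getVert_mem_support _ _)) (hne _ _ h2).symm

/-- The free product of three groups of order two. -/
abbrev TripleInvolutions : Type := Monoid.CoprodI fun _ : Fin 3 => Multiplicative (ZMod 2)

namespace TripleInvolutions

open Monoid.CoprodI

/-- The normal forms of the elements. -/
abbrev ReducedWord : Type := Word fun _ : Fin 3 => Multiplicative (ZMod 2)

/-- The nontrivial element of the group of order two. -/
abbrev invol : Multiplicative (ZMod 2) := Multiplicative.ofAdd 1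

theorem eq_invol {m : Multiplicative (ZMod 2)} (h : m ≠ 1) : m = invol := by
  revert m
  decide

/-- The three standard generators. -/
def gen (i : Fin 3) : TripleInvolutions :=
  Monoid.CoprodI.of (M := fun _ : Fin 3 => Multiplicative (ZMod 2)) (i := i) invol

theorem gen_mul_gen (i : Fin 3) : gen i * gen i = 1 := by
  rw [gen, ← map_mul, show invol * invol = 1 by decide, map_one]

theorem gen_inv (i : Fin 3) : (gen i)⁻¹ = gen i := inv_eq_of_mul_eq_one_left (gen_mul_gen i)

theorem gen_smul_of_fstIdx_ne {i : Fin 3} {w : ReducedWord}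
    (h : w.fstIdx ≠ some i) :
    gen i • w = Word.cons (i := i) invol w h (by decide) :=
  (Word.cons_eq_smul (i := i) (m := invol) (ls := w) (h1 := h) (h2 := by decide)).symm

theorem exists_cons_of_fstIdx_eq {i : Fin 3} {w : ReducedWord}
    (h : w.fstIdx = some i) : ∃ w' : ReducedWord,
      ∃ h' : w'.fstIdx ≠ some i, w = Word.cons (i := i) invol w' h' (by decide) := by
  induction w using Word.consRecOn with
  | empty => simp [Word.fstIdx, Word.empty] at h
  | cons j m w h1 h2 ih =>
    rw [Word.fstIdx_cons, Option.some_inj] at h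
    subst h
    obtain rfl := eq_invol h2
    exact ⟨w, h1, rfl⟩

/-- The word length. -/
def wordLength (w : ReducedWord) : ℕ := w.toList.length

theorem wordLength_gen_smul_of_ne {i : Fin 3}
    {w : ReducedWord} (h : w.fstIdx ≠ some i) :
    wordLength (gen i • w) = wordLength w + 1 := by
  rw [gen_smul_of_fstIdx_ne h]
  rfl

theorem wordLength_gen_smul_of_eq {i : Fin 3}
    {w : ReducedWord} (h : w.fstIdx = some i) :
    wordLength (gen i • w) + 1 = wordLength w := by
  obtain ⟨w', h', rfl⟩ := exists_cons_of_fstIdx_eq h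
  rw [← gen_smul_of_fstIdx_ne h', smul_smul, gen_mul_gen, one_smul, wordLength_gen_smul_of_ne h']

/-- The word length of the inverse, on which right multiplication by a generator acts by adding or
removing the first letter. -/
def height (x : TripleInvolutions) : ℕ := wordLength (x⁻¹ • Word.empty)

theorem height_mul_gen (x : TripleInvolutions) (i : Fin 3) :
    height (x * gen i) = wordLength (gen i • (x⁻¹ • (Word.empty : ReducedWord))) := by
  rw [height, mul_inv_rev, gen_inv, smul_smul]

theorem height_mul_gen_ne (x : TripleInvolutions) (i : Fin 3) : height (x * gen i) ≠ height x := by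
  rw [height_mul_gen, height]
  by_cases h : (x⁻¹ • (Word.empty : ReducedWord)).fstIdx = some i
  · have := wordLength_gen_smul_of_eq h
    omega
  · have := wordLength_gen_smul_of_ne h
    omega

theorem fstIdx_of_height_lt {x : TripleInvolutions} {i : Fin 3}
    (hlt : height (x * gen i) < height x) :
    (x⁻¹ • (Word.empty : ReducedWord)).fstIdx = some i := by
  by_contra h
  rw [height_mul_gen, height, wordLength_gen_smul_of_ne h] at hlt
  omega

theorem gen_injective : Function.Injective gen := by
  intro i j hij
  have h : ∀ i, (gen i • (Word.empty : ReducedWord)).fstIdx =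
      some i := fun i => by
    have h0 : (Word.empty : ReducedWord).fstIdx ≠ some i :=
      Option.some_ne_none i |>.symm
    rw [gen_smul_of_fstIdx_ne h0, Word.fstIdx_cons]
  have h1 := h i
  rw [hij, h j, Option.some_inj] at h1
  exact h1.symm

theorem cayley_adj_iff (x y : TripleInvolutions) :
    (SimpleGraph.mulCayley (Set.range gen)).Adj x y ↔ ∃ i, y = x * gen i := by
  rw [SimpleGraph.mulCayley_adj]
  constructor
  · rintro ⟨_, ⟨i, hi⟩ | ⟨i, hi⟩⟩
    · exact ⟨i, by rw [hi, mul_inv_cancel_left]⟩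
    · exact ⟨i, by rw [← gen_inv, hi, mul_inv_rev, inv_inv, mul_inv_cancel_left]⟩
  · rintro ⟨i, rfl⟩
    refine ⟨fun h => height_mul_gen_ne x i (congrArg height h).symm, Or.inl ⟨i, ?_⟩⟩
    rw [inv_mul_cancel_left]

theorem isCubicTree_cayley : IsCubicTree (SimpleGraph.mulCayley (Set.range gen)) := by
  refine ⟨⟨?_, isAcyclic_of_height height ?_ ?_⟩, fun x => ?_⟩
  · have h : ∀ y x : TripleInvolutions,
        (SimpleGraph.mulCayley (Set.range gen)).Reachable x (x * y) := by
      intro y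
      induction y using Monoid.CoprodI.induction_on with
      | one => exact fun x => by rw [mul_one]
      | of i m =>
        intro x
        by_cases hm : m = 1
        · rw [hm, map_one, mul_one]
        · rw [eq_invol hm]
          exact ((cayley_adj_iff _ _).2 ⟨i, rfl⟩).reachable
      | mul a b ha hb =>
        intro x
        rw [← mul_assoc]
        exact (ha x).trans (hb _)
    have hpre : (SimpleGraph.mulCayley (Set.range gen)).Preconnected := fun x y => by
      have := h (x⁻¹ * y) x
      rwa [mul_inv_cancel_left] at this
    exact ⟨hpre⟩
  · intro x y hxy
    obtain ⟨i, rfl⟩ := (cayley_adj_iff _ _).1 hxy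
    exact (height_mul_gen_ne x i).symm
  · intro x y y' hy hy' hlt hlt'
    obtain ⟨i, rfl⟩ := (cayley_adj_iff _ _).1 hy
    obtain ⟨j, rfl⟩ := (cayley_adj_iff _ _).1 hy'
    have h1 := fstIdx_of_height_lt hlt
    rw [fstIdx_of_height_lt hlt', Option.some_inj] at h1
    rw [h1]
  · have h : (SimpleGraph.mulCayley (Set.range gen)).neighborSet x =
        Set.range fun i => x * gen i := by
      ext y
      rw [SimpleGraph.mem_neighborSet, cayley_adj_iff]
      exact exists_congr fun i => eq_comm
    have hinj : Function.Injective fun i => x * gen i :=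
      fun i j hij => gen_injective (mul_left_cancel hij)
    rw [h, ← Set.image_univ, hinj.encard_image, Set.encard_univ]
    simp

end TripleInvolutions

end FactorIID

theorem mainTheorem1 :
    -- the 3-regular tree is a Cayley graph
    (∃ (G : Type) (_ : Group G) (S : Set G), FactorIID.IsCubicTree (SimpleGraph.mulCayley S)) ∧
    ∀ (Γ : Type*) [Group Γ] (S : Set Γ), FactorIID.IsCubicTree (SimpleGraph.mulCayley S) →
      ∃ (f : (Γ → unitInterval) → (Γ → unitInterval))
        (p : ℕ → (Γ → unitInterval) → Setoid Γ)
        (g : ℕ → (Γ → unitInterval) → (Γ → Bool)),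
        FactorIID.IsFactor f ∧
        (∀ n, FactorIID.IsFactorPartition (p n)) ∧
        (∀ n, FactorIID.IsFactor (g n)) ∧
        -- each marginal is uniform
        (∀ v, Measure.map (fun ω => f ω v) (FactorIID.iidUniform Γ) = volume) ∧
        -- every vertex lies in an infinite cluster of equal labels
        (∀ ω v, {w | (FactorIID.clust (SimpleGraph.mulCayley S) (f ω)).Reachable v w}.Infinite) ∧
        ∀ n,
          -- the next bit is a symmetric labeling, fair, and independent of the earlier bits
          Measure.map (fun ω => FactorIID.nextBit n (f ω)) (FactorIID.iidUniform Γ) =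
            Measure.map (fun ω v => !(FactorIID.nextBit n (f ω) v)) (FactorIID.iidUniform Γ) ∧
          (∀ v, FactorIID.iidUniform Γ {ω | FactorIID.nextBit n (f ω) v = true} = 1 / 2) ∧
          (∀ v, ProbabilityTheory.IndepFun (fun ω => FactorIID.nextBit n (f ω) v)
            (fun ω => FactorIID.firstBits n (f ω)) (FactorIID.iidUniform Γ)) ∧
          -- the partitions coarsen, and the coarse-grained trees have minimal degree at least 4
          (∀ᵐ ω ∂(FactorIID.iidUniform Γ), p n ω ≤ p (n + 1) ω) ∧
          (∀ᵐ ω ∂(FactorIID.iidUniform Γ),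
            FactorIID.IsCoarseGraining (SimpleGraph.mulCayley S)
              (FactorIID.clust (SimpleGraph.mulCayley S) (FactorIID.firstBits n (f ω)))
              (p n ω)) ∧
          -- Bernoulli(1/2) percolation on the coarse-grained trees
          FactorIID.IsFairCellLabeling (FactorIID.iidUniform Γ) (FactorIID.past f p g n)
            (p n) (g n) ∧
          -- followed by merging of non-forking clusters into forking ones
          (∀ᵐ ω ∂(FactorIID.iidUniform Γ),
            FactorIID.IsMergeOf
              (FactorIID.clust (SimpleGraph.mulCayley S) (FactorIID.firstBits n (f ω)))
              (g n ω) (FactorIID.nextBit n (f ω))) ∧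
          (∀ᵐ ω ∂(FactorIID.iidUniform Γ), ∀ v, FactorIID.InForking
            (FactorIID.clust (SimpleGraph.mulCayley S) (FactorIID.firstBits (n + 1) (f ω))) v) := by
  refine ⟨⟨_, _, _, FactorIID.TripleInvolutions.isCubicTree_cayley⟩, fun Γ _ S hT => ?_⟩
  have hcount : Countable Γ := FactorIID.countable_of_connected hT.1.connected fun v =>
    Set.finite_of_encard_eq_coe (k := 3) (hT.2 v)
  have henc : Encodable Γ := Encodable.ofCountable Γ
  have hinv : FactorIID.IsTranslationInvariant (SimpleGraph.mulCayley S) :=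
    fun γ x y => SimpleGraph.mulCayley_adj_mul_iff_right
  have hac := hT.1.isAcyclic
  set T := SimpleGraph.mulCayley S
  have hreg := FactorIID.ae_digitMap (FactorIID.ae_isRegular hT hinv)
  have hnext : ∀ n, ∀ᵐ ω ∂(FactorIID.iidUniform Γ),
      FactorIID.nextBit n (FactorIID.label T (FactorIID.digitMap ω)) =
        FactorIID.bits T (FactorIID.digitMap ω) n := fun n => by
    filter_upwards [hreg] with ω hω using FactorIID.nextBit_label hω n
  have hfirst : ∀ n, ∀ᵐ ω ∂(FactorIID.iidUniform Γ),
      FactorIID.firstBits n (FactorIID.label T (FactorIID.digitMap ω)) =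
        fun v (i : Fin n) => FactorIID.bits T (FactorIID.digitMap ω) i v := fun n => by
    filter_upwards [hreg] with ω hω using FactorIID.firstBits_label hω n
  have hclust : ∀ n, ∀ᵐ ω ∂(FactorIID.iidUniform Γ),
      FactorIID.clust T (FactorIID.firstBits n (FactorIID.label T (FactorIID.digitMap ω))) =
        FactorIID.forest T (FactorIID.digitMap ω) n := fun n => by
    filter_upwards [hfirst n] with ω hω
    rw [hω, FactorIID.forest_eq_clust]
  have hgood := fun n => FactorIID.ae_digitMap (FactorIID.ae_goodStep hT hinv n)
  refine ⟨fun ω => FactorIID.label T (FactorIID.digitMap ω),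
    fun n ω => FactorIID.cells T (FactorIID.digitMap ω) n,
    fun n ω => FactorIID.cellBits T (FactorIID.digitMap ω) n, ⟨?_, ?_⟩, fun n => ⟨?_, ?_⟩,
    fun n => ⟨?_, ?_⟩, fun v => ?_, ?_, fun n => ⟨?_, fun v => ?_, fun v => ?_, ?_, ?_,
    FactorIID.isFairCellLabeling_cellBits hT hinv n, ?_, ?_⟩⟩
  · exact (FactorIID.measurable_label hac).comp FactorIID.measurable_digitMap
  · exact fun γ ω => funext fun v => FactorIID.label_shift hac hinv γ (FactorIID.digitMap ω) v
  · exact fun x y => FactorIID.measurable_digitMap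
      (measurableSet_setOfPred.2 (FactorIID.measurable_cells hac n x y))
  · exact fun γ ω => FactorIID.cells_shift (FactorIID.digitMap ω) hac hinv γ n
  · exact measurable_pi_lambda _ fun v =>
      (FactorIID.measurable_cellBits hac n v).comp FactorIID.measurable_digitMap
  · exact fun γ ω => funext fun v =>
      FactorIID.cellBits_shift (FactorIID.digitMap ω) hac hinv γ n v
  · have hm : Measurable fun z => FactorIID.label T z v :=
      (measurable_pi_apply v).comp (FactorIID.measurable_label hac)
    rw [← FactorIID.map_label hT hinv v, ← FactorIID.map_digitMap,
      Measure.map_map hm FactorIID.measurable_digitMap]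
    rfl
  · exact fun ω v => FactorIID.infinite_label_cluster hT _ v
  · have hm := FactorIID.measurable_bits_family (T := T) hT n
    have hm' : Measurable fun z v => !(FactorIID.bits T z n v) := measurable_pi_lambda _ fun v =>
      (measurable_from_top (f := not)).comp (FactorIID.measurable_bits hac n v)
    have h1 : (FactorIID.fair (Γ × ℕ)).map (fun z => FactorIID.bits T z n) =
        (FactorIID.fair (Γ × ℕ)).map (fun z v => !(FactorIID.bits T z n v)) := by
      refine Measure.ext fun A hA => ?_
      have := FactorIID.fair_inter_bits hT hinv (n := n) (@MeasurableSet.univ _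
        (FactorIID.invariantSpace (FactorIID.stepIndices Γ n))) hA
      rw [Set.univ_inter, Set.univ_inter] at this
      rw [Measure.map_apply hm hA, Measure.map_apply hm' hA]
      exact this
    rw [← FactorIID.map_digitMap, Measure.map_map hm FactorIID.measurable_digitMap,
      Measure.map_map hm' FactorIID.measurable_digitMap] at h1
    have h2 : (fun ω v => !(FactorIID.nextBit n (FactorIID.label T (FactorIID.digitMap ω)) v))
        =ᵐ[FactorIID.iidUniform Γ] fun ω v => !(FactorIID.bits T (FactorIID.digitMap ω) n v) := by
      filter_upwards [hnext n] with ω hω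
      rw [hω]
    exact (Measure.map_congr (hnext n)).trans (h1.trans (Measure.map_congr h2).symm)
  · have hm : MeasurableSet {z | FactorIID.bits T z n v = true} := measurableSet_setOfPred.2
      (FactorIID.measurable_eq_of_discrete (FactorIID.measurable_bits hac n v) measurable_const)
    have h1 := FactorIID.fair_inter_bit hT hinv (n := n) (@MeasurableSet.univ _
      (FactorIID.invariantSpace (FactorIID.stepIndices Γ n))) v true
    rw [Set.univ_inter, measure_univ, mul_one, ← FactorIID.iidUniform_preimage hm] at h1
    rw [one_div, ← h1]
    refine measure_congr ?_
    filter_upwards [hnext n] with ω hω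
    exact congrArg (fun L : Γ → Bool => L v = true) hω
  · refine (FactorIID.indepFun_bits hT hinv n v).congr ?_ ?_
    · filter_upwards [hnext n] with ω hω
      rw [hω]
    · filter_upwards [hfirst n] with ω hω
      rw [hω]
  · exact Eventually.of_forall fun ω => FactorIID.le_coarsen
  · filter_upwards [hclust n, hgood n] with ω hω h
    rw [hω]
    exact h.canCoarsen.isCoarseGraining (FactorIID.forest_isAcyclic _ hac n) h.finite
      (FactorIID.forest_le T _ n)
  · filter_upwards [hclust n, hnext n, hgood n] with ω hω hω' h
    rw [hω, hω']
    exact h.isMergeOf _ hT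
  · filter_upwards [hclust (n + 1), hgood n] with ω hω h
    rw [hω]
    exact h.inForking _ hT
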